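/- **Setting.** Let $n\ge 1$, let $B^0=(b^0_{ij})$ be an $n\times n$ integer matrix and $D=\operatorname{diag}(d_1,\dots,d_n)$ with positive integers $d_i$ such that $DB^0$ is skew-symmetric. Let $\mathbb T_n$ be the $n$-regular tree whose edges are labeled by $1,\dots,n$ so that the edges at each vertex have different labels; fix $t_0\in\mathbb T_n$. Write $[x]_+=\max(x,0)$. *Classical notions.* For an $m\times n$ integer matrix $\tilde B^0$ ($m\ge n$) with principal part (top $n$ rows) $B^0$, let $x_{j;t}\in\mathbb Q(x_1,\dots,x_m)$ ($j\in[1,n]$, $t\in\mathbb T_n$) be the cluster variables of the cluster algebra of geometric type whose seed at $t_0$ is $((x_1,\dots,x_m),\tilde B^0)$. For the principal matrix $\tilde B^0=\binom{B^0}{I}$ write $(x_1,\dots,x_n,y_1,\dots,y_n)$ for the initial extended cluster. The $F$-polynomial $F^{B^0;t_0}_{j;t}(u_1,\dots,u_n)$ is obtained from $x_{j;t}$ by setting $x_i=1$, $y_i=u_i$; the $\mathbf g$-vector $\mathbf g_{j;t}\in\mathbb Z^n$ is the degree of $x_{j;t}$, which is a homogeneous element of $\mathbb Z[x_i^{\pm1},y_i^{\pm1}]$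 for the grading $\deg x_i=\mathbf e_i$, $\deg y_j=-(j\text{-th column of }B^0)$. For general $\tilde B^0=(b^0_{ij})$ the extended $\mathbf g$-vector is the unique $\tilde{\mathbf g}_{j;t}=\tilde{\mathbf g}_{j;t}^{\tilde B^0;t_0}\in\mathbb Z^m$ with $x_{j;t}=F^{B^0;t_0}_{j;t}(\hat y_1,\dots,\hat y_n)\,x_1^{\tilde g_1}\cdots x_m^{\tilde g_m}$, where $\hat y_l=\prod_{i=1}^m x_i^{b^0_{il}}$. *Quantum notions.* For a lattice with integer skew-symmetric form, the based quantum torus is the $\mathbb Z[q^{\pm1/2}]$-algebra with basis $X^{\mathbf e}$ and $X^{\mathbf e}X^{\mathbf f}=q^{\Lambda(\mathbf e,\mathbf f)/2}X^{\mathbf e+\mathbf f}$; $\mathcal F$ is its skew field of fractions. A toric frame is a map $M(\mathbf c)=\varphi(X^{\eta(\mathbf c)})$ on $\mathbb Z^m$, with $\varphi$ a $\mathbb Z[q^{\pm1/2}]$-algebra automorphism of $\mathcal F$ and $\eta$ an isomorphism from $\mathbb Z^m$ to the lattice; $\Lambda_M$ is the transferred form. All quantum cluster algebras considered have a quantum seed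 $(M_0,\tilde B^0)$ at $t_0$ for which $\tilde B^0$ has principal part $B^0$ and $(\tilde B^0)^T\Lambda_{M_0}=(D\mid 0)$. The quantum seeds $(M_t,\tilde B^t)$, $t\in\mathbb T_n$, are obtained from it by mutation along the edges: in direction $k$ the matrix is mutated in the usual way and, for $c_k\ge0$, $M'(\mathbf c)=\sum_{p=0}^{c_k}\binom{c_k}{p}_{q^{d_k/2}}M(E\mathbf c+p\,\mathbf b^k)$, $M'(-\mathbf c)=M'(\mathbf c)^{-1}$, where $\mathbf b^k$ is the $k$-th column of the matrix $\tilde B=(b_{ij})$ being mutated, $E\mathbf e_i=\mathbf e_i$ for $i\ne k$, $E\mathbf e_k=-\mathbf e_k+\sum_{i\neq k}[-b_{ik}]_+\mathbf e_i$, and $\binom rp_v=\prod_{i=0}^{p-1}\frac{v^{r-i}-v^{-(r-i)}}{v^{i+1}-v^{-(i+1)}}$. The cluster variables are $X_{j;t}=M_t(\mathbf e_j)$, $j\in[1,n]$. Put $\hat Y_j=M_0(j\text{-th column of }\tilde B^0)$. For an $n\times n$ skew-symmetric integer matrix $\Lambda$, $\mathcal A_\bullet(B^0,D,\Lambda,t_0)$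 denotes the quantum cluster algebra with $\tilde B^0=\binom{B^0}{I}$ and $$\Lambda_{M_0}=\begin{pmatrix}\Lambda&-\Lambda B^0-D\\-(B^0)^T\Lambda+D&(B^0)^T\Lambda B^0+(B^0)^TD\end{pmatrix}.$$ Finally let $R$ be the quantum torus over $\mathbb Z[q^{\pm1/2}]$ generated by $Z_1^{\pm1},\dots,Z_n^{\pm1}$ with $Z_iZ_j=q^{d_ib^0_{ij}}Z_jZ_i$; $F(\hat Y)$ denotes the result of setting $Z_i=\hat Y_i$ in $F\in R$. **Theorem.** Let $j\in[1,n]$ and $t\in\mathbb T_n$. 1. There is a polynomial $F_{j;t}=F_{j;t}^{B^0;D;t_0}$ in $Z_1,\dots,Z_n$ with coefficients in $\mathbb Z[q^{\pm1/2}]$, not depending on $\Lambda$, such that for every $n\times n$ skew-symmetric integer matrix $\Lambda$ it is the unique such polynomial for which the cluster variable $X_{j;t}$ of $\mathcal A_\bullet(B^0,D,\Lambda,t_0)$ is $$X_{j;t}=F_{j;t}(\hat Y)\,M_0(\mathbf g_{j;t}),$$ where $\mathbf g_{j;t}$ is regarded as an element of $\mathbb Z^{2n}$ by appending $n$ zeros.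 2. Let $\tilde B^0$ be an $m\times n$ integer matrix with principal part $B^0$. There is $\lambda_{j;t}=\lambda_{j;t}^{\tilde B^0;t_0}\in\frac12\mathbb Z$ such that in every quantum cluster algebra as above (for the fixed $D$) whose exchange matrix at $t_0$ is $\tilde B^0$, $$X_{j;t}=q^{\lambda_{j;t}}F_{j;t}(\hat Y)\,M_0(\tilde{\mathbf g}_{j;t}^{\tilde B^0;t_0});$$ in particular $\lambda_{j;t}$ depends neither on the initial quasi-commutation matrix $\Lambda_{M_0}$ nor on the choice of the quantum cluster algebra. 3. Setting $q=1$ and $Z_i=u_i$ in $F_{j;t}$ gives the classical $F$-polynomial $F_{j;t}^{B^0;t_0}$. -/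

import Mathlib

namespace QCluster

open LaurentPolynomial

/-- The ring `ℤ[q^{±1/2}]`; the Laurent variable is `q^{1/2}`, so that `T a` is `q^{a/2}`. -/
abbrev QCoeff : Type := LaurentPolynomial ℤ

/-- The bilinear form on `ℤ^ι` with matrix `Λ`. -/
def latticeForm {ι : Type} [Fintype ι] (Λ : Matrix ι ι ℤ) (e f : ι → ℤ) : ℤ :=
  ∑ i, ∑ j, e i * Λ i j * f j

/-- The based quantum torus of `(ℤ^ι, Λ)`: the free `ℤ[q^{±1/2}]`-module on `X^e`, `e ∈ ℤ^ι`. -/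
def QTorus {ι : Type} [Fintype ι] (_Λ : Matrix ι ι ℤ) : Type := (ι → ℤ) →₀ QCoeff

namespace QTorus

noncomputable section

variable {ι : Type} [Fintype ι] {Λ : Matrix ι ι ℤ}

theorem form_add_left (e f g : ι → ℤ) :
    latticeForm Λ (e + f) g = latticeForm Λ e g + latticeForm Λ f g := by
  simp [latticeForm, add_mul, Finset.sum_add_distrib]

theorem form_add_right (e f g : ι → ℤ) :
    latticeForm Λ e (f + g) = latticeForm Λ e f + latticeForm Λ e g := by
  simp [latticeForm, mul_add, Finset.sum_add_distrib]

theorem form_zero_left (e : ι → ℤ) : latticeForm Λ 0 e = 0 := by simp [latticeForm]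

theorem form_zero_right (e : ι → ℤ) : latticeForm Λ e 0 = 0 := by simp [latticeForm]

instance : AddCommGroup (QTorus Λ) := inferInstanceAs (AddCommGroup ((ι → ℤ) →₀ QCoeff))

instance : Module QCoeff (QTorus Λ) := inferInstanceAs (Module QCoeff ((ι → ℤ) →₀ QCoeff))

/-- The coefficient of `X^e`. -/
def coeff (x : QTorus Λ) (e : ι → ℤ) : QCoeff := Finsupp.toFun x e

/-- The finite set of exponents `e` whose coefficient is nonzero. -/
def supp (x : QTorus Λ) : Finset (ι → ℤ) := Finsupp.support x

/-- The element `a X^e`. -/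
def mono (e : ι → ℤ) (a : QCoeff) : QTorus Λ := Finsupp.single e a

/-- The basis element `X^e`. -/
def X (e : ι → ℤ) : QTorus Λ := mono e 1

/-- `(a X^e)(b X^f) = a b q^{Λ(e,f)/2} X^{e+f}`, extended biadditively. -/
def mul (x y : QTorus Λ) : QTorus Λ :=
  Finsupp.sum x fun e a => Finsupp.sum y fun f b => mono (e + f) (a * b * T (latticeForm Λ e f))

instance : Mul (QTorus Λ) := ⟨mul⟩

instance : One (QTorus Λ) := ⟨X 0⟩

theorem mono_zero (e : ι → ℤ) : (mono e 0 : QTorus Λ) = 0 := Finsupp.single_zero e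

theorem mono_add (e : ι → ℤ) (a b : QCoeff) :
    (mono e (a + b) : QTorus Λ) = mono e a + mono e b := Finsupp.single_add e a b

theorem mono_mul_mono (e f : ι → ℤ) (a b : QCoeff) :
    (mono e a * mono f b : QTorus Λ) = mono (e + f) (a * b * T (latticeForm Λ e f)) := by
  change Finsupp.sum (Finsupp.single e a) (fun e a => Finsupp.sum (Finsupp.single f b)
    fun f b => (mono (e + f) (a * b * T (latticeForm Λ e f)) : QTorus Λ)) = _
  rw [Finsupp.sum_single_index, Finsupp.sum_single_index]
  · rw [mul_zero, zero_mul, mono_zero]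
  · rw [Finsupp.sum_single_index] <;> simp [mono_zero]

theorem induction {p : QTorus Λ → Prop} (x : QTorus Λ) (h0 : p 0)
    (hadd : ∀ x y, p x → p y → p (x + y)) (hm : ∀ e a, p (mono e a)) : p x :=
  Finsupp.induction_linear (motive := p) x h0 hadd hm

theorem mul_add_aux (x y z : QTorus Λ) : x * (y + z) = x * y + x * z := by
  change mul x (y + z) = mul x y + mul x z
  unfold mul
  refine Eq.trans ?_ Finsupp.sum_add
  refine Finsupp.sum_congr fun e _ => ?_
  exact Finsupp.sum_add_index' (h := fun f b => (mono (e + f)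
    (Finsupp.toFun x e * b * T (latticeForm Λ e f)) : QTorus Λ))
    (fun f => by rw [mul_zero, zero_mul, mono_zero])
    (fun f b b' => by rw [mul_add, add_mul, mono_add])

theorem add_mul_aux (x y z : QTorus Λ) : (x + y) * z = x * z + y * z := by
  refine Finsupp.sum_add_index' (f := x) (g := y) (h := fun e a => Finsupp.sum z fun f b =>
    (mono (e + f) (a * b * T (latticeForm Λ e f)) : QTorus Λ)) (fun e => ?_) (fun e a a' => ?_)
  · simp only [zero_mul, mono_zero]; exact Finset.sum_const_zero
  · simp only [add_mul, mono_add]; exact Finsupp.sum_add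

theorem zero_mul_aux (x : QTorus Λ) : 0 * x = 0 :=
  Finsupp.sum_zero_index (h := fun (e : ι → ℤ) (a : QCoeff) => Finsupp.sum x fun f b =>
    (mono (e + f) (a * b * T (latticeForm Λ e f)) : QTorus Λ))

theorem mul_zero_aux (x : QTorus Λ) : x * 0 = 0 :=
  Finset.sum_eq_zero fun _ _ => Finset.sum_empty

theorem mul_assoc_aux (x y z : QTorus Λ) : x * y * z = x * (y * z) := by
  refine induction (p := fun x => x * y * z = x * (y * z)) x (by simp only [zero_mul_aux])
    (fun _ _ h h' => by simp only [add_mul_aux, h, h']) fun e a => ?_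
  refine induction (p := fun y => mono e a * y * z = mono e a * (y * z)) y
    (by simp only [zero_mul_aux, mul_zero_aux])
    (fun _ _ h h' => by simp only [add_mul_aux, mul_add_aux, h, h']) fun f b => ?_
  refine induction (p := fun z => mono e a * mono f b * z = mono e a * (mono f b * z)) z
    (by simp only [mul_zero_aux])
    (fun _ _ h h' => by simp only [mul_add_aux, h, h']) fun g c => ?_
  simp only [mono_mul_mono, form_add_left, form_add_right, add_assoc, T_add]
  congr 1; ring

theorem one_mul_aux (x : QTorus Λ) : 1 * x = x := by
  refine induction (p := fun x => 1 * x = x) x (mul_zero_aux _)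
    (fun _ _ h h' => by simp only [mul_add_aux, h, h']) fun e a => ?_
  change mono 0 1 * mono e a = _
  rw [mono_mul_mono, form_zero_left]; simp

theorem mul_one_aux (x : QTorus Λ) : x * 1 = x := by
  refine induction (p := fun x => x * 1 = x) x (zero_mul_aux _)
    (fun _ _ h h' => by simp only [add_mul_aux, h, h']) fun e a => ?_
  change mono e a * mono 0 1 = _
  rw [mono_mul_mono, form_zero_right]; simp

instance : Ring (QTorus Λ) where
  __ := (inferInstance : AddCommGroup (QTorus Λ))
  mul := (· * ·)
  one := 1
  left_distrib := mul_add_aux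
  right_distrib := add_mul_aux
  zero_mul := zero_mul_aux
  mul_zero := mul_zero_aux
  mul_assoc := mul_assoc_aux
  one_mul := one_mul_aux
  mul_one := mul_one_aux

theorem smul_mono (r : QCoeff) (e : ι → ℤ) (a : QCoeff) :
    (r • mono e a : QTorus Λ) = mono e (r * a) := Finsupp.smul_single _ _ _

theorem smul_mul_aux (r : QCoeff) (x y : QTorus Λ) : r • x * y = r • (x * y) := by
  refine induction (p := fun x => r • x * y = r • (x * y)) x (by simp)
    (fun _ _ h h' => by simp only [add_mul, smul_add, h, h']) fun e a => ?_
  refine induction (p := fun y => r • mono e a * y = r • (mono e a * y)) y (by simp)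
    (fun _ _ h h' => by simp only [mul_add, smul_add, h, h']) fun f b => ?_
  simp only [mono_mul_mono, smul_mono]
  congr 1; ring

theorem mul_smul_aux (r : QCoeff) (x y : QTorus Λ) : x * r • y = r • (x * y) := by
  refine induction (p := fun x => x * r • y = r • (x * y)) x (by simp)
    (fun _ _ h h' => by simp only [add_mul, smul_add, h, h']) fun e a => ?_
  refine induction (p := fun y => mono e a * r • y = r • (mono e a * y)) y (by simp)
    (fun _ _ h h' => by simp only [mul_add, smul_add, h, h']) fun f b => ?_
  simp only [mono_mul_mono, smul_mono]
  congr 1; ring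

instance : Algebra QCoeff (QTorus Λ) := Algebra.ofModule smul_mul_aux mul_smul_aux

theorem X_mul_X (e f : ι → ℤ) :
    (X e * X f : QTorus Λ) = (T (latticeForm Λ e f) : QCoeff) • X (e + f) := by
  simp [X, mono_mul_mono, smul_mono]

theorem one_eq : (1 : QTorus Λ) = X 0 := rfl

instance : Nontrivial (QTorus Λ) :=
  ⟨⟨1, 0, fun h => by
    have := congrArg (fun x : QTorus Λ => x.coeff 0) h
    simp only [one_eq, X, mono, coeff] at this
    exact one_ne_zero ((Finsupp.single_eq_same (a := (0 : ι → ℤ)) (b := (1 : QCoeff))).symm.trans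
      this)⟩⟩

theorem coeff_add (x y : QTorus Λ) (e : ι → ℤ) : (x + y).coeff e = x.coeff e + y.coeff e := rfl

theorem coeff_sub (x y : QTorus Λ) (e : ι → ℤ) : (x - y).coeff e = x.coeff e - y.coeff e := rfl

theorem coeff_smul (a : QCoeff) (x : QTorus Λ) (e : ι → ℤ) :
    (a • x).coeff e = a * x.coeff e := rfl

theorem coeff_zero (e : ι → ℤ) : (0 : QTorus Λ).coeff e = 0 := rfl

theorem ext {x y : QTorus Λ} (h : ∀ e, x.coeff e = y.coeff e) : x = y := Finsupp.ext h

theorem mem_supp {x : QTorus Λ} {e : ι → ℤ} : e ∈ x.supp ↔ x.coeff e ≠ 0 := Finsupp.mem_support_iff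

theorem coeff_mono [DecidableEq ι] (e f : ι → ℤ) (a : QCoeff) :
    (mono e a : QTorus Λ).coeff f = if e = f then a else 0 :=
  Finsupp.single_apply

theorem eq_sum (x : QTorus Λ) : x = ∑ e ∈ x.supp, mono e (x.coeff e) :=
  (Finsupp.sum_single x).symm

theorem coeff_sum {α : Type*} (s : Finset α) (x : α → QTorus Λ) (e : ι → ℤ) :
    (∑ i ∈ s, x i).coeff e = ∑ i ∈ s, (x i).coeff e :=
  Finsupp.finsetSum_apply s x e

theorem mul_eq_sum (x y : QTorus Λ) : x * y = ∑ e ∈ x.supp, ∑ f ∈ y.supp,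
    mono (e + f) (x.coeff e * y.coeff f * T (latticeForm Λ e f)) := by
  conv_lhs => rw [eq_sum x, eq_sum y]
  simp only [Finset.sum_mul, Finset.mul_sum, mono_mul_mono]
  exact Finset.sum_comm

open Classical in
theorem coeff_mul (x y : QTorus Λ) (g : ι → ℤ) : (x * y).coeff g = ∑ e ∈ x.supp, ∑ f ∈ y.supp,
    if e + f = g then x.coeff e * y.coeff f * T (latticeForm Λ e f) else 0 := by
  rw [mul_eq_sum]
  simp only [coeff_sum, coeff_mono]

theorem T_ne_zero (a : ℤ) : (T a : QCoeff) ≠ 0 := (isUnit_T a).ne_zero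

instance : NoZeroDivisors (QTorus Λ) where
  eq_zero_or_eq_zero_of_mul_eq_zero {x y} h := by
    classical
    by_contra hne
    push Not at hne
    have hx : x.supp.Nonempty := Finsupp.support_nonempty_iff.2 hne.1
    have hy : y.supp.Nonempty := Finsupp.support_nonempty_iff.2 hne.2
    obtain ⟨e, he, f, hf, hu⟩ := UniqueSums.uniqueAdd_of_nonempty hx hy
    have h1 := congrArg (fun z : QTorus Λ => z.coeff (e + f)) h
    simp only [coeff_mul, coeff_zero] at h1
    rw [Finset.sum_eq_single e, Finset.sum_eq_single f, if_pos rfl] at h1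
    · exact mul_ne_zero (mul_ne_zero (mem_supp.1 he) (mem_supp.1 hf)) (T_ne_zero _) h1
    · intro f' hf' hne'
      rw [if_neg]
      intro heq
      exact hne' (hu he hf' heq).2
    · exact fun hn => absurd hf hn
    · intro e' he' hne'
      refine Finset.sum_eq_zero fun f' hf' => if_neg fun heq => hne' (hu he' hf' heq).1
    · exact fun hn => absurd he hn

/-- The exponents with all coordinates in `[-N, N]`. -/
def box (ι : Type) [Fintype ι] [DecidableEq ι] (N : ℕ) : Finset (ι → ℤ) :=
  Fintype.piFinset fun _ => Finset.Icc (-(N : ℤ)) N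

theorem card_box [DecidableEq ι] (N : ℕ) :
    (box ι N).card = (2 * N + 1) ^ Fintype.card ι := by
  simp only [box, Fintype.card_piFinset, Int.card_Icc, Finset.prod_const, Finset.card_univ]
  congr 1; omega

theorem exists_box [DecidableEq ι] (s : Finset (ι → ℤ)) : ∃ c : ℕ, s ⊆ box ι c := by
  refine ⟨∑ e ∈ s, ∑ i, (e i).natAbs, fun e he => ?_⟩
  rw [box, Fintype.mem_piFinset]
  intro i
  have h1 : (e i).natAbs ≤ ∑ i, (e i).natAbs :=
    Finset.single_le_sum (f := fun i => (e i).natAbs) (fun _ _ => Nat.zero_le _) (Finset.mem_univ i)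
  have h2 : ∑ i, (e i).natAbs ≤ ∑ e ∈ s, ∑ i, (e i).natAbs :=
    Finset.single_le_sum (f := fun e : ι → ℤ => ∑ i, (e i).natAbs) (fun _ _ => Nat.zero_le _) he
  rw [Finset.mem_Icc]; omega

theorem box_mono [DecidableEq ι] {M N : ℕ} (h : M ≤ N) : box ι M ⊆ box ι N := by
  intro e he
  simp only [box, Fintype.mem_piFinset, Finset.mem_Icc] at he ⊢
  intro i; have := he i; omega

theorem growth (m c : ℕ) :
    (2 * (2 * c * m + c) + 1) ^ m < 2 * (2 * (2 * c * m) + 1) ^ m := by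
  have hL : (0 : ℚ) < 2 * (2 * c * m + c) + 1 := by positivity
  have key := one_add_mul_le_pow (a := -(2 * c : ℚ) / (2 * (2 * c * m + c) + 1)) (by
    rw [le_div_iff₀ hL]
    have : (0 : ℚ) ≤ c * m := by positivity
    have : (0 : ℚ) ≤ c := by positivity
    nlinarith) m
  have h1 : (1 : ℚ) + -(2 * c : ℚ) / (2 * (2 * c * m + c) + 1)
      = (2 * (2 * c * m) + 1) / (2 * (2 * c * m + c) + 1) := by field_simp; ring
  rw [h1, div_pow] at key
  have h2 : (1 / 2 : ℚ) < 1 + m * (-(2 * c : ℚ) / (2 * (2 * c * m + c) + 1)) := by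
    rw [← sub_pos]
    have : (1 : ℚ) + m * (-(2 * c : ℚ) / (2 * (2 * c * m + c) + 1)) - 1 / 2
      = (2 * c + 1) / (2 * (2 * (2 * c * m + c) + 1)) := by field_simp; ring
    rw [this]; positivity
  have h3 := lt_of_lt_of_le h2 key
  rw [lt_div_iff₀ (by positivity)] at h3
  have h4 : ((2 * (2 * c * m + c) + 1 : ℕ) : ℚ) ^ m < 2 * ((2 * (2 * c * m) + 1 : ℕ) : ℚ) ^ m := by
    push_cast; linarith
  exact_mod_cast h4

theorem supp_mul_box [DecidableEq ι] {x y : QTorus Λ} {M N : ℕ} (hx : x.supp ⊆ box ι M)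
    (hy : y.supp ⊆ box ι N) {e : ι → ℤ} (he : e ∉ box ι (M + N)) : (x * y).coeff e = 0 := by
  rw [coeff_mul]
  refine Finset.sum_eq_zero fun f hf => Finset.sum_eq_zero fun g hg => if_neg ?_
  rintro rfl
  apply he
  have h1 := hx hf
  have h2 := hy hg
  simp only [box, Fintype.mem_piFinset, Finset.mem_Icc] at h1 h2 ⊢
  intro i; have := h1 i; have := h2 i; simp only [Pi.add_apply]; push_cast; omega

/-- The element with prescribed coefficients on a finite set. -/
def ofBox (s : Finset (ι → ℤ)) : (s → QCoeff) →ₗ[QCoeff] QTorus Λ where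
  toFun v := ∑ e, mono e.1 (v e)
  map_add' v w := by
    rw [← Finset.sum_add_distrib]
    exact Finset.sum_congr rfl fun e _ => Finsupp.single_add _ _ _
  map_smul' a v := by
    rw [RingHom.id_apply, Finset.smul_sum]
    exact Finset.sum_congr rfl fun e _ => (smul_mono _ _ _).symm

theorem coeff_ofBox (s : Finset (ι → ℤ)) (v : s → QCoeff) (e : s) :
    (ofBox s v : QTorus Λ).coeff e = v e := by
  classical
  change (∑ f : s, mono f.1 (v f) : QTorus Λ).coeff e = v e
  rw [coeff_sum]
  simp only [coeff_mono]
  rw [Finset.sum_eq_single e (fun f _ hf => if_neg fun h => hf (Subtype.ext h))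
    (fun h => absurd (Finset.mem_univ e) h), if_pos rfl]

theorem supp_ofBox (s : Finset (ι → ℤ)) (v : s → QCoeff) :
    (ofBox s v : QTorus Λ).supp ⊆ s := by
  classical
  intro e he
  rw [mem_supp] at he
  by_contra hs
  apply he
  change (∑ f : s, mono f.1 (v f) : QTorus Λ).coeff e = 0
  rw [coeff_sum]
  refine Finset.sum_eq_zero fun f _ => ?_
  rw [coeff_mono, if_neg]
  rintro rfl
  exact hs f.2

/-- The left Ore condition, by comparing the ranks of boxes of exponents. -/
theorem exists_ore (r s : QTorus Λ) (hs : s ≠ 0) :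
    ∃ x y : QTorus Λ, x ≠ 0 ∧ x * r = y * s := by
  classical
  obtain ⟨c, hc⟩ := exists_box (r.supp ∪ s.supp)
  have hr' : r.supp ⊆ box ι c := Finset.subset_union_left.trans hc
  have hs' : s.supp ⊆ box ι c := Finset.subset_union_right.trans hc
  let N := 2 * c * Fintype.card ι
  let S := box ι N
  let S' := box ι (N + c)
  let f : (S ⊕ S → QCoeff) →ₗ[QCoeff] (S' → QCoeff) :=
    { toFun := fun v e =>
        (ofBox S (fun i => v (.inl i)) * r - ofBox S (fun i => v (.inr i)) * s : QTorus Λ).coeff e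
      map_add' := fun v w => by
        funext e
        have h1 := map_add (ofBox (Λ := Λ) S) (fun i => v (.inl i)) (fun i => w (.inl i))
        have h2 := map_add (ofBox (Λ := Λ) S) (fun i => v (.inr i)) (fun i => w (.inr i))
        simp only [Pi.add_def] at h1 h2 ⊢
        rw [h1, h2, ← coeff_add]
        congr 1
        simp only [add_mul]; abel
      map_smul' := fun a v => by
        funext e
        have h1 := map_smul (ofBox (Λ := Λ) S) a (fun i => v (.inl i))
        have h2 := map_smul (ofBox (Λ := Λ) S) a (fun i => v (.inr i))
        simp only [Pi.smul_def, RingHom.id_apply] at h1 h2 ⊢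
        rw [h1, h2, smul_mul_assoc, smul_mul_assoc, ← smul_sub, coeff_smul, smul_eq_mul] }
  have hninj : ¬ Function.Injective f := by
    intro hinj
    have := card_le_of_injective QCoeff f hinj
    rw [Fintype.card_sum, Fintype.card_coe, Fintype.card_coe, card_box, card_box] at this
    have h' := growth (Fintype.card ι) c
    change _ + _ ≤ _ at this
    simp only [N] at this
    omega
  have hker : ∃ v, f v = 0 ∧ v ≠ 0 := by
    by_contra hcon
    push Not at hcon
    exact hninj ((injective_iff_map_eq_zero f).2 hcon)
  obtain ⟨v, hv, hv0⟩ := hker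
  have heq : (ofBox S (fun i => v (.inl i)) * r : QTorus Λ) = ofBox S (fun i => v (.inr i)) * s := by
    rw [← sub_eq_zero]
    refine ext fun e => ?_
    by_cases he : e ∈ S'
    · exact congrFun hv ⟨e, he⟩
    · rw [coeff_sub, supp_mul_box (supp_ofBox _ _) hr' he, supp_mul_box (supp_ofBox _ _) hs' he,
        sub_zero, coeff_zero]
  refine ⟨_, _, fun hx => hv0 ?_, heq⟩
  have hy : (ofBox S (fun i => v (.inr i)) : QTorus Λ) = 0 := by
    rw [hx, zero_mul] at heq
    exact (mul_eq_zero.1 heq.symm).resolve_right hs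
  funext i
  rcases i with i | i
  · have := coeff_ofBox (Λ := Λ) S (fun i => v (.inl i)) i
    rw [hx] at this
    exact this.symm
  · have := coeff_ofBox (Λ := Λ) S (fun i => v (.inr i)) i
    rw [hy] at this
    exact this.symm

instance instOreSet : OreLocalization.OreSet (nonZeroDivisors (QTorus Λ)) :=
  Classical.choice <| OreLocalization.nonempty_oreSet_iff_of_noZeroDivisors.2 fun r s => by
    obtain ⟨x, y, hx, h⟩ := exists_ore r s.1 (nonZeroDivisors.ne_zero s.2)
    exact ⟨y, ⟨x, mem_nonZeroDivisors_of_ne_zero hx⟩, h⟩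

end

end QTorus

/-- The skew field of fractions of the based quantum torus. -/
abbrev QField {ι : Type} [Fintype ι] (Λ : Matrix ι ι ℤ) : Type :=
  OreLocalization (nonZeroDivisors (QTorus Λ)) (QTorus Λ)

noncomputable section

/-- The element `q^{1/2}`, in any `ℤ[q^{±1/2}]`-algebra. -/
def qHalf (K : Type) [Ring K] [Algebra QCoeff K] : K := algebraMap QCoeff K (T 1)

/-! ### Elements of the torus in the variables `Z_i` -/

section Variables

variable {n : ℕ} {Λ : Matrix (Fin n) (Fin n) ℤ}

/-- `F` is a polynomial (not just a Laurent polynomial) in `Z_i = X^{e_i}`. -/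
def QTorus.IsPolynomial (F : QTorus Λ) : Prop := ∀ c ∈ F.supp, ∀ i, 0 ≤ c i

/-- The value of `F` when each `Z_i = X^{e_i}` is set to `y i`; here `X^c` equals
`q^{(1/2) ∑_{i<j} Λ_{ji} c_i c_j} Z_1^{c_1} ⋯ Z_n^{c_n}`. -/
def QTorus.evalAt {K : Type} [DivisionRing K] [Algebra QCoeff K] (F : QTorus Λ)
    (y : Fin n → K) : K :=
  ∑ c ∈ F.supp,
    algebraMap QCoeff K
      (F.coeff c * T (∑ i, ∑ j, if i < j then Λ j i * c i * c j else 0)) *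
      (List.ofFn fun i => y i ^ c i).prod

end Variables

/-! ### Classical cluster algebras of geometric type -/

/-- An extended exchange matrix: the rows `Sum.inl i` form the principal part, the rows
`Sum.inr i` belong to the `r = m - n` coefficient variables. -/
abbrev ExchangeMatrix (n r : ℕ) : Type := Matrix (Fin n ⊕ Fin r) (Fin n) ℤ

/-- Matrix mutation in direction `k`. -/
def mutMatrix {n r : ℕ} (k : Fin n) (B : ExchangeMatrix n r) : ExchangeMatrix n r :=
  fun i j =>
    if i = Sum.inl k ∨ j = k then -B i j
    else B i j + (B i k).sign * max (B i k * B (Sum.inl k) j) 0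

/-- The principal matrix of `B`: the identity matrix placed below `B`. -/
def principalMatrix {n : ℕ} (B : Matrix (Fin n) (Fin n) ℤ) : ExchangeMatrix n n :=
  Matrix.fromRows B 1

/-- The vertices of the `n`-regular tree `𝕋_n`. A vertex `t` is given by the sequence of labels of
the edges on the path from the initial vertex `t₀` (the empty sequence) to `t`; a sequence arises
in this way, for a unique `t`, if and only if no two consecutive labels are equal. -/
def TreeVertex (n : ℕ) : Type := {w : List (Fin n) // w.IsChain (· ≠ ·)}

/-- The field of rational functions over `ℚ` in the variables indexed by `σ`. -/
abbrev RatField (σ : Type) : Type := FractionRing (MvPolynomial σ ℤ)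

/-- The variable with index `i`, as a rational function. -/
def ratVar {σ : Type} (i : σ) : RatField σ :=
  algebraMap (MvPolynomial σ ℤ) (RatField σ) (MvPolynomial.X i)

/-- The value of a rational function at `v`, computed from its reduced fraction. -/
def evalRat {σ K : Type} [Field K] (v : σ → K) (f : RatField σ) : K :=
  MvPolynomial.aeval v (IsFractionRing.num (MvPolynomial σ ℤ) f) /
    MvPolynomial.aeval v (IsFractionRing.den (MvPolynomial σ ℤ) f : MvPolynomial σ ℤ)

/-- Mutation in direction `k` of the labeled seed with extended cluster `S.1` and exchange
matrix `S.2`. -/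
def mutSeed {n r : ℕ} {K : Type} [Field K] (k : Fin n)
    (S : (Fin n ⊕ Fin r → K) × ExchangeMatrix n r) : (Fin n ⊕ Fin r → K) × ExchangeMatrix n r :=
  (Function.update S.1 (Sum.inl k)
      ((S.1 (Sum.inl k))⁻¹ *
        (∏ i, S.1 i ^ max (S.2 i k) 0 + ∏ i, S.1 i ^ max (-S.2 i k) 0)),
    mutMatrix k S.2)

/-- The cluster variable `x_{j;t}` of the cluster algebra whose seed at `t₀` has exchange matrix
`B` and extended cluster the free variables `x_i`. -/
def clusterVar {n r : ℕ} (B : ExchangeMatrix n r) (t : TreeVertex n) (j : Fin n) :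
    RatField (Fin n ⊕ Fin r) :=
  (t.1.foldl (fun S k => mutSeed k S) (ratVar, B)).1 (Sum.inl j)

/-- The (classical) F-polynomial: in the cluster variable `x_{j;t}` of the cluster algebra with
principal coefficients, set `x_i = 1` and `y_i = u_i`. -/
def fPoly {n : ℕ} (B : Matrix (Fin n) (Fin n) ℤ) (t : TreeVertex n) (j : Fin n) :
    RatField (Fin n) :=
  evalRat (Sum.elim (fun _ => 1) ratVar) (clusterVar (principalMatrix B) t j)

/-- The `ℤ^n`-degree of the Laurent monomial with exponent `e` in `x_1, …, x_n, y_1, …, y_n`, for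
`deg x_i = e_i` and `deg y_j = -(j`-th column of `B)`. -/
def laurentDegree {n : ℕ} (B : Matrix (Fin n) (Fin n) ℤ) (e : Fin n ⊕ Fin n → ℤ) : Fin n → ℤ :=
  fun i => e (Sum.inl i) - ∑ j, B i j * e (Sum.inr j)

/-- `g` is the g-vector of `x_{j;t}`: the cluster variable `x_{j;t}` of the cluster algebra with
principal coefficients is a Laurent polynomial that is homogeneous of degree `g`. -/
def IsGVector {n : ℕ} (B : Matrix (Fin n) (Fin n) ℤ) (t : TreeVertex n) (j : Fin n)
    (g : Fin n → ℤ) : Prop :=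
  ∃ p : (Fin n ⊕ Fin n → ℤ) →₀ ℤ,
    clusterVar (principalMatrix B) t j
      = p.sum (fun e a => (a : RatField (Fin n ⊕ Fin n)) * ∏ i, ratVar i ^ e i) ∧
    ∀ e ∈ p.support, laurentDegree B e = g

/-- `g` is the extended g-vector of `x_{j;t}` for the initial exchange matrix `B`: one has
`x_{j;t} = F_{j;t}(ŷ_1, …, ŷ_n) x_1^{g_1} ⋯ x_m^{g_m}` with `ŷ_l = ∏_i x_i^{b_{il}}`. -/
def IsExtendedGVector {n r : ℕ} (B : ExchangeMatrix n r) (t : TreeVertex n) (j : Fin n)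
    (g : Fin n ⊕ Fin r → ℤ) : Prop :=
  clusterVar B t j
    = evalRat (fun l => ∏ i, ratVar i ^ B i l) (fPoly B.toRows₁ t j) * ∏ i, ratVar i ^ g i

/-! ### Quantum cluster algebras -/

section Quantum

variable {ι : Type} [Fintype ι] {L : Matrix ι ι ℤ}

/-- A toric frame `c ↦ φ(X^{η(c)})` in the skew field of fractions of the quantum torus of the
lattice `ℤ^ι` with form `L`. -/
structure ToricFrame (L : Matrix ι ι ℤ) where
  /-- the automorphism `φ` -/
  aut : QField L ≃ₐ[QCoeff] QField L
  /-- the lattice isomorphism `η` -/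
  lat : (ι → ℤ) ≃+ (ι → ℤ)

/-- The map underlying a toric frame. -/
def ToricFrame.map (M : ToricFrame L) (c : ι → ℤ) : QField L :=
  M.aut (OreLocalization.numeratorRingHom (QTorus.X (M.lat c)))

/-- The matrix `Λ_M` of the form on `ℤ^ι` transferred by `η`. -/
def ToricFrame.form [DecidableEq ι] (M : ToricFrame L) : Matrix ι ι ℤ :=
  fun i j => latticeForm L (M.lat (Pi.single i 1)) (M.lat (Pi.single j 1))

end Quantum

/-- The pair `(Λ, B)` is compatible, with `Bᵀ Λ = (D | 0)` for the diagonal matrix `D` of `d`. -/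
def IsCompatible {n r : ℕ} (d : Fin n → ℤ) (Λ : Matrix (Fin n ⊕ Fin r) (Fin n ⊕ Fin r) ℤ)
    (B : ExchangeMatrix n r) : Prop :=
  Λ.transpose = -Λ ∧ B.transpose * Λ = Matrix.fromCols (Matrix.diagonal d) 0

/-- The `t`-binomial coefficient
`(t^r - t^{-r}) ⋯ (t^{r-p+1} - t^{-(r-p+1)}) / ((t^p - t^{-p}) ⋯ (t - t^{-1}))`. -/
def tBinomial {K : Type} [DivisionRing K] (t : K) (r : ℤ) (p : ℕ) : K :=
  ((List.range p).map fun i =>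
    (t ^ (r - i) - t ^ (-(r - i))) / (t ^ ((i : ℤ) + 1) - t ^ (-((i : ℤ) + 1)))).prod

/-- The matrix `E_ε` for the sign `ε = +1`. -/
def mutE {n r : ℕ} (k : Fin n) (B : ExchangeMatrix n r) :
    Matrix (Fin n ⊕ Fin r) (Fin n ⊕ Fin r) ℤ :=
  fun i j =>
    if j ≠ Sum.inl k then (if i = j then 1 else 0)
    else if i = j then -1 else max 0 (-B i k)

/-- Mutation in direction `k` of the toric frame `M` of a quantum seed `(M, B)`; the formula is
that for the sign `ε = +1`, the result does not depend on the sign. -/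
def mutFrame {n r : ℕ} {K : Type} [DivisionRing K] [Algebra QCoeff K] (d : Fin n → ℤ)
    (k : Fin n) (B : ExchangeMatrix n r) (M : (Fin n ⊕ Fin r → ℤ) → K) :
    (Fin n ⊕ Fin r → ℤ) → K :=
  let pos : (Fin n ⊕ Fin r → ℤ) → K := fun c =>
    ∑ p ∈ Finset.range ((c (Sum.inl k)).toNat + 1),
      tBinomial (qHalf K ^ d k) (c (Sum.inl k)) p *
        M ((mutE k B).mulVec c + (p : ℤ) • fun i => B i k)
  fun c => if 0 ≤ c (Sum.inl k) then pos c else (pos (-c))⁻¹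

/-- Mutation in direction `k` of the quantum seed `S = (M, B)`. -/
def mutQuantumSeed {n r : ℕ} {K : Type} [DivisionRing K] [Algebra QCoeff K] (d : Fin n → ℤ)
    (k : Fin n) (S : ((Fin n ⊕ Fin r → ℤ) → K) × ExchangeMatrix n r) :
    ((Fin n ⊕ Fin r → ℤ) → K) × ExchangeMatrix n r :=
  (mutFrame d k S.2 S.1, mutMatrix k S.2)

/-- The cluster variable `X_{j;t} = M_t(e_j)` of the quantum cluster algebra whose quantum seed at
`t₀` is `(M, B)`. -/
def quantumVar {n r : ℕ} {L : Matrix (Fin n ⊕ Fin r) (Fin n ⊕ Fin r) ℤ} (d : Fin n → ℤ)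
    (M : ToricFrame L) (B : ExchangeMatrix n r) (t : TreeVertex n) (j : Fin n) : QField L :=
  (t.1.foldl (fun S k => mutQuantumSeed d k S) (M.map, B)).1 (Pi.single (Sum.inl j) 1)

/-- The elements `Ŷ_j = M(b^j)`, with `b^j` the `j`-th column of `B`. -/
def hatY {n r : ℕ} {L : Matrix (Fin n ⊕ Fin r) (Fin n ⊕ Fin r) ℤ} (M : ToricFrame L)
    (B : ExchangeMatrix n r) (j : Fin n) : QField L :=
  M.map fun i => B i j

/-- The form at `t₀` of the quantum cluster algebra with principal coefficients whose initial
cluster variables quasi-commute according to `Λ`. -/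
def principalForm {n : ℕ} (d : Fin n → ℤ) (B Λ : Matrix (Fin n) (Fin n) ℤ) :
    Matrix (Fin n ⊕ Fin n) (Fin n ⊕ Fin n) ℤ :=
  Matrix.fromBlocks Λ (-(Λ * B) - Matrix.diagonal d)
    (-(B.transpose * Λ) + Matrix.diagonal d)
    (B.transpose * Λ * B + B.transpose * Matrix.diagonal d)

/-- Setting `q = 1` and `Z_i = u_i`. -/
def QTorus.atOne {n : ℕ} {Λ : Matrix (Fin n) (Fin n) ℤ} (F : QTorus Λ) : RatField (Fin n) :=
  ∑ c ∈ F.supp,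
    ((LaurentPolynomial.eval₂ (RingHom.id ℤ) 1 (F.coeff c) : ℤ) : RatField (Fin n)) *
      ∏ i, ratVar i ^ c i

end

end QCluster

namespace QCluster

open LaurentPolynomial

noncomputable section

/-! ### Gaussian binomial coefficients -/

theorem tBinomial_map {k K : Type} [DivisionRing k] [DivisionRing K] (φ : k →+* K) (t : k) (r : ℤ)
    (p : ℕ) : tBinomial (φ t) r p = φ (tBinomial t r p) := by
  simp only [tBinomial, map_list_prod, List.map_map]
  congr 2
  funext i
  simp

theorem tBinomial_succ {K : Type} [DivisionRing K] (t : K) (r : ℤ) (p : ℕ) :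
    tBinomial t r (p + 1) = tBinomial t r p *
      ((t ^ (r - p) - t ^ (-(r - p))) / (t ^ ((p : ℤ) + 1) - t ^ (-((p : ℤ) + 1)))) := by
  simp [tBinomial, List.range_succ]

theorem tBinomial_zero_right {K : Type} [DivisionRing K] (t : K) (r : ℤ) :
    tBinomial t r 0 = 1 := by
  simp [tBinomial]

theorem tBinomial_eq_zero {K : Type} [DivisionRing K] (t : K) {r p : ℕ} (h : r < p) :
    tBinomial t r p = 0 := by
  unfold tBinomial
  rw [List.prod_eq_zero_iff]
  exact List.mem_map.2 ⟨r, by simpa using h, by simp⟩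

theorem tBinomial_succ_succ {k : Type} [Field k] (t : k) (r : ℤ) (p : ℕ) :
    tBinomial t (r + 1) (p + 1) = tBinomial t r p *
      ((t ^ (r + 1) - t ^ (-(r + 1))) / (t ^ ((p : ℤ) + 1) - t ^ (-((p : ℤ) + 1)))) := by
  induction p with
  | zero => simp [tBinomial]
  | succ p ih =>
    rw [tBinomial_succ, ih, tBinomial_succ t r p]
    have : r + 1 - ((p + 1 : ℕ) : ℤ) = r - p := by push_cast; ring
    rw [this]
    push_cast
    simp only [div_eq_mul_inv]
    ring

/-- After the common factor is cleared this is an identity between three pairs of powers of `t`. It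
drives the induction in the binomial theorem `dilog_eq_sum_tBinomial`. -/
theorem tBinomial_pascal {k : Type} [Field k] (t : k) (ht0 : t ≠ 0)
    (ht : ∀ p : ℕ, t ^ ((p : ℤ) + 1) - t ^ (-((p : ℤ) + 1)) ≠ 0) (r : ℤ) (p : ℕ) :
    tBinomial t (r + 1) (p + 1) * t ^ ((p : ℤ) + 1) =
      tBinomial t r (p + 1) + t ^ (r + 1) * tBinomial t r p := by
  rw [tBinomial_succ_succ, tBinomial_succ t r p]
  have h := ht p
  generalize tBinomial t r p = b
  rw [mul_div_assoc', mul_div_assoc', div_mul_eq_mul_div, div_add' _ _ _ h]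
  congr 1
  have e1 : t ^ (r + 1) * t ^ ((p : ℤ) + 1) = t ^ (r + p + 2) := by
    rw [← zpow_add₀ ht0]; congr 1; ring
  have e2 : t ^ (-(r + 1)) * t ^ ((p : ℤ) + 1) = t ^ (-(r - p)) := by
    rw [← zpow_add₀ ht0]; congr 1; ring
  have e3 : t ^ (r + 1) * t ^ (-((p : ℤ) + 1)) = t ^ (r - p) := by
    rw [← zpow_add₀ ht0]; congr 1; ring
  linear_combination b * e1 - b * e2 - b * e1 + b * e3

/-! ### Scalars -/

section Scalars

variable {K : Type} [DivisionRing K] [Algebra QCoeff K]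

theorem T_smul_T_smul {M : Type} [AddCommMonoid M] [Module QCoeff M] (a b : ℤ) (x : M) :
    (T a : QCoeff) • (T b : QCoeff) • x = (T (a + b) : QCoeff) • x := by
  rw [smul_smul, T_add]

theorem qHalf_zpow (a : ℤ) : qHalf K ^ a = algebraMap QCoeff K (T a) := by
  have hu : ∀ m : ℕ, qHalf K ^ m = algebraMap QCoeff K (T m) := fun m => by
    rw [qHalf, ← map_pow, T_pow]; simp
  cases a with
  | ofNat m => simpa using hu m
  | negSucc m =>
    rw [zpow_negSucc, hu]
    refine inv_eq_of_mul_eq_one_left ?_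
    rw [← map_mul, ← T_add]
    simp [Int.negSucc_eq]

theorem T_injective : Function.Injective (T : ℤ → QCoeff) := fun a b h => by
  simpa using congrArg degree h

variable [FaithfulSMul QCoeff K]

theorem algebraMap_T_injective : Function.Injective fun a : ℤ => algebraMap QCoeff K (T a) :=
  (FaithfulSMul.algebraMap_injective QCoeff K).comp T_injective

instance : Module.IsTorsionFree QCoeff K :=
  Module.isTorsionFree_iff_faithfulSMul.2 inferInstance

end Scalars


/-! ### The products `∏ (1 + q^{d (2i+1)/2} Y)` -/

section Dilog

variable {K : Type} [DivisionRing K] [Algebra QCoeff K]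

/-- The product of the factors `1 + q^{d (2i+1)/2} Y` for `0 ≤ i < a`; for `a < 0` the inverse of
the product over `a ≤ i < 0`. -/
def dilog (d : ℤ) (Y : K) : ℤ → K
  | Int.ofNat a => ((List.range a).map fun i : ℕ => 1 + (T (d * (2 * i + 1)) : QCoeff) • Y).prod
  | Int.negSucc a =>
    (((List.range (a + 1)).map fun i : ℕ => 1 + (T (-d * (2 * i + 1)) : QCoeff) • Y).prod)⁻¹

variable (d : ℤ) (Y : K)

@[simp] theorem dilog_zero : dilog d Y 0 = 1 := by
  change ((List.range 0).map _).prod = 1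
  simp

@[simp] theorem dilog_one : dilog d Y 1 = 1 + (T d : QCoeff) • Y := by
  change ((List.range 1).map _).prod = _
  simp

theorem dilog_natCast (a : ℕ) : dilog d Y a =
    ((List.range a).map fun i : ℕ => 1 + (T (d * (2 * i + 1)) : QCoeff) • Y).prod := rfl

theorem dilog_neg_natCast (a : ℕ) : dilog d Y (-a) =
    (((List.range a).map fun i : ℕ => 1 + (T (-d * (2 * i + 1)) : QCoeff) • Y).prod)⁻¹ := by
  cases a with
  | zero => simp
  | succ a => rfl

theorem dilog_map {K' : Type} [DivisionRing K'] [Algebra QCoeff K'] (f : K →+* K')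
    (hf : ∀ (a : ℤ) (x : K), f ((T a : QCoeff) • x) = (T a : QCoeff) • f x) (a : ℤ) :
    f (dilog d Y a) = dilog d (f Y) a := by
  cases a <;> simp [dilog, map_list_prod, Function.comp_def, hf]

variable {d Y}

theorem Commute.dilog_right {z : K} (h : Commute z Y) (d a : ℤ) : Commute z (dilog d Y a) := by
  have key : ∀ (e : ℤ) (m : ℕ), Commute z
      ((List.range m).map fun i : ℕ => 1 + (T (e * (2 * i + 1)) : QCoeff) • Y).prod := by
    intro e m
    refine Commute.list_prod_right _ _ fun x hx => ?_
    obtain ⟨i, -, rfl⟩ := List.mem_map.1 hx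
    exact (Commute.one_right z).add_right (h.smul_right _)
  cases a with
  | ofNat m => exact key d m
  | negSucc m => exact (key (-d) (m + 1)).inv_right₀

/-- One first order recursion covers both branches of the definition. Together with the value at `0`
it characterizes `dilog`, so the identities below need only one step each. -/
theorem dilog_add_one (hY : ∀ s : ℤ, 1 + (T s : QCoeff) • Y ≠ 0) (d a : ℤ) :
    dilog d Y (a + 1) = dilog d Y a * (1 + (T (d * (2 * a + 1)) : QCoeff) • Y) := by
  obtain ⟨m, rfl | rfl⟩ := a.eq_nat_or_neg
  · have : (m : ℤ) + 1 = ((m + 1 : ℕ) : ℤ) := by push_cast; ring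
    rw [this, dilog_natCast, dilog_natCast, List.range_succ]
    simp
  · cases m with
    | zero => simp
    | succ m =>
      have h1 : -((m + 1 : ℕ) : ℤ) + 1 = -(m : ℤ) := by push_cast; ring
      have h2 : d * (2 * -((m + 1 : ℕ) : ℤ) + 1) = -d * (2 * m + 1) := by push_cast; ring
      have hc : Commute (1 + (T (-d * (2 * m + 1)) : QCoeff) • Y) (dilog d Y (-m)) :=
        Commute.dilog_right
          ((Commute.one_left Y).add_left ((Commute.refl Y).smul_left _)) d _
      rw [h1, h2, dilog_neg_natCast _ _ (m + 1), List.range_succ, List.map_append,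
        List.prod_append, mul_inv_rev, ← dilog_neg_natCast]
      simp only [List.map_cons, List.map_nil, List.prod_cons, List.prod_nil, mul_one]
      rw [mul_assoc, ← hc.eq, ← mul_assoc, inv_mul_cancel₀ (hY _), one_mul]

theorem dilog_ne_zero (hY : ∀ s : ℤ, 1 + (T s : QCoeff) • Y ≠ 0) (d a : ℤ) :
    dilog d Y a ≠ 0 := by
  have key : ∀ (e : ℤ) (m : ℕ),
      ((List.range m).map fun i : ℕ => 1 + (T (e * (2 * i + 1)) : QCoeff) • Y).prod ≠ 0 := by
    intro e m h
    obtain ⟨i, -, h⟩ := List.mem_map.1 (List.prod_eq_zero_iff.1 h)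
    exact hY _ h
  cases a with
  | ofNat m => exact key d m
  | negSucc m => exact inv_ne_zero (key (-d) (m + 1))

/-- Two functions on `ℤ` satisfying the same invertible first order recursion agree. -/
theorem int_recursion_unique {K : Type} [DivisionRing K] {f g u : ℤ → K} (h0 : f 0 = g 0) (hu : ∀ a, u a ≠ 0)
    (hf : ∀ a, f (a + 1) = f a * u a) (hg : ∀ a, g (a + 1) = g a * u a) (a : ℤ) : f a = g a := by
  induction a using Int.induction_on with
  | zero => exact h0
  | succ i ih => rw [hf, hg, ih]
  | pred i ih =>
    have h1 := hf (-(i : ℤ) - 1)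
    have h2 := hg (-(i : ℤ) - 1)
    rw [sub_add_cancel] at h1 h2
    rw [h1, h2] at ih
    exact mul_right_cancel₀ (hu _) ih

theorem one_add_T_smul_smul_ne_zero (hY : ∀ s : ℤ, 1 + (T s : QCoeff) • Y ≠ 0) (c : ℤ) :
    ∀ s : ℤ, 1 + (T s : QCoeff) • (T c : QCoeff) • Y ≠ 0 := fun s => by
  rw [T_smul_T_smul]; exact hY _

theorem mul_dilog_of_mul_eq (hY : ∀ s : ℤ, 1 + (T s : QCoeff) • Y ≠ 0) {z : K} {s : ℤ}
    (h : z * Y = (T s : QCoeff) • (Y * z)) (d a : ℤ) :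
    z * dilog d Y a = dilog d ((T s : QCoeff) • Y) a * z := by
  refine int_recursion_unique (f := fun a => z * dilog d Y a)
    (g := fun a => dilog d ((T s : QCoeff) • Y) a * z)
    (u := fun a => 1 + (T (d * (2 * a + 1)) : QCoeff) • Y) (by simp) (fun a => hY _)
    (fun a => ?_) (fun a => ?_) a
  · rw [dilog_add_one hY, mul_assoc]
  · rw [dilog_add_one (one_add_T_smul_smul_ne_zero hY s), mul_assoc, mul_assoc]
    congr 1
    rw [mul_add z, add_mul 1, mul_one, one_mul, mul_smul_comm, h, smul_mul_assoc, smul_mul_assoc]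

/-- The factors with index `≥ a` are those with index `≥ 0` after rescaling `Y` by `q^{d a}`. Moving
a frame value past `dilog` causes a rescaling of the same kind, which makes mutated frames
multiplicative. -/
theorem dilog_add (hY : ∀ s : ℤ, 1 + (T s : QCoeff) • Y ≠ 0) (d a b : ℤ) :
    dilog d Y (a + b) = dilog d Y a * dilog d ((T (2 * d * a) : QCoeff) • Y) b := by
  refine int_recursion_unique (f := fun b => dilog d Y (a + b))
    (g := fun b => dilog d Y a * dilog d ((T (2 * d * a) : QCoeff) • Y) b)
    (u := fun b => 1 + (T (d * (2 * (a + b) + 1)) : QCoeff) • Y) (by simp) (fun a => hY _)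
    (fun b => ?_) (fun b => ?_) b
  · rw [← add_assoc, dilog_add_one hY]
  · rw [dilog_add_one (one_add_T_smul_smul_ne_zero hY _), T_smul_T_smul, ← mul_assoc]
    have : d * (2 * b + 1) + 2 * d * a = d * (2 * (a + b) + 1) := by ring
    rw [this]

theorem one_add_T_smul_inv_ne_zero (hY0 : Y ≠ 0) (hY : ∀ s : ℤ, 1 + (T s : QCoeff) • Y ≠ 0) :
    ∀ s : ℤ, 1 + (T s : QCoeff) • Y⁻¹ ≠ 0 := fun s h => by
  apply hY (-s)
  have : (1 + (T s : QCoeff) • Y⁻¹) * ((T (-s) : QCoeff) • Y) = 0 := by rw [h, zero_mul]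
  rw [add_mul, one_mul, smul_mul_smul_comm, ← T_add, inv_mul_cancel₀ hY0] at this
  rw [add_comm]
  simpa using this

/-- Each factor satisfies `1 + sY = (1 + s⁻¹Y⁻¹) sY`. This is the source of the independence of
mutation from the choice of sign. -/
theorem dilog_inv (hY0 : Y ≠ 0) (hY : ∀ s : ℤ, 1 + (T s : QCoeff) • Y ≠ 0) (d a : ℤ) :
    dilog (-d) Y⁻¹ a * ((T (d * a ^ 2) : QCoeff) • Y ^ a) = dilog d Y a := by
  refine int_recursion_unique
    (f := fun a => dilog (-d) Y⁻¹ a * ((T (d * a ^ 2) : QCoeff) • Y ^ a))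
    (g := fun a => dilog d Y a)
    (u := fun a => 1 + (T (d * (2 * a + 1)) : QCoeff) • Y) (by simp) (fun a => hY _)
    (fun a => ?_) (fun a => dilog_add_one hY d a) a
  rw [dilog_add_one (one_add_T_smul_inv_ne_zero hY0 hY), mul_assoc, mul_assoc]
  congr 1
  rw [add_mul 1, one_mul, mul_add _ 1, mul_one, smul_mul_smul_comm, smul_mul_smul_comm, ← T_add,
    ← T_add, ← zpow_add_one₀ hY0, add_comm a 1, zpow_one_add₀ hY0, inv_mul_cancel_left₀ hY0,
    add_comm]
  have h1 : -d * (2 * a + 1) + d * (1 + a) ^ 2 = d * a ^ 2 := by ring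
  have h2 : d * (1 + a) ^ 2 = d * a ^ 2 + d * (2 * a + 1) := by ring
  rw [h1, h2]

theorem dilog_neg_mul (hY : ∀ s : ℤ, 1 + (T s : QCoeff) • Y ≠ 0) (d a : ℤ) :
    dilog (-d) Y a * dilog d Y (-a) = 1 := by
  obtain ⟨m, rfl | rfl⟩ := a.eq_nat_or_neg
  · rw [dilog_neg_natCast, ← dilog_natCast, mul_inv_cancel₀ (dilog_ne_zero hY _ _)]
  · rw [dilog_neg_natCast, neg_neg, neg_neg, ← dilog_natCast,
      inv_mul_cancel₀ (dilog_ne_zero hY _ _)]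

/-- The element `q^{d/2}` of the center. -/
def centralQ (K : Type) [DivisionRing K] [Algebra QCoeff K] (d : ℤ) : Subring.center K :=
  ⟨algebraMap QCoeff K (T d), Subring.mem_center_iff.2 fun x => (Algebra.commutes _ x).symm⟩

theorem coe_centralQ_zpow (d m : ℤ) :
    ((centralQ K d ^ m : Subring.center K) : K) = algebraMap QCoeff K (T (d * m)) := by
  have : ((centralQ K d ^ m : Subring.center K) : K) = (algebraMap QCoeff K (T d)) ^ m :=
    map_zpow₀ (Subring.center K).subtype _ _
  rw [this, ← qHalf_zpow, ← zpow_mul, qHalf_zpow]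

variable [FaithfulSMul QCoeff K]

/-- The denominators of the binomial coefficients do not vanish, since `q` is not a root of unity in
a faithful algebra. -/
theorem centralQ_zpow_sub_ne_zero {d : ℤ} (hd : d ≠ 0) (p : ℕ) :
    centralQ K d ^ ((p : ℤ) + 1) - centralQ K d ^ (-((p : ℤ) + 1)) ≠ 0 := fun h => by
  have h1 := congrArg (Subtype.val : Subring.center K → K) (sub_eq_zero.1 h)
  simp only [coe_centralQ_zpow] at h1
  have h2 := mul_left_cancel₀ hd (algebraMap_T_injective h1)
  omega

/-- The quantum binomial theorem. Although `K` is noncommutative, the coefficients live in its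
center, which is a field, so the Pascal rule may be used there and then transported to `K`. -/
theorem dilog_eq_sum_tBinomial (hY : ∀ s : ℤ, 1 + (T s : QCoeff) • Y ≠ 0) {d : ℤ} (hd : d ≠ 0)
    (a : ℕ) : dilog d Y a = ∑ p ∈ Finset.range (a + 1),
      tBinomial (qHalf K ^ d) (a : ℤ) p * ((T (d * a * p) : QCoeff) • Y ^ p) := by
  have hv : qHalf K ^ d = (Subring.center K).subtype (centralQ K d) := qHalf_zpow d
  have hv0 : centralQ K d ≠ 0 := fun h => by
    have := congrArg (Subtype.val : Subring.center K → K) h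
    change algebraMap QCoeff K (T d) = 0 at this
    rw [map_eq_zero_iff _ (FaithfulSMul.algebraMap_injective QCoeff K)] at this
    exact QTorus.T_ne_zero d this
  have hz : ∀ m : ℤ, (Subring.center K).subtype (centralQ K d ^ m) =
      algebraMap QCoeff K (T (d * m)) := coe_centralQ_zpow d
  simp only [hv, tBinomial_map]
  set b : ℕ → ℕ → K := fun a p => (Subring.center K).subtype (tBinomial (centralQ K d) a p) with hb
  have hpascal : ∀ a p : ℕ, (T (d * (p + 1)) : QCoeff) • b (a + 1) (p + 1) =
      b a (p + 1) + (T (d * (a + 1)) : QCoeff) • b a p := by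
    intro a p
    have := congrArg (Subring.center K).subtype
      (tBinomial_pascal (centralQ K d) hv0 (centralQ_zpow_sub_ne_zero hd) a p)
    rw [map_mul, map_add, map_mul, hz, hz, ← Algebra.commutes, ← Algebra.smul_def,
      ← Algebra.smul_def] at this
    simpa [hb] using this
  have hb0 : ∀ a, b a 0 = 1 := fun a => by simp [hb, tBinomial_zero_right]
  have hbtop : ∀ a, b a (a + 1) = 0 := fun a => by simp [hb, tBinomial_eq_zero]
  change dilog d Y a = ∑ p ∈ Finset.range (a + 1), b a p * ((T (d * a * p) : QCoeff) • Y ^ p)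
  induction a with
  | zero => simp [hb0]
  | succ a ih =>
    -- The sum is shifted by one, with the term at `0` split off; the new top term vanishes because
    -- the binomial coefficient of `a` over `a + 1` is `0`.
    have hA : ∑ p ∈ Finset.range (a + 1), b a p * ((T (d * a * p) : QCoeff) • Y ^ p) =
        ∑ p ∈ Finset.range (a + 1),
          b a (p + 1) * ((T (d * a * (p + 1 : ℕ)) : QCoeff) • Y ^ (p + 1)) + 1 := by
      rw [Finset.sum_range_succ' _ a, Finset.sum_range_succ _ a, hbtop, zero_mul, add_zero]
      simp [hb0]
    have hB : b (a + 1) 0 * ((T (d * (a + 1 : ℕ) * (0 : ℕ)) : QCoeff) • Y ^ 0) = 1 := by simp [hb0]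
    rw [Finset.sum_range_succ' _ (a + 1), hB, Nat.cast_succ, dilog_add_one hY, ih, mul_add, mul_one,
      Finset.sum_mul, hA, add_right_comm, ← Finset.sum_add_distrib]
    congr 1
    refine Finset.sum_congr rfl fun p _ => ?_
    have e1 : d * ((a : ℤ) + 1) * ((p + 1 : ℕ) : ℤ) =
        d * (p + 1) + d * a * ((p + 1 : ℕ) : ℤ) := by push_cast; ring
    have e2 : d * (a : ℤ) * (p : ℤ) + d * (2 * a + 1) =
        d * (a + 1) + d * a * ((p + 1 : ℕ) : ℤ) := by push_cast; ring
    rw [e1, mul_assoc (b a p), smul_mul_smul_comm, ← T_add, e2, ← pow_succ, ← T_smul_T_smul,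
      ← T_smul_T_smul]
    generalize (T (d * a * (p + 1 : ℕ)) : QCoeff) • Y ^ (p + 1) = W
    rw [mul_smul_comm, mul_smul_comm, ← smul_mul_assoc, ← smul_mul_assoc, hpascal, add_mul]

end Dilog

/-! ### Exchange matrices -/

section Exchange

variable {n r : ℕ}

/-- The `l`-th column of an exchange matrix. -/
def col (B : ExchangeMatrix n r) (l : Fin n) : Fin n ⊕ Fin r → ℤ := fun i => B i l

/-- The standard basis vector with index `l` in the principal part. -/
abbrev basisVec (r : ℕ) (l : Fin n) : Fin n ⊕ Fin r → ℤ := Pi.single (Sum.inl l) 1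

/-- The lattice endomorphism with matrix `mutE k B`. -/
def eMap (k : Fin n) (B : ExchangeMatrix n r) (c : Fin n ⊕ Fin r → ℤ) : Fin n ⊕ Fin r → ℤ :=
  (mutE k B).mulVec c

theorem eMap_apply (k : Fin n) (B : ExchangeMatrix n r) (c : Fin n ⊕ Fin r → ℤ)
    (i : Fin n ⊕ Fin r) : eMap k B c i =
      if i = Sum.inl k then -c (Sum.inl k) else c i + max 0 (-B i k) * c (Sum.inl k) := by
  have h : ∀ j, mutE k B i j * c j = (if j = i then c j else 0) +
      (if j = Sum.inl k then (if i = Sum.inl k then -2 else max 0 (-B i k)) * c j else 0) := by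
    intro j
    unfold mutE
    by_cases hj : j = Sum.inl k
    · subst hj
      by_cases hi : i = Sum.inl k
      · subst hi; simp; ring
      · simp [hi, Ne.symm hi]
    · by_cases hi : i = j
      · subst hi; simp [hj]
      · simp [hj, hi, Ne.symm hi]
  simp only [eMap, Matrix.mulVec, dotProduct, h, Finset.sum_add_distrib, Finset.sum_ite_eq',
    Finset.mem_univ, if_true]
  by_cases hi : i = Sum.inl k
  · subst hi; simp; ring
  · simp [hi]

@[simp] theorem eMap_apply_self (k : Fin n) (B : ExchangeMatrix n r) (c : Fin n ⊕ Fin r → ℤ) :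
    eMap k B c (Sum.inl k) = -c (Sum.inl k) := by
  simp [eMap_apply]

theorem eMap_apply_of_ne {k : Fin n} (B : ExchangeMatrix n r) (c : Fin n ⊕ Fin r → ℤ)
    {i : Fin n ⊕ Fin r} (hi : i ≠ Sum.inl k) :
    eMap k B c i = c i + max 0 (-B i k) * c (Sum.inl k) := by
  simp [eMap_apply, hi]

theorem eMap_add (k : Fin n) (B : ExchangeMatrix n r) (c c' : Fin n ⊕ Fin r → ℤ) :
    eMap k B (c + c') = eMap k B c + eMap k B c' := Matrix.mulVec_add _ _ _

theorem eMap_neg (k : Fin n) (B : ExchangeMatrix n r) (c : Fin n ⊕ Fin r → ℤ) :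
    eMap k B (-c) = -eMap k B c := Matrix.mulVec_neg _ _

@[simp] theorem eMap_zero (k : Fin n) (B : ExchangeMatrix n r) : eMap k B 0 = 0 :=
  Matrix.mulVec_zero _

theorem eMap_of_eq_zero {k : Fin n} (B : ExchangeMatrix n r) {c : Fin n ⊕ Fin r → ℤ}
    (hc : c (Sum.inl k) = 0) : eMap k B c = c := by
  funext i
  rw [eMap_apply]
  split_ifs with h
  · rw [h, hc, neg_zero]
  · rw [hc, mul_zero, add_zero]

theorem eMap_eMap (k : Fin n) (B : ExchangeMatrix n r) (c : Fin n ⊕ Fin r → ℤ) :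
    eMap k B (eMap k B c) = c := by
  funext i
  by_cases h : i = Sum.inl k
  · subst h; simp
  · rw [eMap_apply_of_ne _ _ h, eMap_apply_of_ne _ _ h, eMap_apply_self]; ring

theorem eMap_neg_matrix (k : Fin n) (B : ExchangeMatrix n r) (hB : B (Sum.inl k) k = 0)
    (c : Fin n ⊕ Fin r → ℤ) :
    eMap k (-B) c = eMap k B c + c (Sum.inl k) • col B k := by
  funext i
  by_cases h : i = Sum.inl k
  · subst h; simp [col, hB]
  · simp only [Pi.add_apply, Pi.smul_apply, smul_eq_mul, col]
    rw [eMap_apply_of_ne _ _ h, eMap_apply_of_ne _ _ h]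
    have : max 0 (-(-B) i k) = max 0 (-B i k) + B i k := by
      simp only [Matrix.neg_apply]; omega
    rw [this]; ring

theorem mutMatrix_neg (k : Fin n) (B : ExchangeMatrix n r) :
    mutMatrix k (-B) = -mutMatrix k B := by
  funext i j
  simp only [mutMatrix, Matrix.neg_apply]
  split_ifs
  · rfl
  · rw [Int.sign_neg, neg_mul_neg]; ring

/-- In this form of matrix mutation the summand with `[-x]_+` is the one cancelled by the lattice
map `eMap`. -/
theorem sign_mul_max_mul (x y : ℤ) :
    x.sign * max (x * y) 0 = max 0 (-x) * y + max y 0 * x := by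
  rcases lt_trichotomy x 0 with hx | rfl | hx
  · rw [Int.sign_eq_neg_one_of_neg hx, max_eq_right (by omega : (0 : ℤ) ≤ -x)]
    rcases le_total y 0 with hy | hy
    · rw [max_eq_left (mul_nonneg_of_nonpos_of_nonpos hx.le hy), max_eq_right hy]; ring
    · rw [max_eq_right (mul_nonpos_of_nonpos_of_nonneg hx.le hy), max_eq_left hy]; ring
  · simp
  · rw [Int.sign_eq_one_of_pos hx, max_eq_left (by omega : -x ≤ (0 : ℤ))]
    rcases le_total y 0 with hy | hy
    · rw [max_eq_right (mul_nonpos_of_nonneg_of_nonpos hx.le hy), max_eq_right hy]; ring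
    · rw [max_eq_left (mul_nonneg hx.le hy), max_eq_left hy]; ring

/-- Since `a` and `b` have the same sign, `-x` and `y` have the same sign too, so both positive
parts are active or both vanish. -/
theorem mul_max_eq_mul_max {a b x y : ℤ} (hab : 0 < a * b) (h : a * x = -(b * y)) :
    a * max 0 (-x) = b * max y 0 := by
  have h1 : a * b * y = -(a ^ 2 * x) := by linear_combination a * h
  rcases le_total x 0 with hx | hx
  · have hy : 0 ≤ y := by
      by_contra hy
      have : a * b * y < 0 := mul_neg_of_pos_of_neg hab (not_le.1 hy)
      nlinarith [sq_nonneg a]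
    rw [max_eq_right (by omega : (0 : ℤ) ≤ -x), max_eq_left hy]
    linarith
  · have hy : y ≤ 0 := by
      by_contra hy
      have : 0 < a * b * y := mul_pos hab (not_le.1 hy)
      nlinarith [sq_nonneg a]
    rw [max_eq_left (by omega : -x ≤ (0 : ℤ)), max_eq_right hy, mul_zero, mul_zero]

theorem mutMatrix_apply_self_left (k : Fin n) (B : ExchangeMatrix n r) (l : Fin n) :
    mutMatrix k B (Sum.inl k) l = -B (Sum.inl k) l := by
  simp [mutMatrix]

theorem mutMatrix_apply_self_right (k : Fin n) (B : ExchangeMatrix n r) (i : Fin n ⊕ Fin r) :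
    mutMatrix k B i k = -B i k := by
  simp [mutMatrix]

theorem col_mutMatrix_self (k : Fin n) (B : ExchangeMatrix n r) :
    col (mutMatrix k B) k = -col B k := by
  funext i; exact mutMatrix_apply_self_right k B i

/-- Pulled back along the lattice map, the new columns are integer combinations of the old ones,
with coefficients from the principal part. Hence all later columns remain in the lattice spanned by
the initial columns. -/
theorem eMap_col_mutMatrix {k l : Fin n} (hl : l ≠ k) {B : ExchangeMatrix n r}
    (hB : B (Sum.inl k) k = 0) :
    eMap k B (col (mutMatrix k B) l) = col B l + max (B (Sum.inl k) l) 0 • col B k := by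
  funext i
  simp only [Pi.add_apply, Pi.smul_apply, smul_eq_mul]
  by_cases h : i = Sum.inl k
  · subst h
    rw [eMap_apply_self]
    simp [col, mutMatrix_apply_self_left, hB]
  · rw [eMap_apply_of_ne _ _ h]
    simp only [col, mutMatrix_apply_self_left]
    simp only [mutMatrix, h, hl, or_self, if_false]
    rw [sign_mul_max_mul]; ring

theorem eMap_col_self {k : Fin n} {B : ExchangeMatrix n r} (hB : B (Sum.inl k) k = 0) :
    eMap k B (col B k) = col B k := eMap_of_eq_zero B hB

theorem mutMatrix_mutMatrix (k : Fin n) (B : ExchangeMatrix n r) :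
    mutMatrix k (mutMatrix k B) = B := by
  funext i j
  by_cases h : i = Sum.inl k ∨ j = k
  · simp [mutMatrix, h]
  · have h' := h
    push Not at h'
    simp only [mutMatrix, if_false, h'.1, h'.2, or_true, if_true, or_false]
    rw [Int.sign_neg, neg_mul_neg]
    ring

end Exchange

/-! ### Abstract quantum seeds -/

/-- A quantum seed in a division ring `K`: the frame `M` satisfies
`M(c) M(c') = q^{ω(c,c')/2} M(c + c')` for the skew-symmetric form `ω` compatible with `B`. -/
structure QSeed {n r : ℕ} {K : Type} [DivisionRing K] [Algebra QCoeff K] (d : Fin n → ℤ)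
    (B : ExchangeMatrix n r) (ω : (Fin n ⊕ Fin r → ℤ) → (Fin n ⊕ Fin r → ℤ) → ℤ)
    (M : (Fin n ⊕ Fin r → ℤ) → K) : Prop where
  add_left : ∀ c c' e, ω (c + c') e = ω c e + ω c' e
  skew : ∀ c e, ω c e = -ω e c
  compat : ∀ l c, ω (col B l) c = d l * c (Sum.inl l)
  map_zero : M 0 = 1
  map_mul : ∀ c e, M c * M e = (T (ω c e) : QCoeff) • M (c + e)

namespace QSeed

variable {n r : ℕ} {K : Type} [DivisionRing K] [Algebra QCoeff K] {d : Fin n → ℤ}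
  {B : ExchangeMatrix n r} {ω : (Fin n ⊕ Fin r → ℤ) → (Fin n ⊕ Fin r → ℤ) → ℤ}
  {M : (Fin n ⊕ Fin r → ℤ) → K}

theorem add_right (S : QSeed d B ω M) (c e e' : Fin n ⊕ Fin r → ℤ) :
    ω c (e + e') = ω c e + ω c e' := by
  rw [S.skew, S.add_left, S.skew e, S.skew e']; ring

theorem zero_left (S : QSeed d B ω M) (e : Fin n ⊕ Fin r → ℤ) : ω 0 e = 0 := by
  simpa using S.add_left 0 0 e

theorem neg_left (S : QSeed d B ω M) (c e : Fin n ⊕ Fin r → ℤ) : ω (-c) e = -ω c e := by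
  have := S.add_left c (-c) e
  rw [add_neg_cancel, S.zero_left] at this
  linarith

theorem neg_right (S : QSeed d B ω M) (c e : Fin n ⊕ Fin r → ℤ) : ω c (-e) = -ω c e := by
  rw [S.skew, S.neg_left, S.skew e, neg_neg]

theorem zsmul_left (S : QSeed d B ω M) (a : ℤ) (c e : Fin n ⊕ Fin r → ℤ) :
    ω (a • c) e = a * ω c e := by
  let f : (Fin n ⊕ Fin r → ℤ) →+ ℤ :=
    { toFun := fun c => ω c e, map_zero' := S.zero_left e, map_add' := fun c c' => S.add_left c c' e }
  simpa [f] using map_zsmul f a c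

theorem zsmul_right (S : QSeed d B ω M) (a : ℤ) (c e : Fin n ⊕ Fin r → ℤ) :
    ω c (a • e) = a * ω c e := by
  rw [S.skew, S.zsmul_left, S.skew e]; ring

theorem self (S : QSeed d B ω M) (c : Fin n ⊕ Fin r → ℤ) : ω c c = 0 := by
  have := S.skew c c
  omega

theorem compat_right (S : QSeed d B ω M) (l : Fin n) (c : Fin n ⊕ Fin r → ℤ) :
    ω c (col B l) = -(d l * c (Sum.inl l)) := by
  rw [S.skew, S.compat]

/-- Compatibility evaluates `ω(b^l, b^k)` in two ways, and `ω` is skew. -/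
theorem skew_principal (S : QSeed d B ω M) (k l : Fin n) :
    d l * B (Sum.inl l) k = -(d k * B (Sum.inl k) l) := by
  have h1 := S.compat l (col B k)
  have h2 := S.compat k (col B l)
  rw [S.skew, h2] at h1
  exact h1.symm

theorem diag (S : QSeed d B ω M) {k : Fin n} (hd : d k ≠ 0) : B (Sum.inl k) k = 0 := by
  have := S.skew_principal k k
  have h2 : d k * B (Sum.inl k) k = 0 := by omega
  exact (mul_eq_zero.1 h2).resolve_left hd

theorem map_mul_neg (S : QSeed d B ω M) (c : Fin n ⊕ Fin r → ℤ) : M c * M (-c) = 1 := by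
  rw [S.map_mul, S.neg_right, S.self, add_neg_cancel, S.map_zero]; simp

theorem map_ne_zero (S : QSeed d B ω M) (c : Fin n ⊕ Fin r → ℤ) : M c ≠ 0 :=
  left_ne_zero_of_mul_eq_one (S.map_mul_neg c)

theorem map_neg (S : QSeed d B ω M) (c : Fin n ⊕ Fin r → ℤ) : M (-c) = (M c)⁻¹ :=
  (inv_eq_of_mul_eq_one_right (S.map_mul_neg c)).symm

theorem map_add (S : QSeed d B ω M) (c e : Fin n ⊕ Fin r → ℤ) :
    M (c + e) = (T (-ω c e) : QCoeff) • (M c * M e) := by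
  rw [S.map_mul, T_smul_T_smul]; simp

theorem map_nsmul (S : QSeed d B ω M) (a : ℕ) (c : Fin n ⊕ Fin r → ℤ) : M ((a : ℤ) • c) = M c ^ a := by
  induction a with
  | zero => simp [S.map_zero]
  | succ a ih =>
    rw [Nat.cast_succ, add_smul, one_smul, S.map_add, S.zsmul_left, S.self, ih, pow_succ]; simp

theorem map_zsmul (S : QSeed d B ω M) (a : ℤ) (c : Fin n ⊕ Fin r → ℤ) : M (a • c) = M c ^ a := by
  obtain ⟨m, rfl | rfl⟩ := a.eq_nat_or_neg
  · rw [S.map_nsmul, zpow_natCast]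
  · rw [neg_smul, S.map_neg, S.map_nsmul, zpow_neg, zpow_natCast]

theorem map_commute (S : QSeed d B ω M) (c e : Fin n ⊕ Fin r → ℤ) :
    M c * M e = (T (2 * ω c e) : QCoeff) • (M e * M c) := by
  rw [S.map_mul, S.map_mul, T_smul_T_smul, add_comm e c, S.skew e c]
  congr 2; ring

theorem map_mul_col (S : QSeed d B ω M) (c : Fin n ⊕ Fin r → ℤ) (k : Fin n) :
    M c * M (col B k) = (T (-(2 * d k * c (Sum.inl k))) : QCoeff) • (M (col B k) * M c) := by
  rw [S.map_commute, S.compat_right]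
  congr 2; ring

/-- Passing to `(-d, -B)` turns the mutation rule for sign `+1` into the one for sign `-1`. It also
reverses the signs of the exchange matrix, so case distinctions on these signs can be halved. -/
theorem flip (S : QSeed d B ω M) : QSeed (-d) (-B) ω M where
  add_left := S.add_left
  skew := S.skew
  compat l c := by
    have : col (-B) l = -col B l := rfl
    rw [this, S.neg_left, S.compat, Pi.neg_apply, neg_mul]
  map_zero := S.map_zero
  map_mul := S.map_mul

theorem map_eMap_neg_matrix (S : QSeed d B ω M) {k : Fin n} (hd : d k ≠ 0)
    (c : Fin n ⊕ Fin r → ℤ) : M (eMap k (-B) c) =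
      (T (d k * c (Sum.inl k) ^ 2) : QCoeff) • (M (col B k) ^ c (Sum.inl k) * M (eMap k B c)) := by
  rw [eMap_neg_matrix k B (S.diag hd), add_comm, S.map_add, S.map_zsmul, S.zsmul_left, S.compat,
    eMap_apply_self]
  congr 2; ring

/-! ### Mutation of a seed in closed form -/

variable [FaithfulSMul QCoeff K]

/-- Otherwise `M(b^k)` would be a scalar and hence central, but it commutes with `M(e_k)` only up to
`q^{d_k}`, and `d_k ≠ 0`. -/
theorem one_add_ne_zero (S : QSeed d B ω M) {k : Fin n} (hd : d k ≠ 0) (s : ℤ) :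
    1 + (T s : QCoeff) • M (col B k) ≠ 0 := fun h => by
  have h1 : (T s : QCoeff) • M (col B k) = -1 := by rw [eq_neg_iff_add_eq_zero, add_comm]; exact h
  have h2 := S.map_mul_col (basisVec r k) k
  have h3 : M (basisVec r k) * ((T s : QCoeff) • M (col B k)) =
      (T (-(2 * d k)) : QCoeff) • (((T s : QCoeff) • M (col B k)) * M (basisVec r k)) := by
    rw [mul_smul_comm, h2, smul_mul_assoc, smul_comm]; simp
  rw [h1, mul_neg, mul_one, neg_mul, one_mul, smul_neg, neg_inj] at h3
  have h4 : ((T (-(2 * d k)) : QCoeff) - T 0) • M (basisVec r k) = 0 := by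
    rw [sub_smul, ← h3]; simp
  have h5 := (smul_eq_zero.1 h4).resolve_right (S.map_ne_zero _)
  have h6 := T_injective (sub_eq_zero.1 h5)
  omega

theorem mutFrame_eq_of_nonneg (S : QSeed d B ω M) {k : Fin n} (hd : d k ≠ 0)
    {c : Fin n ⊕ Fin r → ℤ} (hc : 0 ≤ c (Sum.inl k)) :
    ∑ p ∈ Finset.range ((c (Sum.inl k)).toNat + 1),
      tBinomial (qHalf K ^ d k) (c (Sum.inl k)) p *
        M ((mutE k B).mulVec c + (p : ℤ) • fun i => B i k) =
      dilog (d k) (M (col B k)) (c (Sum.inl k)) * M (eMap k B c) := by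
  obtain ⟨a, ha⟩ := Int.eq_ofNat_of_zero_le hc
  rw [ha, dilog_eq_sum_tBinomial (S.one_add_ne_zero hd) hd, Int.toNat_natCast, Finset.sum_mul]
  refine Finset.sum_congr rfl fun p _ => ?_
  change _ * M (eMap k B c + (p : ℤ) • col B k) = _
  rw [mul_assoc, smul_mul_assoc, ← S.map_nsmul, S.map_mul, T_smul_T_smul, S.zsmul_left, S.compat,
    eMap_apply_self, ha, add_comm (eMap k B c)]
  -- The power of `q` in the binomial theorem cancels the one from `Y ^ p * M(E c)`, because `E c`
  -- has the exponent `-a` at `k`.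
  have : d k * a * p + p * (d k * -(a : ℤ)) = 0 := by ring
  rw [this]; simp

/-- For negative exponents the frame is defined by inversion; the cocycle identity at `c_k + (-c_k)
= 0` shows that the product formula inverts correctly. -/
theorem mutFrame_eq (S : QSeed d B ω M) {k : Fin n} (hd : d k ≠ 0) (c : Fin n ⊕ Fin r → ℤ) :
    mutFrame d k B M c = dilog (d k) (M (col B k)) (c (Sum.inl k)) * M (eMap k B c) := by
  unfold mutFrame
  simp only
  split_ifs with hc
  · exact S.mutFrame_eq_of_nonneg hd hc
  · rw [S.mutFrame_eq_of_nonneg (c := -c) hd (by simp only [Pi.neg_apply]; omega)]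
    refine inv_eq_of_mul_eq_one_left ?_
    rw [eMap_neg, ← mul_assoc, mul_assoc (dilog _ _ _),
      mul_dilog_of_mul_eq (S.one_add_ne_zero hd) (S.map_mul_col _ _), ← mul_assoc, mul_assoc,
      S.map_mul_neg, eMap_apply_self, mul_one]
    have h := dilog_add (S.one_add_ne_zero hd) (d k) (c (Sum.inl k)) (-c (Sum.inl k))
    rw [add_neg_cancel, dilog_zero] at h
    rw [h]
    congr 4
    ring

/-- The hypothesis says that all `d_k` have the same sign. Unlike positivity, it is preserved by
`flip`. -/
theorem ne_zero (hd : ∀ k l, 0 < d k * d l) (k : Fin n) : d k ≠ 0 :=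
  left_ne_zero_of_mul (hd k k).ne'

/-- The new form is the old one pulled back along `eMap`. Compatibility reduces to `d_l [-b_{lk}]_+
= d_k [b_{kl}]_+`, and multiplicativity to the cocycle identity of `dilog`. -/
theorem mutate (S : QSeed d B ω M) (hd : ∀ k l, 0 < d k * d l) (k : Fin n) :
    QSeed d (mutMatrix k B) (fun c e => ω (eMap k B c) (eMap k B e)) (mutFrame d k B M) where
  add_left c c' e := by rw [eMap_add, S.add_left]
  skew c e := S.skew _ _
  compat l c := by
    by_cases hl : l = k
    · subst hl
      rw [col_mutMatrix_self, eMap_neg, eMap_col_self (S.diag (ne_zero hd l)), S.neg_left, S.compat,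
        eMap_apply_self]
      ring
    · have hl' : (Sum.inl l : Fin n ⊕ Fin r) ≠ Sum.inl k := by simpa using hl
      rw [eMap_col_mutMatrix hl (S.diag (ne_zero hd k)), S.add_left, S.zsmul_left, S.compat, S.compat,
        eMap_apply_self, eMap_apply_of_ne _ _ hl']
      have h2 := mul_max_eq_mul_max (hd l k) (S.skew_principal k l)
      linear_combination c (Sum.inl k) * h2
  map_zero := by rw [S.mutFrame_eq (ne_zero hd k)]; simp [S.map_zero]
  map_mul c e := by
    rw [S.mutFrame_eq (ne_zero hd k), S.mutFrame_eq (ne_zero hd k), S.mutFrame_eq (ne_zero hd k), mul_assoc,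
      ← mul_assoc (M _), mul_dilog_of_mul_eq (S.one_add_ne_zero (ne_zero hd k)) (S.map_mul_col _ _),
      mul_assoc, S.map_mul, mul_smul_comm, mul_smul_comm, ← mul_assoc, eMap_apply_self, Pi.add_apply,
      dilog_add (S.one_add_ne_zero (ne_zero hd k)), eMap_add]
    congr 6
    ring

theorem mutFrame_flip (S : QSeed d B ω M) {k : Fin n} (hd : d k ≠ 0) :
    mutFrame (-d) k (-B) M = mutFrame d k B M := by
  funext c
  have hc : col (-B) k = -col B k := rfl
  rw [S.flip.mutFrame_eq (by simpa using hd), S.mutFrame_eq hd, S.map_eMap_neg_matrix hd,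
    ← smul_mul_assoc, ← mul_assoc, hc, S.map_neg, Pi.neg_apply,
    dilog_inv (S.map_ne_zero _) (S.one_add_ne_zero hd)]

/-- Perform the second mutation with the opposite sign. Its column is again `b^k`, on which both
frames agree because `b_kk = 0`; the two lattice maps are the same involution, and the two
dilogarithms are inverse to each other. -/
theorem mutFrame_mutFrame (S : QSeed d B ω M) (hd : ∀ k l, 0 < d k * d l) (k : Fin n) :
    mutFrame d k (mutMatrix k B) (mutFrame d k B M) = M := by
  funext c
  have hk := ne_zero hd k
  have h0 := S.diag hk
  have hcol : col (-mutMatrix k B) k = col B k := by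
    funext i; simp [col, mutMatrix_apply_self_right]
  have hE : ∀ c, eMap k (-mutMatrix k B) c = eMap k B c := fun c => by
    funext i
    simp only [eMap_apply, mutMatrix_apply_self_right, Matrix.neg_apply, neg_neg]
  have hY : mutFrame d k B M (col B k) = M (col B k) := by
    rw [S.mutFrame_eq hk, eMap_col_self h0]
    simp [col, h0]
  rw [← (S.mutate hd k).mutFrame_flip hk, (S.mutate hd k).flip.mutFrame_eq (by simpa using hk),
    hcol, hE, hY, S.mutFrame_eq hk, eMap_eMap, ← mul_assoc, eMap_apply_self, Pi.neg_apply,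
    dilog_neg_mul (S.one_add_ne_zero hk), one_mul]

end QSeed

/-! ### Weight spaces of conjugation -/

section Weights

variable {K : Type} [DivisionRing K] [Algebra QCoeff K]

/-- The weight space `{x | x Z = q^{l/2} Z x}`, for `Z ≠ 0`. -/
def wt (Z : K) (l : ℤ) : Submodule QCoeff K :=
  Module.End.eigenspace (LinearMap.mulLeft QCoeff Z⁻¹ * LinearMap.mulRight QCoeff Z) (T l)

/-- The span of the weight spaces of weight greater than `l`. -/
def wtAbove (Z : K) (l : ℤ) : Submodule QCoeff K := ⨆ m : ℤ, ⨆ _ : l < m, wt Z m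

variable {Z : K}

theorem mem_wt (hZ : Z ≠ 0) {l : ℤ} {x : K} :
    x ∈ wt Z l ↔ x * Z = (T l : QCoeff) • (Z * x) := by
  rw [wt, Module.End.mem_eigenspace_iff]
  simp only [Module.End.mul_apply, LinearMap.mulLeft_apply, LinearMap.mulRight_apply]
  rw [← mul_right_inj' hZ, mul_inv_cancel_left₀ hZ, mul_smul_comm]

theorem mul_mem_wt (hZ : Z ≠ 0) {l m : ℤ} {x y : K} (hx : x ∈ wt Z l) (hy : y ∈ wt Z m) :
    x * y ∈ wt Z (l + m) := by
  rw [mem_wt hZ] at *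
  rw [mul_assoc, hy, mul_smul_comm, ← mul_assoc, hx, smul_mul_assoc, T_smul_T_smul, mul_assoc,
    add_comm]

theorem wt_le_wtAbove {l m : ℤ} (h : l < m) : wt Z m ≤ wtAbove Z l :=
  le_iSup₂_of_le m h le_rfl

theorem wtAbove_induction {l : ℤ} {p : K → Prop} {x : K} (hx : x ∈ wtAbove Z l)
    (hm : ∀ m, l < m → ∀ y ∈ wt Z m, p y) (h0 : p 0) (hadd : ∀ y z, p y → p z → p (y + z)) :
    p x := by
  refine Submodule.iSup_induction _ (motive := p) hx (fun m y hy => ?_) h0 hadd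
  by_cases hl : l < m
  · rw [iSup_pos hl] at hy
    exact hm m hl y hy
  · rw [iSup_neg hl, Submodule.mem_bot] at hy
    rw [hy]; exact h0

theorem mul_wtAbove (hZ : Z ≠ 0) {l m : ℤ} {x y : K} (hx : x ∈ wt Z l) (hy : y ∈ wtAbove Z m) :
    x * y ∈ wtAbove Z (l + m) := by
  refine wtAbove_induction (p := fun y => x * y ∈ wtAbove Z (l + m)) hy (fun a ha y hy => ?_)
    (by simp) fun y z hy hz => by rw [mul_add]; exact add_mem hy hz
  exact wt_le_wtAbove (by omega) (mul_mem_wt hZ hx hy)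

theorem wtAbove_mul (hZ : Z ≠ 0) {l m : ℤ} {x y : K} (hx : x ∈ wtAbove Z l) (hy : y ∈ wt Z m) :
    x * y ∈ wtAbove Z (l + m) := by
  refine wtAbove_induction (p := fun x => x * y ∈ wtAbove Z (l + m)) hx (fun a ha x hx => ?_)
    (by simp) fun y z hy hz => by rw [add_mul]; exact add_mem hy hz
  exact wt_le_wtAbove (by omega) (mul_mem_wt hZ hx hy)

theorem wtAbove_anti {l m : ℤ} (h : l ≤ m) : wtAbove Z m ≤ wtAbove Z l :=
  iSup₂_le fun _ ha => wt_le_wtAbove (lt_of_le_of_lt h ha)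

theorem wtAbove_mul_wtAbove (hZ : Z ≠ 0) {l m : ℤ} {x y : K} (hx : x ∈ wtAbove Z l)
    (hy : y ∈ wtAbove Z m) : x * y ∈ wtAbove Z (l + m) := by
  refine wtAbove_induction (p := fun x => x * y ∈ wtAbove Z (l + m)) hx (fun a ha x hx => ?_)
    (by simp) fun y z hy hz => by rw [add_mul]; exact add_mem hy hz
  exact wtAbove_anti (by omega) (mul_wtAbove hZ hx hy)

/-- The component of lowest weight of `x` is a unit, with inverse in `A`. -/
def HasLowestUnit (A : Subalgebra QCoeff K) (Z x : K) : Prop :=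
  ∃ l z z', z ∈ wt Z l ∧ z' ∈ A ∧ z * z' = 1 ∧ x - z ∈ wtAbove Z l

theorem HasLowestUnit.one (hZ : Z ≠ 0) (A : Subalgebra QCoeff K) : HasLowestUnit A Z 1 :=
  ⟨0, 1, 1, (mem_wt hZ).2 (by simp), one_mem A, one_mul 1, by simp⟩

theorem HasLowestUnit.mul (hZ : Z ≠ 0) {A : Subalgebra QCoeff K} {x y : K}
    (hx : HasLowestUnit A Z x) (hy : HasLowestUnit A Z y) : HasLowestUnit A Z (x * y) := by
  obtain ⟨l, z, z', hz, hz', h1, h2⟩ := hx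
  obtain ⟨m, w, w', hw, hw', h3, h4⟩ := hy
  refine ⟨l + m, z * w, w' * z', mul_mem_wt hZ hz hw, mul_mem hw' hz', ?_, ?_⟩
  · rw [mul_assoc, ← mul_assoc w, h3, one_mul, h1]
  · have : x * y - z * w = (x - z) * (y - w) + (x - z) * w + z * (y - w) := by noncomm_ring
    rw [this]
    exact add_mem (add_mem (wtAbove_mul_wtAbove hZ h2 h4) (wtAbove_mul hZ h2 hw))
      (mul_wtAbove hZ hz h4)

theorem HasLowestUnit.pow (hZ : Z ≠ 0) {A : Subalgebra QCoeff K} {x : K}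
    (hx : HasLowestUnit A Z x) (m : ℕ) : HasLowestUnit A Z (x ^ m) := by
  induction m with
  | zero => rw [pow_zero]; exact HasLowestUnit.one hZ A
  | succ m ih => rw [pow_succ]; exact ih.mul hZ hx

/-- If `A` contains the weight components of its elements, `y ∈ A` has a unit as component of
lowest weight, and `x` is a finite sum of weight vectors, then `x y ∈ A` implies `x ∈ A`. -/
theorem mem_of_mul_mem_of_hasLowestUnit (hZ : Z ≠ 0) {A : Subalgebra QCoeff K}
    (hA : ∀ l, ∀ x ∈ wt Z l, ∀ y ∈ wtAbove Z l, x + y ∈ A → x ∈ A) {x y : K}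
    (hx : x ∈ ⨆ l, wt Z l) (hy : y ∈ A) (hy' : HasLowestUnit A Z y) (hxy : x * y ∈ A) :
    x ∈ A := by
  classical
  obtain ⟨f, hf, rfl⟩ := (Submodule.mem_iSup_iff_exists_finsupp _ _).1 hx
  rw [Finsupp.sum] at *
  obtain ⟨m, z, z', hz, hz', hzz, hyz⟩ := hy'
  generalize f.support = s at hxy ⊢
  clear hx
  induction s using Finset.induction_on_min with
  | empty => simp
  | insert a s ha ih =>
    have hna : a ∉ s := fun h => lt_irrefl _ (ha a h)
    rw [Finset.sum_insert hna] at hxy ⊢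
    -- With `a` the lowest weight left in `x`, the component of `x * y` of lowest weight `a + m` is
    -- `f a * z`. After division by the unit `z`, `f a` can be subtracted from `x`.
    have h1 : f a * z ∈ A := by
      refine hA (a + m) _ (mul_mem_wt hZ (hf a) hz)
        (f a * (y - z) + ∑ i ∈ s, (f i * z + f i * (y - z))) ?_ ?_
      · refine add_mem (mul_wtAbove hZ (hf a) hyz) (sum_mem fun i hi => add_mem ?_ ?_)
        · exact wt_le_wtAbove (by have := ha i hi; omega) (mul_mem_wt hZ (hf i) hz)
        · exact wtAbove_anti (by have := ha i hi; omega) (mul_wtAbove hZ (hf i) hyz)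
      · convert hxy using 1
        simp only [mul_sub, add_sub_cancel]
        rw [add_mul, Finset.sum_mul, ← add_assoc, add_sub_cancel]
    have h2 : f a ∈ A := by
      have := mul_mem h1 hz'
      rwa [mul_assoc, hzz, mul_one] at this
    refine add_mem h2 (ih ?_)
    have := sub_mem hxy (mul_mem h2 hy)
    rwa [add_mul, add_sub_cancel_left] at this

theorem dilog_mem {A : Subalgebra QCoeff K} {Y : K} (hY : Y ∈ A) (d : ℤ) (a : ℕ) :
    dilog d Y a ∈ A := by
  rw [dilog_natCast]
  refine list_prod_mem fun x hx => ?_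
  obtain ⟨i, -, rfl⟩ := List.mem_map.1 hx
  exact add_mem (one_mem A) (A.smul_mem hY _)

/-- Every term other than the constant `1` contains a positive power of `Y`; in the Laurent argument
this is what raises both the weight and the exponent at `j`. -/
theorem dilog_sub_one_mem (d : ℤ) (Y : K) (a : ℕ) :
    dilog d Y a - 1 ∈ Submodule.span QCoeff (Set.range fun p : ℕ => Y ^ (p + 1)) := by
  induction a with
  | zero => simp
  | succ a ih =>
    rw [dilog_natCast] at ih ⊢
    rw [List.range_succ, List.map_append, List.prod_append]
    generalize ((List.range a).map fun i : ℕ => 1 + (T (d * (2 * i + 1)) : QCoeff) • Y).prod = D at *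
    have : D * ([a].map fun i : ℕ => 1 + (T (d * (2 * i + 1)) : QCoeff) • Y).prod - 1 =
        (D - 1) + (T (d * (2 * a + 1)) : QCoeff) • ((D - 1) * Y) +
          (T (d * (2 * a + 1)) : QCoeff) • Y := by
      simp only [List.map_cons, List.map_nil, List.prod_cons, List.prod_nil, mul_one]
      rw [sub_mul, smul_sub, mul_add, mul_one, one_mul, mul_smul_comm]
      abel
    rw [this]
    refine add_mem (add_mem ih (Submodule.smul_mem _ _ ?_))
      (Submodule.smul_mem _ _ (Submodule.subset_span ⟨0, by simp⟩))
    refine Submodule.span_induction (p := fun x _ => x * Y ∈ Submodule.span QCoeff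
      (Set.range fun p : ℕ => Y ^ (p + 1))) ?_ (by simp) (fun x y _ _ hx hy => ?_)
      (fun b x _ hx => ?_) ih
    · rintro _ ⟨p, rfl⟩
      exact Submodule.subset_span ⟨p + 1, by simp [pow_succ]⟩
    · rw [add_mul]; exact add_mem hx hy
    · rw [smul_mul_assoc]; exact Submodule.smul_mem _ _ hx

variable [FaithfulSMul QCoeff K]

/-- These are eigenspaces of one linear operator for the pairwise distinct eigenvalues `T l`. -/
theorem iSupIndep_wt (Z : K) : iSupIndep (wt Z) :=
  (Module.End.eigenspaces_iSupIndep
    (LinearMap.mulLeft QCoeff Z⁻¹ * LinearMap.mulRight QCoeff Z)).comp T_injective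

end Weights

/-! ### The Laurent phenomenon -/

/-- The subalgebra generated by the values of a frame. -/
def laurent {K V : Type} [DivisionRing K] [Algebra QCoeff K] (M : V → K) : Subalgebra QCoeff K :=
  Algebra.adjoin QCoeff (Set.range M)

theorem map_mem_laurent {K V : Type} [DivisionRing K] [Algebra QCoeff K] (M : V → K) (c : V) :
    M c ∈ laurent M := Algebra.subset_adjoin ⟨c, rfl⟩

namespace QSeed

variable {n r : ℕ} {K : Type} [DivisionRing K] [Algebra QCoeff K] {d : Fin n → ℤ}
  {B : ExchangeMatrix n r} {ω : (Fin n ⊕ Fin r → ℤ) → (Fin n ⊕ Fin r → ℤ) → ℤ}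
  {M : (Fin n ⊕ Fin r → ℤ) → K}

/-- A product of two frame values is a scalar times a frame value, so their span is already a
subalgebra. -/
theorem mem_laurent_iff (S : QSeed d B ω M) {x : K} :
    x ∈ laurent M ↔ x ∈ Submodule.span QCoeff (Set.range M) := by
  constructor
  · intro hx
    have h1 : (1 : K) ∈ Submodule.span QCoeff (Set.range M) :=
      Submodule.subset_span ⟨0, S.map_zero⟩
    have h2 : ∀ x y, x ∈ Submodule.span QCoeff (Set.range M) →
        y ∈ Submodule.span QCoeff (Set.range M) → x * y ∈ Submodule.span QCoeff (Set.range M) := by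
      intro x y hx hy
      have := Submodule.mul_mem_mul hx hy
      rw [Submodule.span_mul_span] at this
      refine Submodule.span_le.2 ?_ this
      rintro _ ⟨_, ⟨c, rfl⟩, _, ⟨e, rfl⟩, rfl⟩
      change M c * M e ∈ _
      rw [S.map_mul]
      exact Submodule.smul_mem _ _ (Submodule.subset_span ⟨_, rfl⟩)
    exact Algebra.adjoin_le (S := Submodule.toSubalgebra _ h1 h2) Submodule.subset_span hx
  · exact fun hx => Algebra.span_le_adjoin _ _ hx

theorem laurent_induction (S : QSeed d B ω M) {p : K → Prop} {x : K} (hx : x ∈ laurent M)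
    (hM : ∀ c, p (M c)) (h0 : p 0) (hadd : ∀ x y, p x → p y → p (x + y))
    (hsmul : ∀ (a : QCoeff) x, p x → p (a • x)) : p x := by
  refine Submodule.span_induction (p := fun x _ => p x) ?_ h0 (fun x y _ _ => hadd x y)
    (fun a x _ => hsmul a x) (S.mem_laurent_iff.1 hx)
  rintro _ ⟨c, rfl⟩
  exact hM c

theorem map_mem_wt (S : QSeed d B ω M) (c e : Fin n ⊕ Fin r → ℤ) : M c ∈ wt (M e) (2 * ω c e) :=
  (mem_wt (S.map_ne_zero e)).2 (S.map_commute c e)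

theorem mem_iSup_wt (S : QSeed d B ω M) (e : Fin n ⊕ Fin r → ℤ) {x : K} (hx : x ∈ laurent M) :
    x ∈ ⨆ l, wt (M e) l :=
  S.laurent_induction (p := fun x => x ∈ ⨆ l, wt (M e) l) hx
    (fun c => Submodule.mem_iSup_of_mem _ (S.map_mem_wt c e)) (zero_mem _)
    (fun _ _ => add_mem) (fun a _ => Submodule.smul_mem _ a)

variable [FaithfulSMul QCoeff K]

/-- Frame values are weight vectors, so the Laurent ring contains the weight components of its
elements, and independence of the weight spaces identifies `x` as such a component. -/
theorem wt_component_mem (S : QSeed d B ω M) (e : Fin n ⊕ Fin r → ℤ) (l : ℤ) (x : K)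
    (hx : x ∈ wt (M e) l) (y : K) (hy : y ∈ wtAbove (M e) l) (hxy : x + y ∈ laurent M) :
    x ∈ laurent M := by
  have key : ∃ z ∈ laurent M, z ∈ wt (M e) l ∧ x + y - z ∈ ⨆ m, ⨆ _ : m ≠ l, wt (M e) m := by
    refine S.laurent_induction (p := fun u => ∃ z ∈ laurent M, z ∈ wt (M e) l ∧
      u - z ∈ ⨆ m, ⨆ _ : m ≠ l, wt (M e) m) hxy (fun c => ?_)
      ⟨0, zero_mem _, zero_mem _, by simp⟩ ?_ ?_
    · by_cases hc : 2 * ω c e = l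
      · exact ⟨M c, map_mem_laurent M c, hc ▸ S.map_mem_wt c e, by simp⟩
      · refine ⟨0, zero_mem _, zero_mem _, ?_⟩
        rw [sub_zero]
        exact (le_iSup₂_of_le (f := fun m (_ : m ≠ l) => wt (M e) m) _ hc le_rfl)
          (S.map_mem_wt c e)
    · rintro u v ⟨z, h1, h2, h3⟩ ⟨w, h4, h5, h6⟩
      exact ⟨z + w, add_mem h1 h4, add_mem h2 h5, by rw [add_sub_add_comm]; exact add_mem h3 h6⟩
    · rintro a u ⟨z, h1, h2, h3⟩
      exact ⟨a • z, Subalgebra.smul_mem _ h1 a, Submodule.smul_mem _ a h2, by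
        rw [← smul_sub]; exact Submodule.smul_mem _ a h3⟩
  obtain ⟨z, hz, hzl, hz'⟩ := key
  have h1 : wtAbove (M e) l ≤ ⨆ m, ⨆ _ : m ≠ l, wt (M e) m :=
    iSup₂_le fun m hm => le_iSup₂_of_le (f := fun m (_ : m ≠ l) => wt (M e) m) m hm.ne' le_rfl
  have h2 : x - z ∈ ⨆ m, ⨆ _ : m ≠ l, wt (M e) m := by
    have := sub_mem hz' (h1 hy)
    rwa [show x + y - z - y = x - z by abel] at this
  have h3 := (Submodule.disjoint_def.1 (iSupIndep_wt (M e) l)) _ (sub_mem hx hzl) h2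
  rw [sub_eq_zero.1 h3]
  exact hz

theorem mutFrame_of_eq_zero (S : QSeed d B ω M) {k : Fin n} (hd : d k ≠ 0)
    {c : Fin n ⊕ Fin r → ℤ} (hc : c (Sum.inl k) = 0) : mutFrame d k B M c = M c := by
  rw [S.mutFrame_eq hd, hc, eMap_of_eq_zero B hc, dilog_zero, one_mul]

theorem mutFrame_of_eq_one (S : QSeed d B ω M) {k : Fin n} (hd : d k ≠ 0)
    {c : Fin n ⊕ Fin r → ℤ} (hc : c (Sum.inl k) = 1) :
    mutFrame d k B M c = M (eMap k B c) + M (eMap k B c + col B k) := by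
  rw [S.mutFrame_eq hd, hc, dilog_one, add_mul, one_mul, smul_mul_assoc, S.map_mul, T_smul_T_smul,
    S.compat, eMap_apply_self, hc, add_comm (col B k)]
  simp

theorem mutFrame_mem_laurent (S : QSeed d B ω M) {k : Fin n} (hd : d k ≠ 0)
    {c : Fin n ⊕ Fin r → ℤ} (hc : 0 ≤ c (Sum.inl k)) : mutFrame d k B M c ∈ laurent M := by
  obtain ⟨a, ha⟩ := Int.eq_ofNat_of_zero_le hc
  rw [S.mutFrame_eq hd, ha]
  exact mul_mem (dilog_mem (map_mem_laurent M _) _ _) (map_mem_laurent M _)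

end QSeed

/-! ### Laurent elements in neighbouring seeds -/

namespace QSeed

variable {n r : ℕ} {K : Type} [DivisionRing K] [Algebra QCoeff K] {d : Fin n → ℤ}
  {B : ExchangeMatrix n r} {ω : (Fin n ⊕ Fin r → ℤ) → (Fin n ⊕ Fin r → ℤ) → ℤ}
  {M : (Fin n ⊕ Fin r → ℤ) → K}

/-- A Laurent polynomial in `M` becomes an element of `A` after multiplication by high powers of the
variables `j` and `k` if all monomials with nonnegative exponents at `j` and `k` lie in `A`. -/
theorem exists_pow_mul_mem (S : QSeed d B ω M) (A : Subalgebra QCoeff K) {j k : Fin n} (hjk : j ≠ k)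
    (hA : ∀ c, 0 ≤ c (Sum.inl j) → 0 ≤ c (Sum.inl k) → M c ∈ A) {x : K} (hx : x ∈ laurent M) :
    ∃ N : ℕ, x * (M (basisVec r j) ^ N * M (basisVec r k) ^ N) ∈ A := by
  -- Membership for all large exponents, rather than for one, is stable under sums.
  suffices h : ∃ N₀ : ℕ, ∀ N, N₀ ≤ N →
      x * (M (basisVec r j) ^ N * M (basisVec r k) ^ N) ∈ A by
    obtain ⟨N, hN⟩ := h
    exact ⟨N, hN N le_rfl⟩
  refine S.laurent_induction (p := fun x => ∃ N₀ : ℕ, ∀ N, N₀ ≤ N →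
      x * (M (basisVec r j) ^ N * M (basisVec r k) ^ N) ∈ A) hx (fun c => ?_)
      ⟨0, fun N _ => by simp⟩ ?_ ?_
  · refine ⟨(c (Sum.inl j)).natAbs + (c (Sum.inl k)).natAbs, fun N hN => ?_⟩
    rw [← S.map_nsmul, ← S.map_nsmul, S.map_mul, mul_smul_comm, S.map_mul]
    refine A.smul_mem (A.smul_mem (hA _ ?_ ?_) _) _
    · simp [hjk]; omega
    · simp [hjk.symm]; omega
  · rintro u v ⟨N, hN⟩ ⟨N', hN'⟩
    refine ⟨max N N', fun m hm => ?_⟩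
    rw [add_mul]
    exact add_mem (hN m ((le_max_left _ _).trans hm)) (hN' m ((le_max_right _ _).trans hm))
  · rintro a u ⟨N, hN⟩
    refine ⟨N, fun m hm => ?_⟩
    rw [smul_mul_assoc]
    exact A.smul_mem (hN m hm) a

/-- Monomials with nonnegative exponents at `j` and `k` lie in every subalgebra that contains the
variables `j`, `k` and the Laurent monomials in the other variables. -/
theorem map_mem_of_basisVec_mem (S : QSeed d B ω M) {A : Subalgebra QCoeff K} {j k : Fin n}
    (hjk : j ≠ k) (h0 : ∀ c, c (Sum.inl j) = 0 → c (Sum.inl k) = 0 → M c ∈ A)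
    (hj : M (basisVec r j) ∈ A) (hk : M (basisVec r k) ∈ A) {c : Fin n ⊕ Fin r → ℤ}
    (hcj : 0 ≤ c (Sum.inl j)) (hck : 0 ≤ c (Sum.inl k)) : M c ∈ A := by
  obtain ⟨a, ha⟩ := Int.eq_ofNat_of_zero_le hcj
  obtain ⟨b, hb⟩ := Int.eq_ofNat_of_zero_le hck
  have hc : c = (c - (a : ℤ) • basisVec r j - (b : ℤ) • basisVec r k) + (a : ℤ) • basisVec r j +
      (b : ℤ) • basisVec r k := by abel
  rw [hc, S.map_add, S.map_add, S.map_nsmul, S.map_nsmul]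
  refine A.smul_mem (mul_mem (A.smul_mem (mul_mem (h0 _ ?_ ?_) (pow_mem hj _)) _) (pow_mem hk _)) _
  · simp [hjk, ha]
  · simp [hjk.symm, hb]

variable [FaithfulSMul QCoeff K]

/-- The variables `j` and `k` of the third seed are Laurent in `M`, and their components of lowest
weight under conjugation by a power of `M(e_k)` are monomials of `M`. Multiplying `x` by high powers
of both clears the denominators from the third seed. Since `x` is Laurent in the first seed it is a
sum of weight vectors, so these powers can be divided out again by removing components of lowest
weight. -/
theorem laurent_inter_of_nonneg (S : QSeed d B ω M) (hd : ∀ k l, 0 < d k * d l) {j k : Fin n}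
    (hjk : j ≠ k) (hb : 0 ≤ mutMatrix j B (Sum.inl j) k) {x : K}
    (hx1 : x ∈ laurent (mutFrame d j B M))
    (hx3 : x ∈ laurent (mutFrame d j (mutMatrix k (mutMatrix j B))
      (mutFrame d k (mutMatrix j B) (mutFrame d j B M)))) : x ∈ laurent M := by
  have dj := ne_zero hd j
  have dk := ne_zero hd k
  have S1 := S.mutate hd j
  have hinv := S.mutFrame_mutFrame hd j
  have hL1 : ∀ c : Fin n ⊕ Fin r → ℤ, 0 ≤ c (Sum.inl j) → mutFrame d j B M c ∈ laurent M :=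
    fun c hc => S.mutFrame_mem_laurent dj hc
  have h10 : ∀ c : Fin n ⊕ Fin r → ℤ, c (Sum.inl j) = 0 → mutFrame d j B M c = M c :=
    fun c hc => S.mutFrame_of_eq_zero dj hc
  set B1 := mutMatrix j B with hB1
  set M1 := mutFrame d j B M with hM1
  set ω1 : (Fin n ⊕ Fin r → ℤ) → (Fin n ⊕ Fin r → ℤ) → ℤ :=
    fun c e => ω (eMap j B c) (eMap j B e) with hω1
  have S2 := S1.mutate hd k
  have h21 : ∀ c : Fin n ⊕ Fin r → ℤ, c (Sum.inl k) = 0 → mutFrame d k B1 M1 c = M1 c :=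
    fun c hc => S1.mutFrame_of_eq_zero dk hc
  have hX2 : mutFrame d k B1 M1 (basisVec r k) = _ :=
    S1.mutFrame_of_eq_one dk (c := basisVec r k) (by simp)
  have hM2 := S1.mutFrame_eq dk
  set B2 := mutMatrix k B1 with hB2
  set M2 := mutFrame d k B1 M1 with hM2d
  have S3 := S2.mutate hd j
  have h32 : ∀ c : Fin n ⊕ Fin r → ℤ, c (Sum.inl j) = 0 → mutFrame d j B2 M2 c = M2 c :=
    fun c hc => S2.mutFrame_of_eq_zero dj hc
  have hX3 : mutFrame d j B2 M2 (basisVec r j) = _ :=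
    S2.mutFrame_of_eq_one dj (c := basisVec r j) (by simp)
  set M3 := mutFrame d j B2 M2 with hM3
  -- signs of the principal entries
  have hkj : B1 (Sum.inl k) j ≤ 0 := by
    have h := S1.skew_principal k j
    by_contra hcon
    have h' : d j * d k * B1 (Sum.inl k) j = -(d j * d j * B1 (Sum.inl j) k) := by
      linear_combination d j * h
    have := mul_nonneg (hd j j).le hb
    have := mul_pos (hd j k) (not_le.1 hcon)
    omega
  have hkj0 : B1 (Sum.inl j) k = 0 → B1 (Sum.inl k) j = 0 := fun h0 => by
    have h := S1.skew_principal k j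
    rw [h0, mul_zero] at h
    exact (mul_eq_zero.1 (neg_eq_zero.1 h.symm)).resolve_left dk
  -- the grading
  set e : Fin n ⊕ Fin r → ℤ := d k • basisVec r k with he
  have hej : e (Sum.inl j) = 0 := by simp [he, hjk]
  have hek : e (Sum.inl k) = d k := by simp [he]
  -- The exponent of `e` at `j` is `0`, so the same element grades the Laurent rings of `M` and
  -- `M1`. The factor `d k` in `e` gives `b^k` the weight `2 d_k²`, positive for either sign of
  -- `d_k`.
  have hZ : M1 e = M e := h10 e hej
  have hZ0 := S.map_ne_zero e
  have hω10 : ∀ c : Fin n ⊕ Fin r → ℤ, c (Sum.inl j) = 0 → ω1 c e = ω c e := fun c hc => by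
    simp only [hω1, eMap_of_eq_zero B hc, eMap_of_eq_zero B hej]
  have hw1 : ∀ c, M1 c ∈ wt (M e) (2 * ω1 c e) := fun c => hZ ▸ S1.map_mem_wt c e
  have hdk2 : 0 < d k * d k := hd k k
  -- the variable `k`
  have hXk : M3 (basisVec r k) = M2 (basisVec r k) := h32 _ (by simp [hjk])
  set u := eMap k B1 (basisVec r k) with hu
  have hjk' : (Sum.inl j : Fin n ⊕ Fin r) ≠ Sum.inl k := by simpa using hjk
  -- Here the sign assumption enters: it makes the lower term of `M2(e_k)` free of the variable `j`,
  -- hence a monomial of `M`, while the other term has the exponent `b_jk ≥ 0` at `j`.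
  have huj : u (Sum.inl j) = 0 := by
    rw [hu, eMap_apply_of_ne _ _ hjk']
    simp [hjk, hb]
  have hXk_mem : M3 (basisVec r k) ∈ laurent M := by
    rw [hXk, hX2]
    refine add_mem (hL1 _ huj.ge) (hL1 _ ?_)
    rw [Pi.add_apply, huj, zero_add]
    exact hb
  have hXk_low : HasLowestUnit (laurent M) (M e) (M3 (basisVec r k)) := by
    refine ⟨2 * ω u e, M u, M (-u), S.map_mem_wt u e, map_mem_laurent M _, S.map_mul_neg u, ?_⟩
    rw [hXk, hX2, h10 u huj, add_sub_cancel_left]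
    refine wt_le_wtAbove ?_ (hw1 _)
    rw [S1.add_left, S1.compat, hω10 u huj, hek]
    omega
  -- the variable `j`
  set c0 := eMap j B2 (basisVec r j) with hc0
  have hc0j : c0 (Sum.inl j) = -1 := by simp [hc0]
  have hc0k : c0 (Sum.inl k) = 0 := by
    rw [hc0, eMap_apply_of_ne _ _ hjk'.symm]
    simp [hjk.symm, hB2, mutMatrix_apply_self_left, hkj]
  obtain ⟨a, ha⟩ : ∃ a : ℕ, -B1 (Sum.inl k) j = a := Int.eq_ofNat_of_zero_le (by omega)
  have hE : eMap k B1 (c0 + col B2 j) = c0 + col B1 j := by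
    rw [eMap_add, eMap_of_eq_zero B1 hc0k, hB2, eMap_col_mutMatrix hjk (S1.diag dk),
      max_eq_right hkj]
    simp
  have hvj : (c0 + col B1 j) (Sum.inl j) = -1 := by
    rw [Pi.add_apply, hc0j, show col B1 j (Sum.inl j) = 0 from S1.diag dj]; rfl
  set w := eMap j B1 c0 with hw
  -- The two terms of an exchange binomial of `M1` in direction `j` add up to one monomial of `M`,
  -- because mutating `M1` at `j` gives back `M`.
  have hMw : M w = M1 c0 + M1 (c0 + col B1 j) := by
    rw [← hinv, S1.mutFrame_of_eq_one dj (c := w) (by rw [hw, eMap_apply_self, hc0j]; rfl), hw,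
      eMap_eMap]
  have hωv : ω1 (c0 + col B1 j) e = ω1 c0 e := by
    rw [S1.add_left, S1.compat, hej]; ring
  have hXj : M3 (basisVec r j) =
      M w + (dilog (d k) (M1 (col B1 k)) a - 1) * M1 (c0 + col B1 j) := by
    rw [hX3, h21 c0 hc0k, hM2 (c0 + col B2 j), hE, hMw, Pi.add_apply, hc0k, zero_add]
    rw [show col B2 j (Sum.inl k) = a by
      rw [← ha]; simp [hB2, col, mutMatrix_apply_self_left]]
    rw [sub_mul, one_mul]; abel
  have htail : (dilog (d k) (M1 (col B1 k)) a - 1) * M1 (c0 + col B1 j) ∈ laurent M ∧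
      (dilog (d k) (M1 (col B1 k)) a - 1) * M1 (c0 + col B1 j) ∈ wtAbove (M e) (2 * ω1 c0 e) := by
    -- If `b_jk = 0`, then `b_kj = 0` as well and the tail is zero. Otherwise its terms have the
    -- exponent `(p + 1) b_jk - 1 ≥ 0` at `j`, so they are Laurent in `M`.
    rcases hb.eq_or_lt with hb0 | hb0
    · have : a = 0 := by have := hkj0 hb0.symm; omega
      subst this
      simp
    · refine Submodule.span_induction (p := fun x _ => x * M1 (c0 + col B1 j) ∈ laurent M ∧
        x * M1 (c0 + col B1 j) ∈ wtAbove (M e) (2 * ω1 c0 e)) ?_ (by simp)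
        (fun x y _ _ hx hy => ?_) (fun b x _ hx => ?_) (dilog_sub_one_mem (d k) (M1 (col B1 k)) a)
      · rintro _ ⟨p, rfl⟩
        simp only
        rw [← S1.map_nsmul, S1.map_mul]
        refine ⟨Subalgebra.smul_mem _ (hL1 _ ?_) _, Submodule.smul_mem _ _
          (wt_le_wtAbove ?_ (hw1 _))⟩
        · rw [Pi.add_apply, hvj, Pi.smul_apply]
          change 0 ≤ ((p + 1 : ℕ) : ℤ) * B1 (Sum.inl j) k + -1
          push_cast
          nlinarith
        · rw [S1.add_left, S1.zsmul_left, S1.compat, hek, hωv]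
          have : 0 < ((p + 1 : ℕ) : ℤ) * (d k * d k) := by positivity
          omega
      · rw [add_mul]; exact ⟨add_mem hx.1 hy.1, add_mem hx.2 hy.2⟩
      · rw [smul_mul_assoc]
        exact ⟨Subalgebra.smul_mem _ hx.1 _, Submodule.smul_mem _ _ hx.2⟩
  have hXj_mem : M3 (basisVec r j) ∈ laurent M := by
    rw [hXj]
    exact add_mem (map_mem_laurent M _) htail.1
  have hXj_low : HasLowestUnit (laurent M) (M e) (M3 (basisVec r j)) := by
    refine ⟨2 * ω1 c0 e, M w, M (-w), ?_, map_mem_laurent M _, S.map_mul_neg w, ?_⟩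
    · rw [hMw]
      refine add_mem (hw1 _) ?_
      rw [← hωv]
      exact hw1 _
    · rw [hXj, add_sub_cancel_left]
      exact htail.2
  -- conclusion
  have hmono : ∀ c : Fin n ⊕ Fin r → ℤ, 0 ≤ c (Sum.inl j) → 0 ≤ c (Sum.inl k) →
      M3 c ∈ laurent M := fun c hcj hck =>
    S3.map_mem_of_basisVec_mem hjk (fun c hcj hck => by
      rw [h32 c hcj, h21 c hck, h10 c hcj]; exact map_mem_laurent M c) hXj_mem hXk_mem hcj hck
  obtain ⟨N, hN⟩ := S3.exists_pow_mul_mem (laurent M) hjk hmono hx3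
  exact mem_of_mul_mem_of_hasLowestUnit hZ0 (S.wt_component_mem e) (hZ ▸ S1.mem_iSup_wt e hx1)
    (mul_mem (pow_mem hXj_mem N) (pow_mem hXk_mem N))
    ((hXj_low.pow hZ0 N).mul hZ0 (hXk_low.pow hZ0 N)) hN

theorem laurent_inter (S : QSeed d B ω M) (hd : ∀ k l, 0 < d k * d l) {j k : Fin n}
    (hjk : j ≠ k) {x : K} (hx1 : x ∈ laurent (mutFrame d j B M))
    (hx3 : x ∈ laurent (mutFrame d j (mutMatrix k (mutMatrix j B))
      (mutFrame d k (mutMatrix j B) (mutFrame d j B M)))) : x ∈ laurent M := by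
  rcases le_total 0 (mutMatrix j B (Sum.inl j) k) with hb | hb
  · exact S.laurent_inter_of_nonneg hd hjk hb hx1 hx3
  · have S1 := S.mutate hd j
    have S2 := S1.mutate hd k
    -- The sign `-1` rule gives the same frames and the exchange matrix `-B`, for which the entry
    -- has the required sign.
    refine S.flip.laurent_inter_of_nonneg (fun k l => by simpa using hd k l) hjk ?_ (x := x) ?_ ?_
    · rw [mutMatrix_neg]; simpa using hb
    · rwa [S.mutFrame_flip (ne_zero hd j)]
    · rwa [S.mutFrame_flip (ne_zero hd j), mutMatrix_neg, S1.mutFrame_flip (ne_zero hd k),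
        mutMatrix_neg, S2.mutFrame_flip (ne_zero hd j)]

/-- The quantum seed obtained by the mutations in the list `w`. -/
abbrev _root_.QCluster.foldSeed (d : Fin n → ℤ) (w : List (Fin n))
    (S : ((Fin n ⊕ Fin r → ℤ) → K) × ExchangeMatrix n r) :
    ((Fin n ⊕ Fin r → ℤ) → K) × ExchangeMatrix n r :=
  w.foldl (fun S k => mutQuantumSeed d k S) S

/-- Strong induction on the length of the path, with the initial seed allowed to vary. -/
theorem foldSeed_basisVec_mem_laurent (hd : ∀ k l, 0 < d k * d l) (w : List (Fin n))
    (S : QSeed d B ω M) (i : Fin n) :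
    (foldSeed d w (M, B)).1 (basisVec r i) ∈ laurent M := by
  induction h : w.length using Nat.strong_induction_on generalizing w B ω M with
  | _ m ih =>
    match w, h with
    | [], _ => exact map_mem_laurent M _
    | [j], _ =>
      refine S.mutFrame_mem_laurent (ne_zero hd j) ?_
      by_cases hij : i = j
      · subst hij; simp
      · simp [Ne.symm hij]
    | j :: k :: w, h =>
      simp only [List.length_cons] at h
      by_cases hjk : j = k
      · subst hjk
        have := ih w.length (by omega) w S rfl
        simpa [foldSeed, mutQuantumSeed, S.mutFrame_mutFrame hd j, mutMatrix_mutMatrix] using this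
      · have S1 := S.mutate hd j
        have S2 := S1.mutate hd k
        have S3 := S2.mutate hd j
        -- The end of the path `j, k, w` is reached from the first seed by `k, w`. From the third
        -- seed it is reached by `j, w`, whose first step undoes the last mutation. Both words are
        -- shorter by one.
        refine S.laurent_inter hd hjk ?_ ?_
        · exact ih (k :: w).length (by simp; omega) (k :: w) S1 rfl
        · have := ih (j :: w).length (by simp; omega) (j :: w) S3 rfl
          simpa [foldSeed, mutQuantumSeed, S2.mutFrame_mutFrame hd j, mutMatrix_mutMatrix] using this

end QSeed

/-! ### Homomorphisms from quantum tori -/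

namespace QTorus

section Lift

variable {ι : Type} [Fintype ι] {Λ : Matrix ι ι ℤ} {R : Type} [Ring R]

/-- The ring homomorphism from a quantum torus determined by the images of the scalars and of the
monomials. -/
def lift (φ : QCoeff →+* R) (m : (ι → ℤ) → R) (hφ : ∀ a e, φ a * m e = m e * φ a) (h1 : m 0 = 1)
    (hm : ∀ e f, m e * m f = φ (T (latticeForm Λ e f)) * m (e + f)) : QTorus Λ →+* R :=
  let f : QTorus Λ →+ R := Finsupp.liftAddHom fun e => (AddMonoidHom.mulRight (m e)).comp φ
  have hf : ∀ e a, f (mono e a) = φ a * m e := fun e a => Finsupp.liftAddHom_apply_single _ _ _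
  { f with
    map_one' := by
      change f (mono 0 1) = 1
      rw [hf, h1, map_one, one_mul]
    map_mul' := fun x y => by
      change f (x * y) = f x * f y
      refine induction (p := fun x => f (x * y) = f x * f y) x (by simp)
        (fun x x' h h' => by rw [add_mul, map_add, map_add, h, h', add_mul]) fun e a => ?_
      refine induction (p := fun y => f (mono e a * y) = f (mono e a) * f y) y (by simp)
        (fun x x' h h' => by rw [mul_add, map_add, map_add, h, h', mul_add]) fun g b => ?_
      rw [mono_mul_mono, hf, hf, hf, mul_assoc (φ a), ← mul_assoc (m e), ← hφ,
        mul_assoc (φ b), hm, map_mul, map_mul]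
      simp only [mul_assoc] }

variable {φ : QCoeff →+* R} {m : (ι → ℤ) → R} {hφ : ∀ a e, φ a * m e = m e * φ a} {h1 : m 0 = 1}
  {hm : ∀ e f, m e * m f = φ (T (latticeForm Λ e f)) * m (e + f)}

theorem lift_mono (e : ι → ℤ) (a : QCoeff) : lift φ m hφ h1 hm (mono e a) = φ a * m e :=
  Finsupp.liftAddHom_apply_single _ _ _

theorem lift_X (e : ι → ℤ) : lift φ m hφ h1 hm (X e) = m e := by
  rw [X, lift_mono, map_one, one_mul]

theorem lift_apply (x : QTorus Λ) :
    lift φ m hφ h1 hm x = ∑ e ∈ x.supp, φ (x.coeff e) * m e := by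
  conv_lhs => rw [eq_sum x, map_sum]
  simp only [lift_mono]

theorem lift_smul (a : QCoeff) (x : QTorus Λ) :
    lift φ m hφ h1 hm (a • x) = φ a * lift φ m hφ h1 hm x := by
  refine induction (p := fun x => lift φ m hφ h1 hm (a • x) = φ a * lift φ m hφ h1 hm x) x (by simp)
    (fun x y hx hy => by rw [smul_add, map_add, map_add, hx, hy, mul_add]) fun e b => ?_
  rw [smul_mono, lift_mono, lift_mono, map_mul, mul_assoc]

end Lift

/-! ### The quantum torus inside its skew field -/

section Num

variable {ι : Type} [Fintype ι] {L : Matrix ι ι ℤ}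

/-- The inclusion of the quantum torus in its skew field of fractions. -/
abbrev num (L : Matrix ι ι ℤ) : QTorus L →+* QField L := OreLocalization.numeratorRingHom

theorem num_injective : Function.Injective (num L) :=
  OreLocalization.numeratorHom_inj inf_le_left

theorem algebraMap_qField (a : QCoeff) :
    algebraMap QCoeff (QField L) a = num L (algebraMap QCoeff (QTorus L) a) := rfl

theorem num_smul (a : QCoeff) (x : QTorus L) : num L (a • x) = a • num L x := by
  rw [Algebra.smul_def, map_mul, ← algebraMap_qField, ← Algebra.smul_def]

theorem algebraMap_eq_mono (a : QCoeff) : algebraMap QCoeff (QTorus L) a = mono 0 a := by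
  rw [Algebra.algebraMap_eq_smul_one, one_eq, X, smul_mono, mul_one]

theorem mono_injective (e : ι → ℤ) : Function.Injective (mono e : QCoeff → QTorus L) :=
  Finsupp.single_injective e

instance : FaithfulSMul QCoeff (QField L) :=
  (faithfulSMul_iff_algebraMap_injective _ _).2 fun a b h => by
    have := num_injective h
    rw [algebraMap_eq_mono, algebraMap_eq_mono] at this
    exact mono_injective 0 this

theorem linearIndependent_X : LinearIndependent QCoeff (X : (ι → ℤ) → QTorus L) := by
  rw [linearIndependent_iff]
  intro l hl
  have : Finsupp.linearCombination QCoeff (X : (ι → ℤ) → QTorus L) l = (l : QTorus L) := by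
    rw [Finsupp.linearCombination_apply]
    conv_rhs => rw [← Finsupp.sum_single l]
    refine Finsupp.sum_congr fun e _ => ?_
    rw [X, smul_mono, mul_one]; rfl
  rw [this] at hl
  exact hl

end Num

end QTorus

/-! ### Quantum seeds from toric frames -/

section Form

variable {ι : Type} [Fintype ι]

theorem ToricFrame.map_zero {L : Matrix ι ι ℤ} (M : ToricFrame L) : M.map 0 = 1 := by
  unfold ToricFrame.map
  rw [_root_.map_zero, ← QTorus.one_eq, map_one, map_one]

theorem ToricFrame.linearIndependent {L : Matrix ι ι ℤ} (M : ToricFrame L) :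
    LinearIndependent QCoeff M.map := by
  let f : QTorus L →ₗ[QCoeff] QField L :=
    { toFun := fun x => M.aut (QTorus.num L x)
      map_add' := fun x y => by rw [map_add, map_add]
      map_smul' := fun a x => by rw [QTorus.num_smul, map_smul, RingHom.id_apply] }
  have hf : Function.Injective f := M.aut.injective.comp QTorus.num_injective
  have := (QTorus.linearIndependent_X (L := L)).comp M.lat M.lat.injective
  exact this.map' f (LinearMap.ker_eq_bot.2 hf)

variable [DecidableEq ι]

theorem latticeForm_eq_of_add {Λ : Matrix ι ι ℤ} {β : (ι → ℤ) → (ι → ℤ) → ℤ}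
    (hl : ∀ c c' e, β (c + c') e = β c e + β c' e) (hr : ∀ c e e', β c (e + e') = β c e + β c e')
    (h : ∀ i j, β (Pi.single i 1) (Pi.single j 1) = Λ i j) (c e : ι → ℤ) :
    latticeForm Λ c e = β c e := by
  let b : (ι → ℤ) →+ (ι → ℤ) →+ ℤ := AddMonoidHom.mk' (fun c => AddMonoidHom.mk' (β c) (hr c))
    fun c c' => by ext e; exact hl c c' _
  have h1 : ∀ c : ι → ℤ, c = ∑ i, c i • (Pi.single i 1 : ι → ℤ) := fun c => by
    funext j
    simp [Finset.sum_apply, Pi.single_apply]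
  have : b c e = ∑ i, ∑ j, c i * Λ i j * e j := by
    conv_lhs => rw [h1 c, h1 e]
    simp only [map_sum, map_zsmul, AddMonoidHom.finsetSum_apply, AddMonoidHom.smul_apply,
      smul_eq_mul, Finset.mul_sum]
    rw [Finset.sum_comm]
    refine Finset.sum_congr rfl fun i _ => Finset.sum_congr rfl fun j _ => ?_
    rw [show b (Pi.single i 1) (Pi.single j 1) = Λ i j from h i j]; ring
  exact this.symm

theorem ToricFrame.latticeForm_form {L : Matrix ι ι ℤ} (M : ToricFrame L) (c e : ι → ℤ) :
    latticeForm M.form c e = latticeForm L (M.lat c) (M.lat e) :=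
  latticeForm_eq_of_add (β := fun c e => latticeForm L (M.lat c) (M.lat e))
    (fun c c' e => by simp only [map_add, QTorus.form_add_left])
    (fun c e e' => by simp only [map_add, QTorus.form_add_right]) (fun _ _ => rfl) c e

theorem ToricFrame.map_mul {L : Matrix ι ι ℤ} (M : ToricFrame L) (c e : ι → ℤ) :
    M.map c * M.map e = (T (latticeForm M.form c e) : QCoeff) • M.map (c + e) := by
  unfold ToricFrame.map
  rw [← _root_.map_mul, ← _root_.map_mul, QTorus.X_mul_X, QTorus.num_smul, map_smul,
    M.latticeForm_form, map_add]

end Form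

section Compatible

variable {n r : ℕ}

theorem latticeForm_transpose {ι : Type} [Fintype ι] {Λ : Matrix ι ι ℤ} (h : Λ.transpose = -Λ)
    (c e : ι → ℤ) : latticeForm Λ c e = -latticeForm Λ e c := by
  unfold latticeForm
  rw [Finset.sum_comm, ← Finset.sum_neg_distrib]
  refine Finset.sum_congr rfl fun i _ => ?_
  rw [← Finset.sum_neg_distrib]
  refine Finset.sum_congr rfl fun j _ => ?_
  have : Λ j i = -Λ i j := congrFun (congrFun h i) j
  rw [this]; ring

theorem IsCompatible.form_col {d : Fin n → ℤ} {Λ : Matrix (Fin n ⊕ Fin r) (Fin n ⊕ Fin r) ℤ}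
    {B : ExchangeMatrix n r} (h : IsCompatible d Λ B) (l : Fin n) (c : Fin n ⊕ Fin r → ℤ) :
    latticeForm Λ (col B l) c = d l * c (Sum.inl l) := by
  have h1 : ∀ j, ∑ i, B i l * Λ i j = Matrix.fromCols (Matrix.diagonal d) 0 l j := fun j =>
    congrFun (congrFun h.2 l) j
  unfold latticeForm
  rw [Finset.sum_comm]
  simp only [← Finset.sum_mul, col, h1]
  simp [Fintype.sum_sum_type, Matrix.diagonal_apply]

theorem ToricFrame.qSeed {L : Matrix (Fin n ⊕ Fin r) (Fin n ⊕ Fin r) ℤ} (M : ToricFrame L)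
    {d : Fin n → ℤ} {B : ExchangeMatrix n r} (h : IsCompatible d M.form B) :
    QSeed d B (latticeForm M.form) M.map where
  add_left _ _ _ := QTorus.form_add_left _ _ _
  skew := latticeForm_transpose h.1
  compat := h.form_col
  map_zero := M.map_zero
  map_mul := M.map_mul

/-- The identity toric frame. -/
def ToricFrame.refl {ι : Type} [Fintype ι] (L : Matrix ι ι ℤ) : ToricFrame L :=
  ⟨AlgEquiv.refl, AddEquiv.refl _⟩

theorem ToricFrame.refl_map {ι : Type} [Fintype ι] (L : Matrix ι ι ℤ) (c : ι → ℤ) :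
    (ToricFrame.refl L).map c = QTorus.num L (QTorus.X c) := rfl

theorem ToricFrame.refl_form {ι : Type} [Fintype ι] [DecidableEq ι] (L : Matrix ι ι ℤ) :
    (ToricFrame.refl L).form = L := by
  funext i j
  simp [ToricFrame.form, ToricFrame.refl, latticeForm, Pi.single_apply]

end Compatible

/-! ### Evaluation of the torus in the variables `Z_i` -/

namespace QSeed

variable {n r : ℕ} {K : Type} [DivisionRing K] [Algebra QCoeff K] {d : Fin n → ℤ}
  {B : ExchangeMatrix n r} {ω : (Fin n ⊕ Fin r → ℤ) → (Fin n ⊕ Fin r → ℤ) → ℤ}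
  {M : (Fin n ⊕ Fin r → ℤ) → K} {B₀ : Matrix (Fin n) (Fin n) ℤ}

theorem mulVec_eq_sum_col (B : ExchangeMatrix n r) (c : Fin n → ℤ) :
    B.mulVec c = ∑ l, c l • col B l := by
  funext i
  simp [Matrix.mulVec, dotProduct, col, mul_comm]

/-- Commutation with monomials in `Ŷ` involves only `D` and the principal part of the exponent. All
independence from `Λ` and from the frozen rows comes from this. -/
theorem form_mulVec (S : QSeed d B ω M) (c : Fin n → ℤ) (e : Fin n ⊕ Fin r → ℤ) :
    ω (B.mulVec c) e = ∑ l, d l * c l * e (Sum.inl l) := by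
  let f : (Fin n ⊕ Fin r → ℤ) →+ ℤ :=
    { toFun := fun c => ω c e, map_zero' := S.zero_left e, map_add' := fun c c' => S.add_left c c' e }
  have : f (B.mulVec c) = ∑ l, c l * ω (col B l) e := by
    rw [mulVec_eq_sum_col, map_sum]
    exact Finset.sum_congr rfl fun l _ => S.zsmul_left _ _ _
  change f (B.mulVec c) = _
  rw [this]
  refine Finset.sum_congr rfl fun l _ => ?_
  rw [S.compat]; ring

theorem form_mulVec_mulVec (S : QSeed d B ω M) (hB : ∀ i l, B (Sum.inl i) l = B₀ i l)
    (c e : Fin n → ℤ) :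
    ω (B.mulVec c) (B.mulVec e) = latticeForm (Matrix.diagonal d * B₀) c e := by
  rw [S.form_mulVec]
  unfold latticeForm
  refine Finset.sum_congr rfl fun i _ => ?_
  simp only [Matrix.mulVec, dotProduct, hB, Matrix.diagonal_mul, Finset.mul_sum]
  refine Finset.sum_congr rfl fun j _ => ?_
  ring

/-- Pairing `B c` with `e_l` recovers `d_l c_l`. -/
theorem mulVec_injective (S : QSeed d B ω M) (hd : ∀ k l, 0 < d k * d l) :
    Function.Injective B.mulVec := by
  intro c c' h
  funext l
  have h1 := S.form_mulVec c (basisVec r l)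
  have h2 := S.form_mulVec c' (basisVec r l)
  rw [h, h2] at h1
  simp only [Pi.single_apply, Sum.inl.injEq, mul_ite, mul_one, mul_zero, Finset.sum_ite_eq',
    Finset.mem_univ, if_true] at h1
  exact (mul_left_cancel₀ (ne_zero hd l) h1).symm

/-- The homomorphism from the torus in the variables `Z_i` that maps `Z^c` to `M(B c)`. -/
def torusHom (S : QSeed d B ω M) (hB : ∀ i l, B (Sum.inl i) l = B₀ i l) :
    QTorus (Matrix.diagonal d * B₀) →+* K :=
  QTorus.lift (algebraMap QCoeff K) (fun c => M (B.mulVec c)) (fun a _ => Algebra.commutes a _)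
    (by rw [Matrix.mulVec_zero, S.map_zero]) fun c e => by
      rw [S.map_mul, S.form_mulVec_mulVec hB, Matrix.mulVec_add, Algebra.smul_def]

theorem torusHom_X (S : QSeed d B ω M) (hB : ∀ i l, B (Sum.inl i) l = B₀ i l) (c : Fin n → ℤ) :
    S.torusHom hB (QTorus.X c) = M (B.mulVec c) := QTorus.lift_X c

theorem torusHom_smul (S : QSeed d B ω M) (hB : ∀ i l, B (Sum.inl i) l = B₀ i l) (a : QCoeff)
    (x : QTorus (Matrix.diagonal d * B₀)) : S.torusHom hB (a • x) = a • S.torusHom hB x := by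
  rw [Algebra.smul_def a (S.torusHom hB x)]
  exact QTorus.lift_smul a x

theorem torusHom_injective (S : QSeed d B ω M) (hd : ∀ k l, 0 < d k * d l)
    (hM : LinearIndependent QCoeff M) (hB : ∀ i l, B (Sum.inl i) l = B₀ i l) :
    Function.Injective (S.torusHom hB) := by
  rw [injective_iff_map_eq_zero]
  intro x hx
  refine linearIndependent_iff.1 (hM.comp _ (S.mulVec_injective hd)) x ?_
  refine (Finsupp.linearCombination_apply _ _).trans ?_
  rw [← hx]
  exact ((QTorus.lift_apply x).trans (Finset.sum_congr rfl fun e _ => (Algebra.smul_def _ _).symm)).symm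

/-- The extension of `torusHom` to the skew field of fractions. -/
def ev (S : QSeed d B ω M) (hd : ∀ k l, 0 < d k * d l)
    (hM : LinearIndependent QCoeff M) (hB : ∀ i l, B (Sum.inl i) l = B₀ i l) :
    QField (Matrix.diagonal d * B₀) →+* K :=
  OreLocalization.universalHom (S.torusHom hB)
    (IsUnit.liftRight ((S.torusHom hB).toMonoidHom.comp (Submonoid.subtype _)) fun s =>
      isUnit_iff_ne_zero.2 fun h => nonZeroDivisors.ne_zero s.2
        ((injective_iff_map_eq_zero _).1 (S.torusHom_injective hd hM hB) _ h))
    fun s => by simp [IsUnit.coe_liftRight]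

theorem ev_num (S : QSeed d B ω M) (hd : ∀ k l, 0 < d k * d l)
    (hM : LinearIndependent QCoeff M) (hB : ∀ i l, B (Sum.inl i) l = B₀ i l)
    (x : QTorus (Matrix.diagonal d * B₀)) :
    S.ev hd hM hB (QTorus.num _ x) = S.torusHom hB x :=
  OreLocalization.universalHom_commutes _ _ _

theorem ev_smul (S : QSeed d B ω M) (hd : ∀ k l, 0 < d k * d l)
    (hM : LinearIndependent QCoeff M) (hB : ∀ i l, B (Sum.inl i) l = B₀ i l)
    (a : QCoeff) (x : QField (Matrix.diagonal d * B₀)) :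
    S.ev hd hM hB (a • x) = a • S.ev hd hM hB x := by
  rw [Algebra.smul_def, _root_.map_mul, QTorus.algebraMap_qField, S.ev_num,
    Algebra.algebraMap_eq_smul_one, torusHom_smul, _root_.map_one, smul_mul_assoc, one_mul]

end QSeed

/-! ### Mutation along a list of directions -/

section Lists

variable {n r : ℕ}

/-- The exchange matrix obtained by the mutations in the list `w`. -/
def foldMatrix (w : List (Fin n)) (B : ExchangeMatrix n r) : ExchangeMatrix n r :=
  w.foldl (fun B k => mutMatrix k B) B

/-- The composition of the lattice maps `eMap` along the list `w`. -/
def gMap : List (Fin n) → ExchangeMatrix n r → (Fin n ⊕ Fin r → ℤ) → (Fin n ⊕ Fin r → ℤ)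
  | [], _, c => c
  | k :: w, B, c => eMap k B (gMap w (mutMatrix k B) c)

theorem foldMatrix_append_singleton (w : List (Fin n)) (k : Fin n) (B : ExchangeMatrix n r) :
    foldMatrix (w ++ [k]) B = mutMatrix k (foldMatrix w B) := by
  simp [foldMatrix]

theorem gMap_append_singleton (w : List (Fin n)) (k : Fin n) (B : ExchangeMatrix n r)
    (c : Fin n ⊕ Fin r → ℤ) : gMap (w ++ [k]) B c = gMap w B (eMap k (foldMatrix w B) c) := by
  induction w generalizing B with
  | nil => rfl
  | cons l w ih => simp [gMap, ih, foldMatrix]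

theorem gMap_add (w : List (Fin n)) (B : ExchangeMatrix n r) (c c' : Fin n ⊕ Fin r → ℤ) :
    gMap w B (c + c') = gMap w B c + gMap w B c' := by
  induction w generalizing B with
  | nil => rfl
  | cons l w ih => simp [gMap, ih, eMap_add]

/-- `gMap` as a homomorphism. -/
def gHom (w : List (Fin n)) (B : ExchangeMatrix n r) :
    (Fin n ⊕ Fin r → ℤ) →+ (Fin n ⊕ Fin r → ℤ) :=
  AddMonoidHom.mk' (gMap w B) (gMap_add w B)

theorem gMap_zsmul (w : List (Fin n)) (B : ExchangeMatrix n r) (a : ℤ) (c : Fin n ⊕ Fin r → ℤ) :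
    gMap w B (a • c) = a • gMap w B c := map_zsmul (gHom w B) a c

theorem gMap_neg (w : List (Fin n)) (B : ExchangeMatrix n r) (c : Fin n ⊕ Fin r → ℤ) :
    gMap w B (-c) = -gMap w B c := map_neg (gHom w B) c

variable {r' : ℕ} {f : Fin r → Fin r'} {B : ExchangeMatrix n r} {B' : ExchangeMatrix n r'}

theorem map_eq_inl_iff (i : Fin n ⊕ Fin r) (k : Fin n) :
    Sum.map id f i = Sum.inl k ↔ i = Sum.inl k := by
  cases i <;> simp

/-- A row mutates by means of itself and the principal rows only. Hence dropping, adding or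
selecting frozen rows commutes with mutation; this and its analogues for `eMap` and `gMap` allow
different coefficients to be compared. -/
theorem mutMatrix_comp (h : ∀ i l, B' (Sum.map id f i) l = B i l) (k : Fin n) (i : Fin n ⊕ Fin r)
    (l : Fin n) : mutMatrix k B' (Sum.map id f i) l = mutMatrix k B i l := by
  have hk : ∀ l, B' (Sum.inl k) l = B (Sum.inl k) l := fun l => h (Sum.inl k) l
  simp only [mutMatrix, h, hk, map_eq_inl_iff]

theorem foldMatrix_comp (h : ∀ i l, B' (Sum.map id f i) l = B i l) (w : List (Fin n))
    (i : Fin n ⊕ Fin r) (l : Fin n) :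
    foldMatrix w B' (Sum.map id f i) l = foldMatrix w B i l := by
  induction w generalizing B B' with
  | nil => exact h i l
  | cons k w ih => exact ih (mutMatrix_comp h k)

theorem eMap_comp (h : ∀ i l, B' (Sum.map id f i) l = B i l) (k : Fin n)
    (c : Fin n ⊕ Fin r' → ℤ) : eMap k B' c ∘ Sum.map id f = eMap k B (c ∘ Sum.map id f) := by
  funext i
  simp only [Function.comp_apply, eMap_apply, h, map_eq_inl_iff, Sum.map_inl, id]

theorem gMap_comp (h : ∀ i l, B' (Sum.map id f i) l = B i l) (w : List (Fin n))
    (c : Fin n ⊕ Fin r' → ℤ) : gMap w B' c ∘ Sum.map id f = gMap w B (c ∘ Sum.map id f) := by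
  induction w generalizing B B' with
  | nil => rfl
  | cons k w ih => rw [gMap, gMap, eMap_comp h, ih (mutMatrix_comp h k)]

end Lists

/-- The principal part as an exchange matrix without coefficient rows. -/
def bareMatrix {n : ℕ} (B₀ : Matrix (Fin n) (Fin n) ℤ) : ExchangeMatrix n 0 :=
  fun i l => Sum.elim (fun i => B₀ i l) Fin.elim0 i

/-- The principal part of an exponent vector. -/
def principalPart {n r : ℕ} (c : Fin n ⊕ Fin r → ℤ) : Fin n ⊕ Fin 0 → ℤ := c ∘ Sum.map id Fin.elim0

section FoldSeed

variable {n r : ℕ} {K : Type} [DivisionRing K] [Algebra QCoeff K] {d : Fin n → ℤ}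
  {B : ExchangeMatrix n r} {ω : (Fin n ⊕ Fin r → ℤ) → (Fin n ⊕ Fin r → ℤ) → ℤ}
  {M : (Fin n ⊕ Fin r → ℤ) → K}

theorem foldSeed_snd (w : List (Fin n)) : (foldSeed d w (M, B)).2 = foldMatrix w B := by
  induction w generalizing M B with
  | nil => rfl
  | cons k w ih => exact ih

theorem foldSeed_append_singleton (w : List (Fin n)) (k : Fin n) :
    (foldSeed d (w ++ [k]) (M, B)).1 = mutFrame d k (foldMatrix w B) (foldSeed d w (M, B)).1 := by
  rw [← foldSeed_snd (d := d) (M := M) w, foldSeed, List.foldl_append]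
  rfl

variable [FaithfulSMul QCoeff K]

theorem QSeed.foldSeed (S : QSeed d B ω M) (hd : ∀ k l, 0 < d k * d l) (w : List (Fin n)) :
    ∃ ω', QSeed d (foldMatrix w B) ω' (foldSeed d w (M, B)).1 := by
  induction w using List.reverseRecOn with
  | nil => exact ⟨ω, S⟩
  | append_singleton w k ih =>
    obtain ⟨ω', S'⟩ := ih
    rw [foldSeed_append_singleton, foldMatrix_append_singleton]
    exact ⟨_, S'.mutate hd k⟩

end FoldSeed

/-- The frame at the end of the mutation sequence `w` is given by a formula which depends only on
the principal part of the exchange matrix. -/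
theorem exists_universal_formula {n : ℕ} {d : Fin n → ℤ} (hd : ∀ k l, 0 < d k * d l)
    (B₀ : Matrix (Fin n) (Fin n) ℤ) (w : List (Fin n)) :
    ∃ (P : (Fin n ⊕ Fin 0 → ℤ) → QField (Matrix.diagonal d * B₀)) (C : Fin n → Fin n → ℤ),
      ∀ (r : ℕ) (B : ExchangeMatrix n r) (hB : ∀ i l, B (Sum.inl i) l = B₀ i l)
        (K : Type) [DivisionRing K] [Algebra QCoeff K] [FaithfulSMul QCoeff K]
        (ω : (Fin n ⊕ Fin r → ℤ) → (Fin n ⊕ Fin r → ℤ) → ℤ) (M : (Fin n ⊕ Fin r → ℤ) → K)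
        (S : QSeed d B ω M) (hM : LinearIndependent QCoeff M),
      (∀ l, gMap w B (col (foldMatrix w B) l) = B.mulVec (C l)) ∧
      ∀ c, (foldSeed d w (M, B)).1 c = S.ev hd hM hB (P (principalPart c)) * M (gMap w B c) := by
  induction w using List.reverseRecOn with
  | nil =>
    refine ⟨fun _ => 1, fun l => Pi.single l 1, fun r B hB K _ _ _ ω M S hM => ⟨fun l => ?_,
      fun c => ?_⟩⟩
    · rw [Matrix.mulVec_single_one]; rfl
    · rw [map_one, one_mul]; rfl
  | append_singleton w k ih =>
    obtain ⟨P, C, h⟩ := ih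
    -- By induction the current frame at the column `b^k` is the value of `P(b^k) Z^{C_k}`; this
    -- element is put into the dilogarithm of the next mutation. The new `C` is the pullback of
    -- columns from `eMap_col_mutMatrix`.
    refine ⟨fun c => dilog (d k) (P (col (foldMatrix w (bareMatrix B₀)) k) *
        QTorus.num _ (QTorus.X (C k))) (c (Sum.inl k)) * P (eMap k (foldMatrix w (bareMatrix B₀)) c),
      fun l => if l = k then -C k else
        C l + max (foldMatrix w (bareMatrix B₀) (Sum.inl k) l) 0 • C k,
      fun r B hB K _ _ _ ω M S hM => ?_⟩
    obtain ⟨h1, h2⟩ := h r B hB K ω M S hM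
    obtain ⟨ω', S'⟩ := S.foldSeed hd w
    have hres : ∀ (i : Fin n ⊕ Fin 0) l, B (Sum.map id Fin.elim0 i) l = bareMatrix B₀ i l := by
      rintro (i | i) l
      · exact hB i l
      · exact i.elim0
    have hcol : principalPart (col (foldMatrix w B) k) = col (foldMatrix w (bareMatrix B₀)) k :=
      funext fun i => foldMatrix_comp hres w i k
    have hE : ∀ c, principalPart (eMap k (foldMatrix w B) c) =
        eMap k (foldMatrix w (bareMatrix B₀)) (principalPart c) :=
      fun c => eMap_comp (foldMatrix_comp hres w) k c
    have hentry : ∀ l, foldMatrix w B (Sum.inl k) l = foldMatrix w (bareMatrix B₀) (Sum.inl k) l :=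
      fun l => foldMatrix_comp hres w (Sum.inl k) l
    have hdiag := S'.diag (QSeed.ne_zero hd k)
    constructor
    · intro l
      rw [gMap_append_singleton, foldMatrix_append_singleton]
      beta_reduce
      split_ifs with hl
      · subst hl
        rw [col_mutMatrix_self, eMap_neg, eMap_col_self hdiag, gMap_neg, h1, Matrix.mulVec_neg]
      · rw [eMap_col_mutMatrix hl hdiag, gMap_add, gMap_zsmul, h1, h1, Matrix.mulVec_add,
          Matrix.mulVec_smul, hentry]
    · intro c
      rw [foldSeed_append_singleton, S'.mutFrame_eq (QSeed.ne_zero hd k), h2, h2, h1, hcol, hE,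
        gMap_append_singleton, map_mul, dilog_map _ _ _ (fun a x => S.ev_smul hd hM hB _ _), map_mul,
        S.ev_num, S.torusHom_X, mul_assoc]
      rfl

/-! ### Products of frame values -/

namespace QSeed

variable {n r : ℕ} {K : Type} [DivisionRing K] [Algebra QCoeff K] {d : Fin n → ℤ}
  {B : ExchangeMatrix n r} {ω : (Fin n ⊕ Fin r → ℤ) → (Fin n ⊕ Fin r → ℤ) → ℤ}
  {M : (Fin n ⊕ Fin r → ℤ) → K} {B₀ : Matrix (Fin n) (Fin n) ℤ}

theorem sum_right (S : QSeed d B ω M) {m : ℕ} (c : Fin n ⊕ Fin r → ℤ)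
    (f : Fin m → Fin n ⊕ Fin r → ℤ) : ω c (∑ i, f i) = ∑ i, ω c (f i) := by
  let b : (Fin n ⊕ Fin r → ℤ) →+ ℤ := AddMonoidHom.mk' (ω c) (S.add_right c)
  exact map_sum b f _

theorem list_prod_map (S : QSeed d B ω M) {m : ℕ} (f : Fin m → Fin n ⊕ Fin r → ℤ) :
    (List.ofFn fun i => M (f i)).prod =
      (T (∑ i, ∑ j, if i < j then ω (f i) (f j) else 0) : QCoeff) • M (∑ i, f i) := by
  induction m with
  | zero => simp [S.map_zero]
  | succ m ih =>
    rw [List.ofFn_succ, List.prod_cons, ih fun i => f i.succ, mul_smul_comm, S.map_mul,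
      T_smul_T_smul, ← Fin.sum_univ_succ, S.sum_right]
    congr 2
    rw [Fin.sum_univ_succ (n := m), Fin.sum_univ_succ (n := m)]
    simp only [lt_irrefl, if_false, Fin.succ_pos, if_true, zero_add, Fin.sum_univ_succ (n := m),
      not_lt_zero, Fin.succ_lt_succ_iff]
    rw [add_comm]

theorem evalAt_eq (S : QSeed d B ω M) (hB : ∀ i l, B (Sum.inl i) l = B₀ i l)
    (F : QTorus (Matrix.diagonal d * B₀)) : F.evalAt (fun l => M (col B l)) = S.torusHom hB F := by
  refine Eq.trans ?_ (QTorus.lift_apply F).symm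
  refine Finset.sum_congr rfl fun c _ => ?_
  simp only [← S.map_zsmul, S.list_prod_map, ← mulVec_eq_sum_col]
  rw [← Algebra.smul_def, ← Algebra.smul_def, smul_smul, mul_assoc, ← T_add]
  -- The normalization in `evalAt` cancels the power of `q` from reordering the product of the `Ŷ_i
  -- ^ c_i`.
  have : ∑ i, ∑ j, (if i < j then (Matrix.diagonal d * B₀) j i * c i * c j else 0) +
      ∑ i, ∑ j, (if i < j then ω (c i • col B i) (c j • col B j) else 0) = 0 := by
    rw [← Finset.sum_add_distrib]
    refine Finset.sum_eq_zero fun i _ => ?_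
    rw [← Finset.sum_add_distrib]
    refine Finset.sum_eq_zero fun j _ => ?_
    split_ifs
    · rw [S.zsmul_left, S.zsmul_right, S.skew, S.compat, Matrix.diagonal_mul, ← hB]
      simp only [col]; ring
    · rfl
  rw [this, T_zero, mul_one]

end QSeed

/-! ### Supports in quantum tori -/

namespace QTorus

variable {ι : Type} [Fintype ι] {Λ : Matrix ι ι ℤ}

theorem exists_of_mem_supp_mul {x y : QTorus Λ} {g : ι → ℤ} (hg : g ∈ (x * y).supp) :
    ∃ e ∈ x.supp, ∃ f ∈ y.supp, e + f = g := by
  classical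
  by_contra hcon
  push Not at hcon
  refine mem_supp.1 hg ?_
  rw [coeff_mul]
  exact Finset.sum_eq_zero fun e he => Finset.sum_eq_zero fun f hf => if_neg (hcon e he f hf)

theorem mem_or_mem_of_mem_supp_add {x y : QTorus Λ} {e : ι → ℤ} (he : e ∈ (x + y).supp) :
    e ∈ x.supp ∨ e ∈ y.supp := by
  by_contra hcon
  push Not at hcon
  simp only [mem_supp, not_not] at hcon
  exact mem_supp.1 he (by rw [coeff_add, hcon.1, hcon.2, add_zero])

theorem mem_of_mem_supp_smul {a : QCoeff} {x : QTorus Λ} {e : ι → ℤ} (he : e ∈ (a • x).supp) :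
    e ∈ x.supp :=
  mem_supp.2 fun h => mem_supp.1 he (by rw [coeff_smul, h, mul_zero])

theorem exists_of_mem_supp_sum {α : Type} {s : Finset α} {x : α → QTorus Λ} {e : ι → ℤ}
    (he : e ∈ (∑ i ∈ s, x i).supp) : ∃ i ∈ s, e ∈ (x i).supp := by
  by_contra hcon
  push Not at hcon
  simp only [mem_supp, not_not] at hcon
  exact mem_supp.1 he (by rw [coeff_sum]; exact Finset.sum_eq_zero hcon)

theorem eq_of_mem_supp_mono {e f : ι → ℤ} {a : QCoeff} (h : f ∈ (mono e a : QTorus Λ).supp) :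
    f = e := by
  classical
  by_contra hne
  exact mem_supp.1 h (by rw [coeff_mono, if_neg (Ne.symm hne)])

theorem supp_nonempty {x : QTorus Λ} (hx : x ≠ 0) : x.supp.Nonempty :=
  Finsupp.support_nonempty_iff.2 hx

instance : Module.IsTorsionFree QCoeff (QTorus Λ) :=
  inferInstanceAs (Module.IsTorsionFree QCoeff ((ι → ℤ) →₀ QCoeff))

open Classical in
/-- The part of an element supported on the exponents satisfying `p`. -/
def restrict (p : (ι → ℤ) → Prop) : QTorus Λ →+ QTorus Λ := Finsupp.filterAddHom p

open Classical in
theorem coeff_restrict (p : (ι → ℤ) → Prop) (x : QTorus Λ) (e : ι → ℤ) :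
    (restrict p x).coeff e = if p e then x.coeff e else 0 := Finsupp.filter_apply p x e

theorem restrict_add_restrict_not (p : (ι → ℤ) → Prop) (x : QTorus Λ) :
    restrict p x + restrict (fun e => ¬p e) x = x := by
  refine ext fun e => ?_
  rw [coeff_add, coeff_restrict, coeff_restrict]
  by_cases h : p e <;> simp [h]

theorem mem_supp_restrict {p : (ι → ℤ) → Prop} {x : QTorus Λ} {e : ι → ℤ} :
    e ∈ (restrict p x).supp ↔ p e ∧ e ∈ x.supp := by
  rw [mem_supp, mem_supp, coeff_restrict]
  by_cases h : p e <;> simp [h]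

theorem restrict_smul (p : (ι → ℤ) → Prop) (a : QCoeff) (x : QTorus Λ) :
    restrict p (a • x) = a • restrict p x := by
  refine ext fun e => ?_
  rw [coeff_smul, coeff_restrict, coeff_restrict, coeff_smul]
  by_cases h : p e <;> simp [h]

theorem restrict_eq_zero {p : (ι → ℤ) → Prop} {x : QTorus Λ} (h : ∀ e ∈ x.supp, ¬p e) :
    restrict p x = 0 := by
  refine ext fun e => ?_
  rw [coeff_restrict, coeff_zero]
  by_contra hne
  have h1 : p e := by by_contra hp; simp [hp] at hne
  exact h e (mem_supp.2 (by simpa [h1] using hne)) h1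

open Classical in
theorem restrict_mono (p : (ι → ℤ) → Prop) (e : ι → ℤ) (a : QCoeff) :
    restrict p (mono e a : QTorus Λ) = if p e then mono e a else 0 := by
  refine ext fun f => ?_
  rw [coeff_restrict]
  by_cases hef : e = f
  · subst hef; split_ifs <;> rfl
  · split_ifs <;> simp [coeff_mono, hef, coeff_zero]

/-- The homogeneous component of degree `h` in the variable `i`. -/
def level (i : ι) (h : ℤ) : QTorus Λ →+ QTorus Λ := restrict fun e => e i = h

/-- When both degrees are bounded below, only the two bottom parts contribute to the bottom part of
the product. -/
theorem level_mul {i : ι} {h h' : ℤ} {x y : QTorus Λ} (hx : ∀ e ∈ x.supp, h ≤ e i)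
    (hy : ∀ e ∈ y.supp, h' ≤ e i) : level i (h + h') (x * y) = level i h x * level i h' y := by
  classical
  have h1 : x * y = ∑ e ∈ x.supp, ∑ f ∈ y.supp, mono e (x.coeff e) * mono f (y.coeff f) := by
    conv_lhs => rw [eq_sum x, eq_sum y]
    rw [Finset.sum_mul_sum]
  have h2 : level i h x * level i h' y = ∑ e ∈ x.supp, ∑ f ∈ y.supp,
      level i h (mono e (x.coeff e)) * level i h' (mono f (y.coeff f)) := by
    conv_lhs => rw [eq_sum x, eq_sum y, map_sum, map_sum]
    rw [Finset.sum_mul_sum]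
  rw [h1, h2, map_sum]
  refine Finset.sum_congr rfl fun e he => ?_
  rw [map_sum]
  refine Finset.sum_congr rfl fun f hf => ?_
  have he' := hx e he
  have hf' := hy f hf
  rw [mono_mul_mono, level, level, level, restrict_mono, restrict_mono, restrict_mono, Pi.add_apply]
  by_cases h3 : e i = h
  · by_cases h4 : f i = h'
    · rw [if_pos h3, if_pos h4, if_pos (by omega), mono_mul_mono]
    · rw [if_neg h4, if_neg (by omega), mul_zero]
  · rw [if_neg h3, if_neg (by omega), zero_mul]

end QTorus

/-! ### Exponents of the coefficient variables -/

section Frozen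

variable {n r : ℕ}

/-- Induction over exponent vectors which are nonnegative on the principal part. -/
theorem exponent_induction {p : (Fin n ⊕ Fin r → ℤ) → Prop}
    (h0 : ∀ u, (∀ i : Fin n, u (Sum.inl i) = 0) → p u)
    (hs : ∀ u (i : Fin n), p u → p (u + basisVec r i)) (u : Fin n ⊕ Fin r → ℤ)
    (hu : ∀ i : Fin n, 0 ≤ u (Sum.inl i)) : p u := by
  induction h : (∑ i : Fin n, u (Sum.inl i)).toNat generalizing u with
  | zero =>
    refine h0 u fun i => le_antisymm ?_ (hu i)
    have h1 := Finset.single_le_sum (f := fun i : Fin n => u (Sum.inl i)) (fun i _ => hu i)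
      (Finset.mem_univ i)
    omega
  | succ m ih =>
    obtain ⟨i, hi⟩ : ∃ i : Fin n, 0 < u (Sum.inl i) := by
      by_contra hcon
      push Not at hcon
      have := Finset.sum_nonpos fun i (_ : i ∈ Finset.univ) => hcon i
      omega
    have h2 : ∀ k : Fin n, (u - basisVec r i) (Sum.inl k) =
        u (Sum.inl k) - if k = i then 1 else 0 := fun k => by
      simp [Pi.single_apply]
    have := hs (u - basisVec r i) i (ih _ (fun k => ?_) ?_)
    · rwa [sub_add_cancel] at this
    · rw [h2]
      have := hu k
      split_ifs with hk
      · subst hk; omega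
      · omega
    · simp only [h2, Finset.sum_sub_distrib, Finset.sum_ite_eq', Finset.mem_univ, if_true]
      omega

theorem foldSeed_of_eq_zero {K : Type} [DivisionRing K] [Algebra QCoeff K] [FaithfulSMul QCoeff K]
    {d : Fin n → ℤ} {B : ExchangeMatrix n r}
    {ω : (Fin n ⊕ Fin r → ℤ) → (Fin n ⊕ Fin r → ℤ) → ℤ} {M : (Fin n ⊕ Fin r → ℤ) → K}
    (S : QSeed d B ω M) (hd : ∀ k l, 0 < d k * d l) (w : List (Fin n)) {u : Fin n ⊕ Fin r → ℤ}
    (hu : ∀ i : Fin n, u (Sum.inl i) = 0) : (foldSeed d w (M, B)).1 u = M u := by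
  induction w using List.reverseRecOn with
  | nil => rfl
  | append_singleton w k ih =>
    obtain ⟨ω', S'⟩ := S.foldSeed hd w
    rw [foldSeed_append_singleton, S'.mutFrame_of_eq_zero (QSeed.ne_zero hd k) (hu k), ih]

/-- The exchange relation `M'(e_k) M(e_k) = q^{α/2} M(u) + q^{(α + d_k)/2} M(u + b_k)`. -/
theorem QSeed.exchange {K : Type} [DivisionRing K] [Algebra QCoeff K] [FaithfulSMul QCoeff K]
    {d : Fin n → ℤ} {B : ExchangeMatrix n r}
    {ω : (Fin n ⊕ Fin r → ℤ) → (Fin n ⊕ Fin r → ℤ) → ℤ} {M : (Fin n ⊕ Fin r → ℤ) → K}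
    (S : QSeed d B ω M) {k : Fin n} (hd : d k ≠ 0) :
    ∃ α, mutFrame d k B M (basisVec r k) * M (basisVec r k) =
      (T α : QCoeff) • M (fun i => max 0 (-B i k)) +
        (T (α + d k) : QCoeff) • M (fun i => max 0 (B i k)) := by
  have h0 := S.diag hd
  have h1 : (fun i => max 0 (-B i k)) = eMap k B (basisVec r k) + basisVec r k := by
    funext i
    by_cases hi : i = Sum.inl k
    · subst hi; simp [h0]
    · rw [Pi.add_apply, eMap_apply_of_ne _ _ hi]; simp [hi]
  have h2 : (fun i => max 0 (B i k)) = eMap k B (basisVec r k) + col B k + basisVec r k := by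
    rw [add_right_comm, ← h1]
    funext i
    simp only [Pi.add_apply, col]
    omega
  refine ⟨ω (eMap k B (basisVec r k)) (basisVec r k), ?_⟩
  rw [S.mutFrame_of_eq_one hd (by simp), add_mul, S.map_mul, S.map_mul, h1, h2, S.add_left,
    S.compat]
  simp

/-- In a quantum torus, the cluster variables are polynomials, not divisible by the coefficient
variable `y`, in each coefficient variable `y`. -/
theorem foldSeed_level {L : Matrix (Fin n ⊕ Fin r) (Fin n ⊕ Fin r) ℤ} {d : Fin n → ℤ}
    {B : ExchangeMatrix n r} {ω : (Fin n ⊕ Fin r → ℤ) → (Fin n ⊕ Fin r → ℤ) → ℤ}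
    (S : QSeed d B ω (ToricFrame.refl L).map) (hd : ∀ k l, 0 < d k * d l) (y : Fin r)
    (w : List (Fin n)) (i : Fin n) :
    ∃ m : QTorus L, (foldSeed d w ((ToricFrame.refl L).map, B)).1 (basisVec r i) = QTorus.num L m ∧
      (∀ e ∈ m.supp, 0 ≤ e (Sum.inr y)) ∧ QTorus.level (Sum.inr y) 0 m ≠ 0 := by
  classical
  have hX : ∀ c : Fin n ⊕ Fin r → ℤ, 0 ≤ c (Sum.inr y) →
      (∀ e ∈ (QTorus.X c : QTorus L).supp, 0 ≤ e (Sum.inr y)) := fun c hc e he => by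
    rw [QTorus.eq_of_mem_supp_mono he]; exact hc
  have hX0 : ∀ c : Fin n ⊕ Fin r → ℤ, c (Sum.inr y) = 0 →
      QTorus.level (Sum.inr y) 0 (QTorus.X c : QTorus L) ≠ 0 := fun c hc h => by
    rw [QTorus.level, QTorus.X, QTorus.restrict_mono, if_pos hc] at h
    exact one_ne_zero (QTorus.mono_injective c (h.trans (QTorus.mono_zero c).symm))
  induction w using List.reverseRecOn generalizing i with
  | nil => exact ⟨QTorus.X (basisVec r i), rfl, hX (basisVec r i) (by simp), hX0 (basisVec r i) (by simp)⟩
  | append_singleton w k ih =>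
    obtain ⟨ω', S'⟩ := S.foldSeed hd w
    by_cases hik : i = k
    swap
    · rw [foldSeed_append_singleton, S'.mutFrame_of_eq_zero (QSeed.ne_zero hd k)
        (by simp [Ne.symm hik])]
      exact ih i
    subst hik
    have hdi := QSeed.ne_zero hd i
    -- The Laurent phenomenon places the new variable in the torus, so the exchange relation can be
    -- read there and compared by degree in `y`.
    have hlaur := S.foldSeed_basisVec_mem_laurent hd (w ++ [i]) i
    have hrange : ∀ x ∈ laurent (ToricFrame.refl L).map, ∃ m, x = QTorus.num L m := fun x hx => by
      refine S.laurent_induction (p := fun x => ∃ m, x = QTorus.num L m) hx (fun c => ⟨_, rfl⟩)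
        ⟨0, (map_zero _).symm⟩ ?_ ?_
      · rintro _ _ ⟨m, rfl⟩ ⟨m', rfl⟩
        exact ⟨m + m', (map_add _ _ _).symm⟩
      · rintro a _ ⟨m, rfl⟩
        exact ⟨a • m, (QTorus.num_smul _ _).symm⟩
    obtain ⟨m', hm'⟩ := hrange _ hlaur
    obtain ⟨x, hx, hx1, hx2⟩ := ih i
    rw [foldSeed_append_singleton] at hm' ⊢
    set M := (foldSeed d w ((ToricFrame.refl L).map, B)).1 with hM
    set Bw := foldMatrix w B with hBw
    have hmono : ∀ u : Fin n ⊕ Fin r → ℤ, (∀ i : Fin n, 0 ≤ u (Sum.inl i)) →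
        0 ≤ u (Sum.inr y) → ∃ m : QTorus L, M u = QTorus.num L m ∧
          (∀ e ∈ m.supp, 0 ≤ e (Sum.inr y)) ∧
          (u (Sum.inr y) = 0 → QTorus.level (Sum.inr y) 0 m ≠ 0) := by
      refine exponent_induction (p := fun u => 0 ≤ u (Sum.inr y) → ∃ m : QTorus L,
        M u = QTorus.num L m ∧ (∀ e ∈ m.supp, 0 ≤ e (Sum.inr y)) ∧
          (u (Sum.inr y) = 0 → QTorus.level (Sum.inr y) 0 m ≠ 0)) (fun u hu huy => ?_)
          (fun u i hu huy => ?_)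
      · exact ⟨QTorus.X u, by rw [hM, foldSeed_of_eq_zero S hd w hu]; rfl, hX u huy, hX0 u⟩
      · have huy' : u (Sum.inr y) = (u + basisVec r i) (Sum.inr y) := by simp
        obtain ⟨m, h1, h2, h3⟩ := hu (huy'.symm ▸ huy)
        obtain ⟨x, g1, g2, g3⟩ := ih i
        refine ⟨(T (-ω' u (basisVec r i)) : QCoeff) • (m * x), ?_, fun e he => ?_, fun h0 => ?_⟩
        · rw [S'.map_add, h1, g1, QTorus.num_smul, map_mul]
        · obtain ⟨e1, he1, e2, he2, rfl⟩ :=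
            QTorus.exists_of_mem_supp_mul (QTorus.mem_of_mem_supp_smul he)
          exact add_nonneg (h2 e1 he1) (g2 e2 he2)
        · have := QTorus.level_mul (h := 0) (h' := 0) h2 g2
          rw [add_zero] at this
          rw [QTorus.level, QTorus.restrict_smul, ← QTorus.level, this]
          exact smul_ne_zero (QTorus.T_ne_zero _) (mul_ne_zero (h3 (huy'.trans h0)) g3)
    obtain ⟨m1, h11, h12, h13⟩ := hmono (fun l => max 0 (-Bw l i)) (fun _ => le_max_left _ _)
      (le_max_left _ _)
    obtain ⟨m2, h21, h22, h23⟩ := hmono (fun l => max 0 (Bw l i)) (fun _ => le_max_left _ _)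
      (le_max_left _ _)
    obtain ⟨α, hα⟩ := S'.exchange hdi
    set R : QTorus L := (T α : QCoeff) • m1 + (T (α + d i) : QCoeff) • m2 with hR
    have hrel : m' * x = R := by
      refine QTorus.num_injective ?_
      rw [hR, map_mul, ← hm', ← hx, hα, h11, h21, map_add, QTorus.num_smul, QTorus.num_smul]
    have hRnn : ∀ e ∈ R.supp, 0 ≤ e (Sum.inr y) := fun e he => by
      rcases QTorus.mem_or_mem_of_mem_supp_add he with he | he
      · exact h12 e (QTorus.mem_of_mem_supp_smul he)
      · exact h22 e (QTorus.mem_of_mem_supp_smul he)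
    have hcomm : ∀ (u : Fin n ⊕ Fin r → ℤ) (m : QTorus L), M u = QTorus.num L m →
        (∀ e ∈ m.supp, 0 ≤ e (Sum.inr y)) →
        QTorus.level (Sum.inr y) 0 x * QTorus.level (Sum.inr y) 0 m =
          (T (2 * ω' (basisVec r i) u) : QCoeff) •
            (QTorus.level (Sum.inr y) 0 m * QTorus.level (Sum.inr y) 0 x) := by
      intro u m hu hm
      have h := S'.map_commute (basisVec r i) u
      have h' : x * m = (T (2 * ω' (basisVec r i) u) : QCoeff) • (m * x) := by
        refine QTorus.num_injective ?_
        rw [map_mul, ← hu, ← hx, h, QTorus.num_smul, map_mul, ← hu, ← hx]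
      have h1 := QTorus.level_mul (h := 0) (h' := 0) hx1 hm
      have h2 := QTorus.level_mul (h := 0) (h' := 0) hm hx1
      rw [add_zero] at h1 h2
      rw [← h1, ← h2, h', QTorus.level, QTorus.restrict_smul]
    -- If the parts of degree `0` of the two exchange monomials cancelled, they would be
    -- proportional; but they quasi-commute with the old variable by powers of `q` whose ratio is a
    -- nontrivial power of `q`.
    have hR0 : QTorus.level (Sum.inr y) 0 R ≠ 0 := by
      intro h0
      rw [hR, map_add, QTorus.level, QTorus.restrict_smul, QTorus.restrict_smul, ← QTorus.level]
        at h0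
      have hc1 := hcomm _ m1 h11 h12
      have hc2 := hcomm _ m2 h21 h22
      set μ1 := QTorus.level (Sum.inr y) 0 m1
      set μ2 := QTorus.level (Sum.inr y) 0 m2
      set ξ := QTorus.level (Sum.inr y) 0 x
      have hμ1 : μ1 = -((T (d i) : QCoeff) • μ2) := by
        rw [eq_neg_iff_add_eq_zero]
        have := congrArg (fun z => (T (-α) : QCoeff) • z) h0
        simpa [smul_add, T_smul_T_smul] using this
      -- One of `[b]_+` and `[-b]_+` is zero, so at least one of the two parts is nonzero; being
      -- proportional, they would both be.
      have hμ2 : μ2 ≠ 0 := fun h => by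
        rw [h, smul_zero, neg_zero] at hμ1
        have e1 : max 0 (-Bw (Sum.inr y) i) ≠ 0 := fun h => h13 h hμ1
        have e2 : max 0 (Bw (Sum.inr y) i) ≠ 0 := fun h' => h23 h' h
        omega
      have hω : ω' (basisVec r i) (fun l => max 0 (Bw l i)) =
          ω' (basisVec r i) (fun l => max 0 (-Bw l i)) - d i := by
        have : (fun l => max 0 (Bw l i)) = (fun l => max 0 (-Bw l i)) + col Bw i := by
          funext l; simp only [Pi.add_apply, col]; omega
        rw [this, S'.add_right, S'.compat_right]; simp; ring
      rw [hμ1, mul_neg, neg_mul, smul_neg, neg_inj, mul_smul_comm, smul_mul_assoc, hc2,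
        T_smul_T_smul, T_smul_T_smul, ← sub_eq_zero, ← sub_smul] at hc1
      have h5 := (smul_eq_zero.1 hc1).resolve_right (mul_ne_zero hμ2 hx2)
      have h6 := T_injective (sub_eq_zero.1 h5)
      rw [hω] at h6
      omega
    have hm'0 : m' ≠ 0 := by
      rintro rfl
      rw [zero_mul] at hrel
      exact hR0 (by rw [← hrel, map_zero])
    obtain ⟨e0, he0, hmin⟩ := m'.supp.exists_min_image (fun e => e (Sum.inr y))
      (QTorus.supp_nonempty hm'0)
    -- The lowest `y`-degree is additive in a domain: that of the old variable is `0` and that of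
    -- the right side is not negative, so that of the new variable is not negative.
    have hprod := QTorus.level_mul (h := e0 (Sum.inr y)) (h' := 0) hmin hx1
    rw [add_zero, hrel] at hprod
    have hlev : QTorus.level (Sum.inr y) (e0 (Sum.inr y)) m' ≠ 0 := fun h => by
      have : e0 ∈ (QTorus.level (Sum.inr y) (e0 (Sum.inr y)) m').supp :=
        QTorus.mem_supp_restrict.2 ⟨rfl, he0⟩
      rw [h] at this
      exact QTorus.mem_supp.1 this (QTorus.coeff_zero _)
    have hge : 0 ≤ e0 (Sum.inr y) := by
      by_contra hneg
      refine mul_ne_zero hlev hx2 ?_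
      rw [← hprod]
      refine QTorus.restrict_eq_zero fun e he hee => ?_
      have := hRnn e he
      omega
    have hnn : ∀ e ∈ m'.supp, 0 ≤ e (Sum.inr y) := fun e he => hge.trans (hmin e he)
    refine ⟨m', hm', hnn, fun h => ?_⟩
    have := QTorus.level_mul (h := 0) (h' := 0) hnn hx1
    rw [add_zero, hrel, h, zero_mul] at this
    exact hR0 this

end Frozen

/-! ### g-vectors -/

section GVectors

variable {n : ℕ}

/-- The exponents of the coefficient variables in the image of a basis vector under `gMap`, for
principal coefficients. -/
def frozenShift (w : List (Fin n)) (B₀ : Matrix (Fin n) (Fin n) ℤ) (j : Fin n) : Fin n → ℤ :=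
  fun l => gMap w (principalMatrix B₀) (basisVec n j) (Sum.inr l)

/-- The extended g-vector for the exchange matrix `B` with principal part `B₀`. -/
def extG {r : ℕ} (w : List (Fin n)) (B₀ : Matrix (Fin n) (Fin n) ℤ) (j : Fin n)
    (B : ExchangeMatrix n r) : Fin n ⊕ Fin r → ℤ :=
  gMap w B (basisVec r j) - B.mulVec (frozenShift w B₀ j)

/-- The g-vector. -/
def gVec (w : List (Fin n)) (B₀ : Matrix (Fin n) (Fin n) ℤ) (j : Fin n) : Fin n → ℤ :=
  fun i => extG w B₀ j (principalMatrix B₀) (Sum.inl i)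

theorem principalMatrix_inl (B₀ : Matrix (Fin n) (Fin n) ℤ) (i l : Fin n) :
    principalMatrix B₀ (Sum.inl i) l = B₀ i l := rfl

theorem principalMatrix_mulVec_inr (B₀ : Matrix (Fin n) (Fin n) ℤ) (c : Fin n → ℤ) (l : Fin n) :
    (principalMatrix B₀).mulVec c (Sum.inr l) = c l := by
  simp [principalMatrix, Matrix.fromRows_mulVec]

theorem extG_principalMatrix (w : List (Fin n)) (B₀ : Matrix (Fin n) (Fin n) ℤ) (j : Fin n) :
    extG w B₀ j (principalMatrix B₀) = Sum.elim (gVec w B₀ j) 0 := by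
  funext i
  cases i with
  | inl i => rfl
  | inr l =>
    simp only [extG, Pi.sub_apply, principalMatrix_mulVec_inr]
    simp [frozenShift]

theorem extG_comp {r r' : ℕ} {f : Fin r → Fin r'} {B : ExchangeMatrix n r}
    {B' : ExchangeMatrix n r'} (h : ∀ i l, B' (Sum.map id f i) l = B i l) (w : List (Fin n))
    (B₀ : Matrix (Fin n) (Fin n) ℤ) (j : Fin n) :
    extG w B₀ j B' ∘ Sum.map id f = extG w B₀ j B := by
  have h1 := gMap_comp h w (basisVec r' j)
  have h2 : (basisVec r' j ∘ Sum.map id f : Fin n ⊕ Fin r → ℤ) = basisVec r j := by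
    funext i
    simp [Pi.single_apply, map_eq_inl_iff]
  funext i
  have h3 := congrFun h1 i
  rw [h2] at h3
  simp only [extG, Pi.sub_apply, Function.comp_apply] at h3 ⊢
  rw [h3]
  simp only [Matrix.mulVec, dotProduct, h]

theorem comp_bareMatrix {r : ℕ} {B₀ : Matrix (Fin n) (Fin n) ℤ} {B : ExchangeMatrix n r}
    (hB : ∀ i l, B (Sum.inl i) l = B₀ i l) (i : Fin n ⊕ Fin 0) (l : Fin n) :
    B (Sum.map id Fin.elim0 i) l = bareMatrix B₀ i l := by
  cases i with
  | inl i => exact hB i l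
  | inr i => exact i.elim0

/-- Both sides are compared with the matrix that has no frozen rows. -/
theorem extG_inl {r : ℕ} {B₀ : Matrix (Fin n) (Fin n) ℤ} {B : ExchangeMatrix n r}
    (hB : ∀ i l, B (Sum.inl i) l = B₀ i l) (w : List (Fin n)) (j i : Fin n) :
    extG w B₀ j B (Sum.inl i) = gVec w B₀ j i := by
  have h1 := congrFun (extG_comp (comp_bareMatrix hB) w B₀ j) (Sum.inl i)
  have h2 := congrFun (extG_comp (comp_bareMatrix (principalMatrix_inl B₀)) w B₀ j) (Sum.inl i)
  exact h1.trans h2.symm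

end GVectors

/-! ### Quantum F-polynomials -/

/-- A block computation: the terms with `Λ` cancel in pairs, and the rest uses `(B⁰)ᵀ D = -D B⁰`. -/
theorem isCompatible_principalForm {n : ℕ} {d : Fin n → ℤ} {B₀ : Matrix (Fin n) (Fin n) ℤ}
    (hB₀ : (Matrix.diagonal d * B₀).transpose = -(Matrix.diagonal d * B₀))
    {Λ : Matrix (Fin n) (Fin n) ℤ} (hΛ : Λ.transpose = -Λ) :
    IsCompatible d (principalForm d B₀ Λ) (principalMatrix B₀) := by
  have h1 : B₀.transpose * Matrix.diagonal d = -(Matrix.diagonal d * B₀) := by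
    rw [← hB₀, Matrix.transpose_mul, Matrix.diagonal_transpose]
  constructor
  · rw [principalForm, Matrix.fromBlocks_transpose, Matrix.fromBlocks_neg]
    congr 1
    · rw [Matrix.transpose_add, Matrix.transpose_neg, Matrix.transpose_mul,
        Matrix.transpose_transpose, Matrix.diagonal_transpose, hΛ, Matrix.neg_mul]
      abel
    · rw [Matrix.transpose_sub, Matrix.transpose_neg, Matrix.transpose_mul,
        Matrix.diagonal_transpose, hΛ, Matrix.mul_neg]
      abel
    · rw [h1, Matrix.transpose_add, Matrix.transpose_neg, hB₀]
      simp [Matrix.transpose_mul, hΛ, Matrix.mul_assoc]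
      abel
  · have : (principalMatrix B₀).transpose = Matrix.fromCols B₀.transpose 1 := by
      rw [principalMatrix, Matrix.transpose_fromRows, Matrix.transpose_one]
    rw [this, principalForm, ← Matrix.fromRows_fromCols_eq_fromBlocks]
    have hadd : ∀ a b c e : Matrix (Fin n) (Fin n) ℤ,
        Matrix.fromCols a b + Matrix.fromCols c e = Matrix.fromCols (a + c) (b + e) := by
      intro a b c e
      ext i (l | l) <;> rfl
    rw [Matrix.fromCols_mul_fromRows, Matrix.one_mul, Matrix.mul_fromCols, hadd, Matrix.mul_sub,
      Matrix.mul_neg, ← Matrix.mul_assoc]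
    congr 1 <;> abel

section Quantum

variable {n : ℕ} {d : Fin n → ℤ}

theorem exists_universal_fraction (hd : ∀ k l, 0 < d k * d l)
    (B₀ : Matrix (Fin n) (Fin n) ℤ) (w : List (Fin n)) (j : Fin n) :
    ∃ F : QField (Matrix.diagonal d * B₀),
      ∀ (r : ℕ) (B : ExchangeMatrix n r) (hB : ∀ i l, B (Sum.inl i) l = B₀ i l)
        (K : Type) [DivisionRing K] [Algebra QCoeff K] [FaithfulSMul QCoeff K]
        (ω : (Fin n ⊕ Fin r → ℤ) → (Fin n ⊕ Fin r → ℤ) → ℤ) (M : (Fin n ⊕ Fin r → ℤ) → K)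
        (S : QSeed d B ω M) (hM : LinearIndependent QCoeff M),
      (foldSeed d w (M, B)).1 (basisVec r j) = S.ev hd hM hB F * M (extG w B₀ j B) := by
  obtain ⟨P, C, h⟩ := exists_universal_formula hd B₀ w
  -- The scalar comes from splitting `M(B f + g̃)` into `M(B f) M(g̃)`. It depends only on the
  -- principal part of `g̃`, so it can be included in `F` once for all coefficient systems.
  refine ⟨(T (-∑ l, d l * frozenShift w B₀ j l * gVec w B₀ j l) : QCoeff) • (P (basisVec 0 j) *
    QTorus.num _ (QTorus.X (frozenShift w B₀ j))), fun r B hB K _ _ _ ω M S hM => ?_⟩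
  have hj : principalPart (basisVec r j) = basisVec 0 j := by
    funext i
    simp [principalPart, Pi.single_apply, map_eq_inl_iff]
  have hG : gMap w B (basisVec r j) = B.mulVec (frozenShift w B₀ j) + extG w B₀ j B := by
    rw [extG]; abel
  rw [(h r B hB K ω M S hM).2, hj, hG, S.map_add, S.form_mulVec, S.ev_smul, map_mul, S.ev_num,
    S.torusHom_X, smul_mul_assoc, mul_smul_comm, mul_assoc]
  simp only [extG_inl hB]

/-- The inclusion of the torus in the variables `Z_i` in the torus of principal coefficients. -/
theorem torusHom_refl {r : ℕ} {L : Matrix (Fin n ⊕ Fin r) (Fin n ⊕ Fin r) ℤ}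
    {B : ExchangeMatrix n r} {ω : (Fin n ⊕ Fin r → ℤ) → (Fin n ⊕ Fin r → ℤ) → ℤ}
    {B₀ : Matrix (Fin n) (Fin n) ℤ} (S : QSeed d B ω (ToricFrame.refl L).map)
    (hB : ∀ i l, B (Sum.inl i) l = B₀ i l) (x : QTorus (Matrix.diagonal d * B₀)) :
    S.torusHom hB x =
      QTorus.num L (∑ c ∈ x.supp, QTorus.mono (B.mulVec c) (x.coeff c)) := by
  rw [map_sum]
  refine (QTorus.lift_apply x).trans (Finset.sum_congr rfl fun c _ => ?_)
  rw [ToricFrame.refl_map, ← Algebra.smul_def, ← QTorus.num_smul, QTorus.X, QTorus.smul_mono,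
    mul_one]

/-- The degree of the exponents which vanishes on the columns of the principal matrix. -/
theorem laurentDegree_mulVec (B₀ : Matrix (Fin n) (Fin n) ℤ) (c : Fin n → ℤ) :
    laurentDegree B₀ ((principalMatrix B₀).mulVec c) = 0 := by
  funext i
  simp only [laurentDegree, principalMatrix_mulVec_inr]
  simp [principalMatrix, Matrix.mulVec, dotProduct]

theorem laurentDegree_add (B₀ : Matrix (Fin n) (Fin n) ℤ) (e f : Fin n ⊕ Fin n → ℤ) :
    laurentDegree B₀ (e + f) = laurentDegree B₀ e + laurentDegree B₀ f := by
  funext i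
  simp only [laurentDegree, Pi.add_apply, mul_add, Finset.sum_add_distrib]
  ring

/-- Degree `0` says that the `x`-part of the exponent is `B` applied to its `y`-part. -/
theorem eq_mulVec_of_laurentDegree (B₀ : Matrix (Fin n) (Fin n) ℤ) {e : Fin n ⊕ Fin n → ℤ}
    (h : laurentDegree B₀ e = 0) : (principalMatrix B₀).mulVec (fun l => e (Sum.inr l)) = e := by
  funext i
  cases i with
  | inl i =>
    have := congrFun h i
    simp only [laurentDegree, Pi.zero_apply, sub_eq_zero] at this
    rw [this]
    rfl
  | inr l => rw [principalMatrix_mulVec_inr]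

/-- If `α x = β` with `α ≠ 0` and `β` homogeneous of degree `0`, then `x` is homogeneous of
degree `0`. -/
theorem laurentDegree_of_mul_eq {L : Matrix (Fin n ⊕ Fin n) (Fin n ⊕ Fin n) ℤ}
    (B₀ : Matrix (Fin n) (Fin n) ℤ) {α β x : QTorus L} (hα0 : α ≠ 0)
    (hα : ∀ e ∈ α.supp, laurentDegree B₀ e = 0) (hβ : ∀ e ∈ β.supp, laurentDegree B₀ e = 0)
    (h : α * x = β) : ∀ e ∈ x.supp, laurentDegree B₀ e = 0 := by
  set p : (Fin n ⊕ Fin n → ℤ) → Prop := fun e => laurentDegree B₀ e = 0 with hp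
  have h1 : α * QTorus.restrict p x + α * QTorus.restrict (fun e => ¬p e) x = β := by
    rw [← mul_add, QTorus.restrict_add_restrict_not, h]
  have h2 : α * QTorus.restrict (fun e => ¬p e) x = 0 := by
    by_contra hne
    obtain ⟨e, he⟩ := QTorus.supp_nonempty hne
    have hdeg : laurentDegree B₀ e ≠ 0 := by
      obtain ⟨f, hf, g, hg, rfl⟩ := QTorus.exists_of_mem_supp_mul he
      rw [laurentDegree_add, hα f hf, zero_add]
      exact (QTorus.mem_supp_restrict.1 hg).1
    have h3 : (α * QTorus.restrict p x).coeff e = 0 := by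
      by_contra hne'
      obtain ⟨f, hf, g, hg, hfg⟩ := QTorus.exists_of_mem_supp_mul (QTorus.mem_supp.2 hne')
      apply hdeg
      rw [← hfg, laurentDegree_add, hα f hf, zero_add]
      exact (QTorus.mem_supp_restrict.1 hg).1
    have h4 : β.coeff e = 0 := by
      by_contra hne'
      exact hdeg (hβ e (QTorus.mem_supp.2 hne'))
    rw [← h1, QTorus.coeff_add, h3, zero_add] at h4
    exact QTorus.mem_supp.1 he h4
  have h3 := (mul_eq_zero.1 h2).resolve_left hα0
  intro e he
  by_contra hne
  have : e ∈ (QTorus.restrict (fun e => ¬p e) x).supp := QTorus.mem_supp_restrict.2 ⟨hne, he⟩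
  rw [h3] at this
  exact QTorus.mem_supp.1 this (QTorus.coeff_zero _)

/-- The universal fraction can be tested in one algebra, since its evaluation there is injective.
Principal coefficients with `Λ = 0` are chosen because there the exponent of `Z` can be read off
from the `y`-variables. -/
theorem exists_quantum_fPolynomial (hd : ∀ k l, 0 < d k * d l) {B₀ : Matrix (Fin n) (Fin n) ℤ}
    (hB₀ : (Matrix.diagonal d * B₀).transpose = -(Matrix.diagonal d * B₀)) (w : List (Fin n))
    (j : Fin n) :
    ∃ F : QTorus (Matrix.diagonal d * B₀), F.IsPolynomial ∧
      ∀ (r : ℕ) (B : ExchangeMatrix n r) (hB : ∀ i l, B (Sum.inl i) l = B₀ i l)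
        (K : Type) [DivisionRing K] [Algebra QCoeff K] [FaithfulSMul QCoeff K]
        (ω : (Fin n ⊕ Fin r → ℤ) → (Fin n ⊕ Fin r → ℤ) → ℤ) (M : (Fin n ⊕ Fin r → ℤ) → K)
        (S : QSeed d B ω M), LinearIndependent QCoeff M →
      (foldSeed d w (M, B)).1 (basisVec r j) = S.torusHom hB F * M (extG w B₀ j B) := by
  obtain ⟨F, hF⟩ := exists_universal_fraction hd B₀ w j
  set L := principalForm d B₀ 0 with hL
  have hcompat : IsCompatible d (ToricFrame.refl L).form (principalMatrix B₀) := by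
    rw [ToricFrame.refl_form]
    exact isCompatible_principalForm hB₀ (by simp)
  have S := (ToricFrame.refl L).qSeed hcompat
  have hM := (ToricFrame.refl L).linearIndependent
  have hB := principalMatrix_inl B₀
  have hX := hF n (principalMatrix B₀) hB _ _ _ S hM
  rw [extG_principalMatrix] at hX
  set g : Fin n ⊕ Fin n → ℤ := Sum.elim (gVec w B₀ j) 0 with hg
  -- the Laurent polynomial, divided by the leading monomial
  obtain ⟨x, hx⟩ : ∃ x : QTorus L, S.ev hd hM hB F = QTorus.num L x ∧
      ∀ e ∈ x.supp, ∀ l, 0 ≤ e (Sum.inr l) := by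
    -- Any frozen variable serves to obtain `m`; the index `j` shows that one exists. Division by
    -- `X^g` does not change the `y`-exponents, because the frozen part of `g` is zero.
    obtain ⟨m, hm, -, -⟩ := foldSeed_level S hd j w j
    refine ⟨m * QTorus.X (-g), ?_, fun e he l => ?_⟩
    · rw [map_mul, ← hm, hX, mul_assoc, ← ToricFrame.refl_map, S.map_mul_neg, mul_one]
    · obtain ⟨m', hm', hnn, -⟩ := foldSeed_level S hd l w j
      have : m = m' := QTorus.num_injective (hm.symm.trans hm')
      subst this
      obtain ⟨e1, he1, e2, he2, rfl⟩ := QTorus.exists_of_mem_supp_mul he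
      rw [QTorus.eq_of_mem_supp_mono he2]
      simpa [hg] using hnn e1 he1
  have hdeg : ∀ e ∈ x.supp, laurentDegree B₀ e = 0 := by
    have hsum : ∀ y : QTorus (Matrix.diagonal d * B₀),
        ∀ e ∈ (∑ c ∈ y.supp, QTorus.mono ((principalMatrix B₀).mulVec c) (y.coeff c) :
          QTorus L).supp, laurentDegree B₀ e = 0 := fun y e he => by
      obtain ⟨c, -, hc⟩ := QTorus.exists_of_mem_supp_sum he
      rw [QTorus.eq_of_mem_supp_mono hc, laurentDegree_mulVec]
    -- Writing `F` as a left fraction `α⁻¹ β` gives `α x = β` in the torus, where the images of `α`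
    -- and `β` have degree `0`.
    induction F using OreLocalization.ind with
    | _ β α =>
    have h1 : QTorus.num _ (α : QTorus (Matrix.diagonal d * B₀)) * (β /ₒ α) = QTorus.num _ β := by
      exact OreLocalization.mul_cancel
    have h2 := congrArg (S.ev hd hM hB) h1
    rw [map_mul, hx.1, S.ev_num, S.ev_num, torusHom_refl, torusHom_refl, ← map_mul] at h2
    refine laurentDegree_of_mul_eq B₀ (fun h0 => ?_) (hsum _) (hsum _) (QTorus.num_injective h2)
    have h3 : S.torusHom hB α = 0 := by rw [torusHom_refl, h0, map_zero]
    exact nonZeroDivisors.ne_zero α.2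
      ((injective_iff_map_eq_zero _).1 (S.torusHom_injective hd hM hB) _ h3)
  set F' : QTorus (Matrix.diagonal d * B₀) :=
    ∑ e ∈ x.supp, QTorus.mono (fun l => e (Sum.inr l)) (x.coeff e) with hF'
  have hev : S.torusHom hB F' = QTorus.num L x := by
    rw [hF', map_sum]
    conv_rhs => rw [QTorus.eq_sum x, map_sum]
    refine Finset.sum_congr rfl fun e he => ?_
    refine (QTorus.lift_mono _ _).trans ?_
    rw [eq_mulVec_of_laurentDegree B₀ (hdeg e he), ToricFrame.refl_map, ← Algebra.smul_def,
      ← QTorus.num_smul, QTorus.X, QTorus.smul_mono, mul_one]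
  have hFF' : F = QTorus.num _ F' :=
    (S.ev hd hM hB).injective (by rw [hx.1, S.ev_num, hev])
  refine ⟨F', fun c hc i => ?_, fun r B hB K _ _ _ ω M S hM => ?_⟩
  · obtain ⟨e, he, hce⟩ := QTorus.exists_of_mem_supp_sum hc
    rw [QTorus.eq_of_mem_supp_mono hce]
    exact hx.2 e he i
  · rw [hF r B hB K ω M S hM, hFF', S.ev_num]

end Quantum

/-! ### Values of rational functions -/

section Values

variable {σ : Type}

theorem ratVar_ne_zero (i : σ) : (ratVar i : RatField σ) ≠ 0 :=
  (map_ne_zero_iff _ (IsFractionRing.injective (MvPolynomial σ ℤ) (RatField σ))).2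
    (MvPolynomial.X_ne_zero i)

theorem algebraMap_ratField_ne_zero {p : MvPolynomial σ ℤ} (hp : p ≠ 0) :
    algebraMap (MvPolynomial σ ℤ) (RatField σ) p ≠ 0 :=
  (map_ne_zero_iff _ (IsFractionRing.injective (MvPolynomial σ ℤ) (RatField σ))).2 hp

variable {K : Type} [Field K]

/-- The rational function `f` is defined at `v`, with value `a`. -/
def HasValue (v : σ → K) (f : RatField σ) (a : K) : Prop :=
  ∃ p q : MvPolynomial σ ℤ, MvPolynomial.aeval v q ≠ 0 ∧
    f = algebraMap _ (RatField σ) p / algebraMap _ (RatField σ) q ∧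
    a = MvPolynomial.aeval v p / MvPolynomial.aeval v q

namespace HasValue

variable {v : σ → K} {f g : RatField σ} {a b : K}

/-- The reduced denominator divides every other denominator, so it does not vanish where another one
does not. Values may thus be computed from any admissible fraction. -/
theorem evalRat_eq (h : HasValue v f a) : evalRat v f = a := by
  obtain ⟨p, q, hq, hf, rfl⟩ := h
  set s := IsFractionRing.num (MvPolynomial σ ℤ) f with hs
  set t : MvPolynomial σ ℤ := (IsFractionRing.den (MvPolynomial σ ℤ) f : MvPolynomial σ ℤ) with ht
  have ht0 : t ≠ 0 := nonZeroDivisors.ne_zero (IsFractionRing.den (MvPolynomial σ ℤ) f).2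
  have hq0 : q ≠ 0 := by rintro rfl; simp at hq
  have hst : f = algebraMap _ (RatField σ) s / algebraMap _ (RatField σ) t :=
    (IsFractionRing.mk'_num_den' (MvPolynomial σ ℤ) f).symm
  have hmul : s * q = p * t := by
    refine IsFractionRing.injective (MvPolynomial σ ℤ) (RatField σ) ?_
    rw [map_mul, map_mul]
    exact (div_eq_div_iff (algebraMap_ratField_ne_zero ht0)
      (algebraMap_ratField_ne_zero hq0)).1 (hst.symm.trans hf)
  have hdvd : t ∣ q :=
    (IsFractionRing.num_den_reduced (MvPolynomial σ ℤ) f).symm.dvd_of_dvd_mul_left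
      (Dvd.intro_left p hmul.symm)
  have htv : MvPolynomial.aeval v t ≠ 0 := by
    obtain ⟨u, hu⟩ := hdvd
    intro h0
    apply hq
    rw [hu, map_mul, h0, zero_mul]
  change MvPolynomial.aeval v s / MvPolynomial.aeval v t = _
  rw [div_eq_div_iff htv hq, ← map_mul, ← map_mul, hmul]

theorem add (hf : HasValue v f a) (hg : HasValue v g b) : HasValue v (f + g) (a + b) := by
  obtain ⟨p, q, hq, rfl, rfl⟩ := hf
  obtain ⟨p', q', hq', rfl, rfl⟩ := hg
  have h0 : q ≠ 0 := by rintro rfl; simp at hq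
  have h0' : q' ≠ 0 := by rintro rfl; simp at hq'
  refine ⟨p * q' + q * p', q * q', by rw [map_mul]; exact mul_ne_zero hq hq', ?_, ?_⟩
  · rw [div_add_div _ _ (algebraMap_ratField_ne_zero h0) (algebraMap_ratField_ne_zero h0')]
    simp only [map_add, map_mul]
  · rw [div_add_div _ _ hq hq']
    simp only [map_add, map_mul]

theorem mul (hf : HasValue v f a) (hg : HasValue v g b) : HasValue v (f * g) (a * b) := by
  obtain ⟨p, q, hq, rfl, rfl⟩ := hf
  obtain ⟨p', q', hq', rfl, rfl⟩ := hg
  refine ⟨p * p', q * q', by rw [map_mul]; exact mul_ne_zero hq hq', ?_, ?_⟩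
  · rw [div_mul_div_comm]; simp only [map_mul]
  · rw [div_mul_div_comm]; simp only [map_mul]

theorem inv (hf : HasValue v f a) (ha : a ≠ 0) : HasValue v f⁻¹ a⁻¹ := by
  obtain ⟨p, q, hq, rfl, rfl⟩ := hf
  exact ⟨q, p, fun h => ha (by rw [h, zero_div]), inv_div _ _, inv_div _ _⟩

theorem intCast (v : σ → K) (m : ℤ) : HasValue v (m : RatField σ) (m : K) :=
  ⟨m, 1, by simp, by simp, by simp⟩

theorem ratVar (v : σ → K) (i : σ) : HasValue v (ratVar i) (v i) :=
  ⟨MvPolynomial.X i, 1, by simp, by simp [QCluster.ratVar], by simp⟩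

theorem one (v : σ → K) : HasValue v 1 1 := by simpa using intCast v 1

theorem zero (v : σ → K) : HasValue v 0 0 := by simpa using intCast v 0

theorem zpow (hf : HasValue v f a) (ha : a ≠ 0) (m : ℤ) : HasValue v (f ^ m) (a ^ m) := by
  have hpow : ∀ k : ℕ, HasValue v (f ^ k) (a ^ k) := fun k => by
    induction k with
    | zero => simpa using one v
    | succ k ih => rw [pow_succ, pow_succ]; exact ih.mul hf
  cases m with
  | ofNat k => simpa using hpow k
  | negSucc k =>
    rw [zpow_negSucc, zpow_negSucc]
    exact (hpow _).inv (pow_ne_zero _ ha)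

theorem sum {α : Type} (s : Finset α) {f : α → RatField σ} {a : α → K}
    (h : ∀ i ∈ s, HasValue v (f i) (a i)) : HasValue v (∑ i ∈ s, f i) (∑ i ∈ s, a i) := by
  classical
  induction s using Finset.induction_on with
  | empty => simpa using zero v
  | insert i s hi ih =>
    rw [Finset.sum_insert hi, Finset.sum_insert hi]
    exact (h i (Finset.mem_insert_self i s)).add
      (ih fun k hk => h k (Finset.mem_insert_of_mem hk))

theorem prod {α : Type} (s : Finset α) {f : α → RatField σ} {a : α → K}
    (h : ∀ i ∈ s, HasValue v (f i) (a i)) : HasValue v (∏ i ∈ s, f i) (∏ i ∈ s, a i) := by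
  classical
  induction s using Finset.induction_on with
  | empty => simpa using one v
  | insert i s hi ih =>
    rw [Finset.prod_insert hi, Finset.prod_insert hi]
    exact (h i (Finset.mem_insert_self i s)).mul
      (ih fun k hk => h k (Finset.mem_insert_of_mem hk))

end HasValue

/-- The rational function `f` has a positive value at the point with all coordinates `1`. -/
def IsPosAtOne (f : RatField σ) : Prop := ∃ a : ℚ, 0 < a ∧ HasValue (fun _ => 1) f a

namespace IsPosAtOne

variable {f g : RatField σ}

theorem add (hf : IsPosAtOne f) (hg : IsPosAtOne g) : IsPosAtOne (f + g) := by
  obtain ⟨a, ha, h⟩ := hf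
  obtain ⟨b, hb, h'⟩ := hg
  exact ⟨a + b, add_pos ha hb, h.add h'⟩

theorem mul (hf : IsPosAtOne f) (hg : IsPosAtOne g) : IsPosAtOne (f * g) := by
  obtain ⟨a, ha, h⟩ := hf
  obtain ⟨b, hb, h'⟩ := hg
  exact ⟨a * b, mul_pos ha hb, h.mul h'⟩

theorem inv (hf : IsPosAtOne f) : IsPosAtOne f⁻¹ := by
  obtain ⟨a, ha, h⟩ := hf
  exact ⟨a⁻¹, inv_pos.2 ha, h.inv ha.ne'⟩

theorem prod_zpow {α : Type} (s : Finset α) {f : α → RatField σ} (h : ∀ i, IsPosAtOne (f i))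
    (e : α → ℤ) : IsPosAtOne (∏ i ∈ s, f i ^ e i) := by
  choose a ha h using h
  exact ⟨∏ i ∈ s, a i ^ e i, Finset.prod_pos fun i _ => zpow_pos (ha i) _,
    HasValue.prod s fun i _ => (h i).zpow (ha i).ne' _⟩

theorem ratVar (i : σ) : IsPosAtOne (ratVar i) := ⟨1, one_pos, HasValue.ratVar _ i⟩

theorem ne_zero (hf : IsPosAtOne f) : f ≠ 0 := by
  rintro rfl
  obtain ⟨a, ha, h⟩ := hf
  have h1 := h.evalRat_eq
  have h2 := (HasValue.zero (σ := σ) (fun _ => (1 : ℚ))).evalRat_eq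
  rw [h2] at h1
  exact ha.ne h1

end IsPosAtOne

end Values

/-! ### Adjoining principal coefficients -/

section Extend

variable {n r : ℕ}

/-- The exchange matrix `B` with the identity matrix placed below it. -/
def extendMatrix (B : ExchangeMatrix n r) : ExchangeMatrix n (r + n) := fun i l =>
  Sum.elim (fun i => B (Sum.inl i) l)
    (Fin.addCases (fun i => B (Sum.inr i) l) fun i => if i = l then 1 else 0) i

/-- The position in the principal matrix of a row of `extendMatrix B`. -/
def principalIndex : Fin n ⊕ Fin (r + n) → Option (Fin n ⊕ Fin n) :=
  Sum.elim (fun i => some (Sum.inl i)) (Fin.addCases (fun _ => none) fun i => some (Sum.inr i))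

/-- A form compatible with `extendMatrix B`. -/
def extendForm (r : ℕ) (d : Fin n → ℤ) (B₀ : Matrix (Fin n) (Fin n) ℤ) :
    Matrix (Fin n ⊕ Fin (r + n)) (Fin n ⊕ Fin (r + n)) ℤ := fun i j =>
  (principalIndex i).elim 0 fun a => (principalIndex j).elim 0 fun b => principalForm d B₀ 0 a b

theorem extendMatrix_comp (B : ExchangeMatrix n r) (i : Fin n ⊕ Fin r) (l : Fin n) :
    extendMatrix B (Sum.map id (Fin.castAdd n) i) l = B i l := by
  cases i <;> simp [extendMatrix]

/-- The form vanishes on the original frozen rows, so compatibility is that of the principal matrix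
formed by the remaining rows. No rank condition on `B` is needed. -/
theorem isCompatible_extend {d : Fin n → ℤ} {B₀ : Matrix (Fin n) (Fin n) ℤ}
    (hB₀ : (Matrix.diagonal d * B₀).transpose = -(Matrix.diagonal d * B₀))
    {B : ExchangeMatrix n r} (hB : ∀ i l, B (Sum.inl i) l = B₀ i l) :
    IsCompatible d (extendForm r d B₀) (extendMatrix B) := by
  obtain ⟨h1, h2⟩ := isCompatible_principalForm hB₀ (Λ := 0) (by simp)
  constructor
  · ext i j
    simp only [Matrix.transpose_apply, Matrix.neg_apply, extendForm]
    cases principalIndex i with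
    | none => cases principalIndex j <;> simp
    | some a =>
      cases principalIndex j with
      | none => simp
      | some b => exact congrFun (congrFun h1 a) b
  · ext l j
    have key : ∀ b, ∑ i, B₀ i l * principalForm d B₀ 0 (Sum.inl i) b +
        principalForm d B₀ 0 (Sum.inr l) b = Matrix.fromCols (Matrix.diagonal d) 0 l b := by
      intro b
      rw [← h2, Matrix.mul_apply, Fintype.sum_sum_type]
      simp [principalMatrix, Matrix.one_apply]
    have hsum : ((extendMatrix B).transpose * extendForm r d B₀) l j =
        (principalIndex j).elim 0 fun b => ∑ i, B₀ i l * principalForm d B₀ 0 (Sum.inl i) b +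
          principalForm d B₀ 0 (Sum.inr l) b := by
      rw [Matrix.mul_apply, Fintype.sum_sum_type, Fin.sum_univ_add]
      cases hj : principalIndex j with
      | none =>
        have he : ∀ o : Option (Fin n ⊕ Fin n), o.elim (0 : ℤ) (fun _ => 0) = 0 := by
          intro o; cases o <;> rfl
        simp [extendForm, hj, he]
      | some b =>
        have h1 : ∀ i : Fin n, principalIndex (r := r) (Sum.inl i) = some (Sum.inl i) :=
          fun i => rfl
        have h2 : ∀ i : Fin r, principalIndex (n := n) (Sum.inr (Fin.castAdd n i)) = none :=
          fun i => by simp [principalIndex]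
        have h3 : ∀ i : Fin n, principalIndex (Sum.inr (Fin.natAdd r i)) = some (Sum.inr i) :=
          fun i => by simp [principalIndex]
        simp [extendForm, hj, extendMatrix, h1, h2, h3, hB]
    rw [hsum]
    rcases j with j | j
    · exact key (Sum.inl j)
    · induction j using Fin.addCases with
      | left j => simp [principalIndex]
      | right j =>
        simp only [principalIndex, Sum.elim_inr, Fin.addCases_right, Option.elim_some]
        exact key (Sum.inr j)

end Extend

/-! ### Specialization at `q = 1` -/

section Specialize

variable {n r : ℕ}

/-- The specialization `q = 1` of the coefficients. -/
abbrev evalOne : QCoeff →+* ℤ := LaurentPolynomial.eval₂ (RingHom.id ℤ) 1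

theorem evalOne_T (a : ℤ) : evalOne (T a) = 1 := by simp [evalOne]

theorem prod_zpow_add {σ K : Type} [Fintype σ] [Field K] {x : σ → K} (hx : ∀ i, x i ≠ 0)
    (e f : σ → ℤ) : ∏ i, x i ^ (e i + f i) = (∏ i, x i ^ e i) * ∏ i, x i ^ f i := by
  rw [← Finset.prod_mul_distrib]
  exact Finset.prod_congr rfl fun i _ => zpow_add₀ (hx i) _ _

theorem prod_zpow_basisVec {K : Type} [Field K] (x : Fin n ⊕ Fin r → K) (l : Fin n) :
    ∏ i, x i ^ basisVec (r + n) l (Sum.map id (Fin.castAdd n) i) = x (Sum.inl l) := by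
  rw [Finset.prod_eq_single (Sum.inl l)]
  · simp
  · intro i _ hi
    have h : Sum.map id (Fin.castAdd n) i ≠ Sum.inl l := by rwa [Ne, map_eq_inl_iff]
    simp [basisVec, h]
  · simp

/-- The specialization of a quantum torus with `n + (r + n)` variables in which `q` and the last
`n` variables become `1`. -/
def specialize (L : Matrix (Fin n ⊕ Fin (r + n)) (Fin n ⊕ Fin (r + n)) ℤ) :
    QTorus L →+* RatField (Fin n ⊕ Fin r) :=
  QTorus.lift ((Int.castRingHom (RatField (Fin n ⊕ Fin r))).comp evalOne)
    (fun e => ∏ i, ratVar i ^ e (Sum.map id (Fin.castAdd n) i)) (fun _ _ => mul_comm _ _) (by simp)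
    fun e f => by
      rw [RingHom.comp_apply, evalOne_T, map_one, one_mul]
      exact (prod_zpow_add ratVar_ne_zero _ _).symm

variable {L : Matrix (Fin n ⊕ Fin (r + n)) (Fin n ⊕ Fin (r + n)) ℤ}

theorem specialize_mono (e : Fin n ⊕ Fin (r + n) → ℤ) (a : QCoeff) :
    specialize L (QTorus.mono e a) =
      (evalOne a : RatField _) * ∏ i, ratVar i ^ e (Sum.map id (Fin.castAdd n) i) :=
  QTorus.lift_mono e a

theorem specialize_X (e : Fin n ⊕ Fin (r + n) → ℤ) :
    specialize L (QTorus.X e) = ∏ i, ratVar i ^ e (Sum.map id (Fin.castAdd n) i) :=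
  QTorus.lift_X e

theorem specialize_T_smul (a : ℤ) (x : QTorus L) :
    specialize L ((T a : QCoeff) • x) = specialize L x := by
  refine (QTorus.lift_smul _ x).trans ?_
  rw [RingHom.comp_apply, evalOne_T, map_one, one_mul]
  rfl

variable {d : Fin n → ℤ} {B' : ExchangeMatrix n (r + n)}
  {ω : (Fin n ⊕ Fin (r + n) → ℤ) → (Fin n ⊕ Fin (r + n) → ℤ) → ℤ}

theorem specialize_foldSeed_monomial (S : QSeed d B' ω (ToricFrame.refl L).map)
    (hd : ∀ k l, 0 < d k * d l) (w : List (Fin n)) {x : Fin n ⊕ Fin r → RatField (Fin n ⊕ Fin r)}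
    (hx : ∀ i, x (Sum.inr i) = ratVar (Sum.inr i)) (hx0 : ∀ i, x i ≠ 0)
    (hl : ∀ l, ∃ m, (foldSeed d w ((ToricFrame.refl L).map, B')).1 (basisVec (r + n) l) =
      QTorus.num L m ∧ specialize L m = x (Sum.inl l))
    (u : Fin n ⊕ Fin (r + n) → ℤ) (hu : ∀ i : Fin n, 0 ≤ u (Sum.inl i)) :
    ∃ m, (foldSeed d w ((ToricFrame.refl L).map, B')).1 u = QTorus.num L m ∧
      specialize L m = ∏ i, x i ^ u (Sum.map id (Fin.castAdd n) i) := by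
  refine exponent_induction (p := fun u => ∃ m,
    (foldSeed d w ((ToricFrame.refl L).map, B')).1 u = QTorus.num L m ∧
      specialize L m = ∏ i, x i ^ u (Sum.map id (Fin.castAdd n) i)) ?_ ?_ u hu
  · intro u hu
    refine ⟨QTorus.X u, by rw [foldSeed_of_eq_zero S hd w hu, ToricFrame.refl_map], ?_⟩
    rw [specialize_X, Fintype.prod_sum_type, Fintype.prod_sum_type]
    simp [hu, hx]
  · rintro u l ⟨m, hm, hm'⟩
    obtain ⟨m₁, hm₁, hm₁'⟩ := hl l
    obtain ⟨ω', S'⟩ := S.foldSeed hd w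
    refine ⟨(T (-ω' u (basisVec (r + n) l)) : QCoeff) • (m * m₁), ?_, ?_⟩
    · rw [S'.map_add, hm, hm₁, QTorus.num_smul, map_mul]
    · rw [specialize_T_smul, map_mul, hm', hm₁']
      simp only [Pi.add_apply]
      rw [prod_zpow_add hx0, prod_zpow_basisVec]

/-! ### Classical seeds as specializations -/

theorem mutSeed_fst_self {K : Type} [Field K] (k : Fin n)
    (S : (Fin n ⊕ Fin r → K) × ExchangeMatrix n r) :
    (mutSeed k S).1 (Sum.inl k) = (S.1 (Sum.inl k))⁻¹ *
      (∏ i, S.1 i ^ max (S.2 i k) 0 + ∏ i, S.1 i ^ max (-S.2 i k) 0) :=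
  Function.update_self _ _ _

theorem mutSeed_fst_of_ne {K : Type} [Field K] {k : Fin n}
    (S : (Fin n ⊕ Fin r → K) × ExchangeMatrix n r) {i : Fin n ⊕ Fin r} (hi : i ≠ Sum.inl k) :
    (mutSeed k S).1 i = S.1 i :=
  Function.update_of_ne hi _ _

theorem foldl_mutSeed_append_singleton {K : Type} [Field K] (w : List (Fin n)) (k : Fin n)
    (x : Fin n ⊕ Fin r → K) (B : ExchangeMatrix n r) :
    (w ++ [k]).foldl (fun S k => mutSeed k S) (x, B) =
      mutSeed k (w.foldl (fun S k => mutSeed k S) (x, B)) := by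
  rw [List.foldl_append]
  rfl

theorem foldl_mutSeed_snd {K : Type} [Field K] (w : List (Fin n))
    (x : Fin n ⊕ Fin r → K) (B : ExchangeMatrix n r) :
    (w.foldl (fun S k => mutSeed k S) (x, B)).2 = foldMatrix w B := by
  induction w generalizing x B with
  | nil => rfl
  | cons k w ih => exact ih _ _

theorem foldl_mutSeed_inr {K : Type} [Field K] (w : List (Fin n))
    (x : Fin n ⊕ Fin r → K) (B : ExchangeMatrix n r) (i : Fin r) :
    (w.foldl (fun S k => mutSeed k S) (x, B)).1 (Sum.inr i) = x (Sum.inr i) := by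
  induction w using List.reverseRecOn with
  | nil => rfl
  | append_singleton w k ih =>
    rw [foldl_mutSeed_append_singleton, ← ih]
    exact mutSeed_fst_of_ne _ Sum.inr_ne_inl

/-- Exchange relations are subtraction-free. The purpose is to know that classical cluster variables
are nonzero and may be divided by. -/
theorem isPosAtOne_foldl_mutSeed (w : List (Fin n)) (B : ExchangeMatrix n r) (i : Fin n ⊕ Fin r) :
    IsPosAtOne ((w.foldl (fun S k => mutSeed k S) (ratVar, B)).1 i) := by
  induction w using List.reverseRecOn generalizing i with
  | nil => exact IsPosAtOne.ratVar i
  | append_singleton w k ih =>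
    rw [foldl_mutSeed_append_singleton]
    by_cases hi : i = Sum.inl k
    · subst hi
      rw [mutSeed_fst_self]
      exact (ih _).inv.mul
        ((IsPosAtOne.prod_zpow _ ih _).add (IsPosAtOne.prod_zpow _ ih _))
    · rw [mutSeed_fst_of_ne _ hi]
      exact ih i

/-- Cluster variables are Laurent polynomials in the quantum torus. -/
theorem exists_foldSeed_eq_num (hd : ∀ k l, 0 < d k * d l) {B₀ : Matrix (Fin n) (Fin n) ℤ}
    (hB₀ : (Matrix.diagonal d * B₀).transpose = -(Matrix.diagonal d * B₀))
    (hB' : ∀ i l, B' (Sum.inl i) l = B₀ i l) (S : QSeed d B' ω (ToricFrame.refl L).map)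
    (w : List (Fin n)) (j : Fin n) :
    ∃ m, (foldSeed d w ((ToricFrame.refl L).map, B')).1 (basisVec (r + n) j) = QTorus.num L m := by
  obtain ⟨F, -, hF⟩ := exists_quantum_fPolynomial hd hB₀ w j
  rw [hF _ B' hB' _ ω _ S (ToricFrame.linearIndependent _), torusHom_refl, ToricFrame.refl_map,
    ← map_mul]
  exact ⟨_, rfl⟩

/-- At `q = 1` and with the added variables equal to `1`, the quantum exchange relation, read inside
the torus, becomes the classical one; the old variable is nonzero, so the new one is determined. -/
theorem specialize_foldSeed (hd : ∀ k l, 0 < d k * d l) {B₀ : Matrix (Fin n) (Fin n) ℤ}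
    (hB₀ : (Matrix.diagonal d * B₀).transpose = -(Matrix.diagonal d * B₀))
    (hB' : ∀ i l, B' (Sum.inl i) l = B₀ i l) (S : QSeed d B' ω (ToricFrame.refl L).map)
    {B : ExchangeMatrix n r} (h : ∀ i l, B' (Sum.map id (Fin.castAdd n) i) l = B i l)
    (w : List (Fin n)) (j : Fin n) {m : QTorus L}
    (hm : (foldSeed d w ((ToricFrame.refl L).map, B')).1 (basisVec (r + n) j) = QTorus.num L m) :
    specialize L m = (w.foldl (fun S k => mutSeed k S) (ratVar, B)).1 (Sum.inl j) := by
  induction w using List.reverseRecOn generalizing j m with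
  | nil =>
    replace hm : (ToricFrame.refl L).map (basisVec (r + n) j) = QTorus.num L m := hm
    rw [ToricFrame.refl_map] at hm
    rw [← QTorus.num_injective hm, specialize_X, prod_zpow_basisVec]
    rfl
  | append_singleton w k ih =>
    obtain ⟨ω', S'⟩ := S.foldSeed hd w
    set x := (w.foldl (fun S k => mutSeed k S) (ratVar, B)).1 with hx
    have hl : ∀ l, ∃ m, (foldSeed d w ((ToricFrame.refl L).map, B')).1 (basisVec (r + n) l) =
        QTorus.num L m ∧ specialize L m = x (Sum.inl l) := fun l => by
      obtain ⟨m, hm⟩ := exists_foldSeed_eq_num hd hB₀ hB' S w l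
      exact ⟨m, hm, ih l hm⟩
    have hx0 : ∀ i, x i ≠ 0 := fun i => (isPosAtOne_foldl_mutSeed w B i).ne_zero
    rw [foldSeed_append_singleton] at hm
    rw [foldl_mutSeed_append_singleton]
    by_cases hj : j = k
    · subst hj
      rw [mutSeed_fst_self, foldl_mutSeed_snd, ← hx]
      obtain ⟨α, hα⟩ := S'.exchange (QSeed.ne_zero hd j)
      have hmon := specialize_foldSeed_monomial S hd w (foldl_mutSeed_inr w ratVar B) hx0 hl
      obtain ⟨m₁, hm₁, hm₁'⟩ := hmon (fun i => max 0 (-foldMatrix w B' i j))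
        fun i => le_max_left _ _
      obtain ⟨m₂, hm₂, hm₂'⟩ := hmon (fun i => max 0 (foldMatrix w B' i j))
        fun i => le_max_left _ _
      obtain ⟨m₀, hm₀, hm₀'⟩ := hl j
      rw [hm, hm₀, hm₁, hm₂, ← QTorus.num_smul, ← QTorus.num_smul, ← map_mul, ← map_add] at hα
      have hs := congrArg (specialize L) (QTorus.num_injective hα)
      rw [map_mul, map_add, specialize_T_smul, specialize_T_smul, hm₀', hm₁', hm₂'] at hs
      simp only [foldMatrix_comp h, max_comm (0 : ℤ)] at hs
      rw [eq_inv_mul_iff_mul_eq₀ (hx0 _), mul_comm, hs, add_comm]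
    · rw [mutSeed_fst_of_ne _ (by simpa using hj)]
      refine ih j ?_
      rw [← hm, S'.mutFrame_of_eq_zero (QSeed.ne_zero hd k)]
      simpa [Pi.single_apply] using Ne.symm hj

/-- The Laurent expansion of a cluster variable obtained from the quantum F-polynomial. -/
theorem clusterVar_eq_sum (hd : ∀ k l, 0 < d k * d l) {B₀ : Matrix (Fin n) (Fin n) ℤ}
    (hB₀ : (Matrix.diagonal d * B₀).transpose = -(Matrix.diagonal d * B₀)) (t : TreeVertex n)
    (j : Fin n) {F : QTorus (Matrix.diagonal d * B₀)}
    (hF : ∀ (r : ℕ) (B : ExchangeMatrix n r) (hB : ∀ i l, B (Sum.inl i) l = B₀ i l)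
        (K : Type) [DivisionRing K] [Algebra QCoeff K] [FaithfulSMul QCoeff K]
        (ω : (Fin n ⊕ Fin r → ℤ) → (Fin n ⊕ Fin r → ℤ) → ℤ) (M : (Fin n ⊕ Fin r → ℤ) → K)
        (S : QSeed d B ω M), LinearIndependent QCoeff M →
      (foldSeed d t.1 (M, B)).1 (basisVec r j) = S.torusHom hB F * M (extG t.1 B₀ j B))
    {B : ExchangeMatrix n r} (hB : ∀ i l, B (Sum.inl i) l = B₀ i l) :
    clusterVar B t j = (∑ c ∈ F.supp, (evalOne (F.coeff c) : RatField (Fin n ⊕ Fin r)) *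
      ∏ i, ratVar i ^ B.mulVec c i) * ∏ i, ratVar i ^ extG t.1 B₀ j B i := by
  have hB' : ∀ i l, extendMatrix B (Sum.inl i) l = B₀ i l := hB
  have S := (ToricFrame.refl (extendForm r d B₀)).qSeed (d := d) (B := extendMatrix B)
    (by rw [ToricFrame.refl_form]; exact isCompatible_extend hB₀ hB)
  have h := hF _ (extendMatrix B) hB' _ _ _ S (ToricFrame.linearIndependent _)
  rw [torusHom_refl, ToricFrame.refl_map, ← map_mul] at h
  refine (specialize_foldSeed hd hB₀ hB' S (extendMatrix_comp B) t.1 j h).symm.trans ?_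
  rw [map_mul, map_sum, specialize_X]
  simp only [specialize_mono]
  congr 1
  · refine Finset.sum_congr rfl fun c _ => ?_
    congr 1
    refine Finset.prod_congr rfl fun i _ => ?_
    congr 1
    simp only [Matrix.mulVec, dotProduct, extendMatrix_comp]
  · refine Finset.prod_congr rfl fun i _ => ?_
    congr 1
    exact congrFun (extG_comp (extendMatrix_comp B) t.1 B₀ j) i

end Specialize

/-! ### Classical F-polynomials and g-vectors -/

section Classical

variable {n r : ℕ} {d : Fin n → ℤ} {B₀ : Matrix (Fin n) (Fin n) ℤ}

/-- The columns of the principal matrix have degree `0`, so every term of the expansion has the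
degree of the common factor. -/
theorem isGVector_of_clusterVar_eq_sum {t : TreeVertex n} {j : Fin n} {g : Fin n → ℤ}
    {F : QTorus (Matrix.diagonal d * B₀)}
    (h : clusterVar (principalMatrix B₀) t j =
      (∑ c ∈ F.supp, (evalOne (F.coeff c) : RatField (Fin n ⊕ Fin n)) *
        ∏ i, ratVar i ^ (principalMatrix B₀).mulVec c i) * ∏ i, ratVar i ^ (Sum.elim g 0 : _ → ℤ) i) :
    IsGVector B₀ t j g := by
  classical
  refine ⟨∑ c ∈ F.supp, Finsupp.single ((principalMatrix B₀).mulVec c + Sum.elim g 0)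
    (evalOne (F.coeff c)), ?_, ?_⟩
  · rw [h, ← Finsupp.sum_finsetSum_index (by simp) (by intros; push_cast; ring), Finset.sum_mul]
    refine Finset.sum_congr rfl fun c _ => ?_
    rw [Finsupp.sum_single_index (by simp), mul_assoc]
    simp only [Pi.add_apply]
    rw [prod_zpow_add ratVar_ne_zero]
  · intro e he
    obtain ⟨c, -, hc⟩ := Finset.mem_biUnion.1 (Finsupp.support_finsetSum he)
    rw [Finset.mem_singleton.1 (Finsupp.support_single_subset hc), laurentDegree_add,
      laurentDegree_mulVec, zero_add]
    funext i
    simp [laurentDegree]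

/-- Setting `x_i = 1` leaves only the identity block of the exponent `B̃ c`, so the monomial becomes
`u^c` and the factor with exponent `g` becomes `1`. -/
theorem fPoly_eq_of_clusterVar_eq_sum {t : TreeVertex n} {j : Fin n} {g : Fin n → ℤ}
    {F : QTorus (Matrix.diagonal d * B₀)}
    (h : clusterVar (principalMatrix B₀) t j =
      (∑ c ∈ F.supp, (evalOne (F.coeff c) : RatField (Fin n ⊕ Fin n)) *
        ∏ i, ratVar i ^ (principalMatrix B₀).mulVec c i) * ∏ i, ratVar i ^ (Sum.elim g 0 : _ → ℤ) i) :
    fPoly B₀ t j = F.atOne := by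
  set v : Fin n ⊕ Fin n → RatField (Fin n) := Sum.elim (fun _ => 1) ratVar with hv
  have hv0 : ∀ i, v i ≠ 0 := by
    rintro (i | i)
    · exact one_ne_zero
    · exact ratVar_ne_zero i
  have hmon : ∀ e : Fin n ⊕ Fin n → ℤ, HasValue v (∏ i, ratVar i ^ e i) (∏ i, v i ^ e i) :=
    fun e => HasValue.prod _ fun i _ => (HasValue.ratVar v i).zpow (hv0 i) _
  refine HasValue.evalRat_eq ?_
  rw [h]
  have key := (HasValue.sum F.supp fun c _ =>
    (HasValue.intCast v (evalOne (F.coeff c))).mul (hmon ((principalMatrix B₀).mulVec c))).mul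
      (hmon (Sum.elim g 0))
  convert key using 1
  simp [hv, Fintype.prod_sum_type, principalMatrix_mulVec_inr, QTorus.atOne]

theorem zpow_finset_sum {α K : Type} [Field K] {x : K} (hx : x ≠ 0) (s : Finset α) (f : α → ℤ) :
    x ^ (∑ i ∈ s, f i) = ∏ i ∈ s, x ^ f i := by
  classical
  induction s using Finset.induction_on with
  | empty => simp
  | insert i s hi ih => rw [Finset.sum_insert hi, Finset.prod_insert hi, zpow_add₀ hx, ih]

theorem evalRat_atOne (F : QTorus (Matrix.diagonal d * B₀)) (B : ExchangeMatrix n r) :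
    evalRat (fun l => ∏ i, ratVar i ^ B i l) F.atOne =
      ∑ c ∈ F.supp, (evalOne (F.coeff c) : RatField (Fin n ⊕ Fin r)) *
        ∏ i, ratVar i ^ B.mulVec c i := by
  refine HasValue.evalRat_eq ?_
  refine HasValue.sum _ fun c _ => (HasValue.intCast _ _).mul ?_
  have h := HasValue.prod (v := fun l => ∏ i, (ratVar i : RatField (Fin n ⊕ Fin r)) ^ B i l)
    Finset.univ fun l _ => (HasValue.ratVar _ l).zpow
      (Finset.prod_ne_zero_iff.2 fun i _ => zpow_ne_zero _ (ratVar_ne_zero i)) (c l)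
  convert h using 1
  simp only [← Finset.prod_zpow]
  rw [Finset.prod_comm]
  refine Finset.prod_congr rfl fun i _ => ?_
  simp only [← zpow_mul, Matrix.mulVec, dotProduct]
  exact zpow_finset_sum (ratVar_ne_zero i) _ _

end Classical

end

end QCluster

theorem theorem5 {n : ℕ} (B : Matrix (Fin n) (Fin n) ℤ) (d : Fin n → ℤ) (hd : ∀ i, 0 < d i)
    (hB : (Matrix.diagonal d * B).transpose = -(Matrix.diagonal d * B))
    (t : QCluster.TreeVertex n) (j : Fin n) :
    ∃ g : Fin n → ℤ, QCluster.IsGVector B t j g ∧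
    ∃ F : QCluster.QTorus (Matrix.diagonal d * B), F.IsPolynomial ∧
      -- principal coefficients, for every `Λ`, with uniqueness of `F`
      (∀ Λ : Matrix (Fin n) (Fin n) ℤ, Λ.transpose = -Λ →
        ∀ (L : Matrix (Fin n ⊕ Fin n) (Fin n ⊕ Fin n) ℤ) (M₀ : QCluster.ToricFrame L),
          M₀.form = QCluster.principalForm d B Λ →
          QCluster.quantumVar d M₀ (QCluster.principalMatrix B) t j
              = F.evalAt (QCluster.hatY M₀ (QCluster.principalMatrix B)) *
                M₀.map (Sum.elim g 0) ∧
            ∀ F' : QCluster.QTorus (Matrix.diagonal d * B), F'.IsPolynomial →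
              QCluster.quantumVar d M₀ (QCluster.principalMatrix B) t j
                = F'.evalAt (QCluster.hatY M₀ (QCluster.principalMatrix B)) *
                  M₀.map (Sum.elim g 0) →
              F' = F) ∧
      -- arbitrary coefficients; `l` is twice `λ_{j;t}`
      (∀ (r : ℕ) (Bt : QCluster.ExchangeMatrix n r), Bt.toRows₁ = B →
        ∃ gt : Fin n ⊕ Fin r → ℤ, QCluster.IsExtendedGVector Bt t j gt ∧
        ∃ l : ℤ, ∀ (L : Matrix (Fin n ⊕ Fin r) (Fin n ⊕ Fin r) ℤ) (M₀ : QCluster.ToricFrame L),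
          QCluster.IsCompatible d M₀.form Bt →
          QCluster.quantumVar d M₀ Bt t j
            = QCluster.qHalf (QCluster.QField L) ^ l * F.evalAt (QCluster.hatY M₀ Bt) *
              M₀.map gt) ∧
      -- specialization at `q = 1`
      F.atOne = QCluster.fPoly B t j := by
  have hd' : ∀ k l, 0 < d k * d l := fun k l => mul_pos (hd k) (hd l)
  obtain ⟨F, hpoly, hF⟩ := QCluster.exists_quantum_fPolynomial hd' hB t.1 j
  have hcl := QCluster.clusterVar_eq_sum hd' hB t j hF (QCluster.principalMatrix_inl B)
  rw [QCluster.extG_principalMatrix] at hcl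
  have hone := QCluster.fPoly_eq_of_clusterVar_eq_sum hcl
  refine ⟨QCluster.gVec t.1 B j, QCluster.isGVector_of_clusterVar_eq_sum hcl, F, hpoly,
    fun Λ hΛ L M₀ hM₀ => ?_, fun r Bt hBt => ?_, hone.symm⟩
  · have S := M₀.qSeed (hM₀ ▸ QCluster.isCompatible_principalForm hB hΛ)
    have hinl := QCluster.principalMatrix_inl B
    have hev : ∀ F' : QCluster.QTorus (Matrix.diagonal d * B),
        F'.evalAt (QCluster.hatY M₀ (QCluster.principalMatrix B)) = S.torusHom hinl F' :=
      fun F' => S.evalAt_eq hinl F'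
    have hq : QCluster.quantumVar d M₀ (QCluster.principalMatrix B) t j =
        S.torusHom hinl F * M₀.map (Sum.elim (QCluster.gVec t.1 B j) 0) := by
      rw [← QCluster.extG_principalMatrix]
      exact hF _ _ hinl _ _ _ S M₀.linearIndependent
    -- Uniqueness: the monomial factor cancels and evaluation at `Ŷ` is injective. It holds among
    -- all Laurent polynomials in the `Z_i`.
    refine ⟨by rw [hq, hev], fun F' _ h => ?_⟩
    rw [hq, hev] at h
    exact (S.torusHom_injective hd' M₀.linearIndependent hinl
      (mul_right_cancel₀ (S.map_ne_zero _) h)).symm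
  · have hinl : ∀ i l, Bt (Sum.inl i) l = B i l := fun i l => congrFun (congrFun hBt i) l
    -- The exponent `λ` is `0`: the power of `q` that separates `F(Ŷ)` from the extended monomial
    -- already equals the one for principal coefficients.
    refine ⟨QCluster.extG t.1 B j Bt, ?_, 0, fun L M₀ hM₀ => ?_⟩
    · rw [QCluster.IsExtendedGVector, hBt, hone, QCluster.evalRat_atOne]
      exact QCluster.clusterVar_eq_sum hd' hB t j hF hinl
    · have S := M₀.qSeed hM₀
      rw [zpow_zero, one_mul]
      refine (hF _ _ hinl _ _ _ S M₀.linearIndependent).trans ?_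
      rw [← S.evalAt_eq hinl F]
      rfl
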